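/- Let $G=(V,E)$ be a finite digraph (self-loops allowed) with $n=|V|$ vertices, where an arc $(u,v)$ means that $u$ attacks $v$. A set $S\subseteq V$ is admissible if no arc has both endpoints in $S$ and, for every $v\in S$ and every arc $(u,v)\in E$, there is an arc $(w,u)\in E$ with $w\in S$; a preferred extension is an inclusion-wise maximal admissible set. Let $r(G)$ be the number of vertices that belong to a 2-cycle (two distinct vertices joined by arcs in both directions). The equation $1-x^{-1}-x^{-8}=0$ has a unique positive root $\varphi$; it satisfies $\varphi<1.2321$ and $\varphi^2<1.5180$, and the following hold. (1) There are constants $C,c$ such that every finite digraph $G$ has at most $$\min\left(\varphi^{2r(G)}\varphi^{\,n-r(G)},\;\; C(n+1)^c\left(1+2^{1/4}-\tfrac1{\sqrt2}\right)^{r(G)}\left(2-\tfrac1{\sqrt2}\right)^{n-r(G)},\;\; 3^{n/3}\right)$$ preferred extensions. In particular it has at most $1.5180^{\,r(G)}\cdot1.2321^{\,n-r(G)}$ preferred extensions. (2) There is an algorithm that, given the adjacency matrix of a digraph $G$ on $n$ vertices, outputs a list containing each preferred extension of $G$ exactly once and nothing else, in time $O^*\!\left(\varphi^{2r(G)}\varphi^{\,n-r(G)}\right)$,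 where $O^*$ hides a factor polynomial in $n$; its running time is also $O\!\left(1.5180^{\,r(G)}\cdot1.2321^{\,n-r(G)}\right)$. -/

import Mathlib

/-! ### Argumentation frameworks: finite digraphs `G`, where `G.Adj u v` reads "`u` attacks `v`".
Self-loops are allowed. -/

namespace Digraph

variable {V : Type*}

/-- No arc of `G` has both endpoints in `S`. -/
def IsConflictFree (G : Digraph V) (S : Finset V) : Prop :=
  ∀ u ∈ S, ∀ v ∈ S, ¬ G.Adj u v

/-- Every attacker of `v` is attacked by a member of `S`. -/
def IsAcceptable (G : Digraph V) (S : Finset V) (v : V) : Prop :=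
  ∀ u, G.Adj u v → ∃ w ∈ S, G.Adj w u

/-- `S` is conflict-free and each of its members is acceptable with respect to `S`. -/
def IsAdmissible (G : Digraph V) (S : Finset V) : Prop :=
  G.IsConflictFree S ∧ ∀ v ∈ S, G.IsAcceptable S v

/-- A preferred extension: an inclusion-wise maximal admissible set. -/
def IsPreferred (G : Digraph V) (S : Finset V) : Prop :=
  Maximal G.IsAdmissible S

/-- The number of preferred extensions. -/
noncomputable def numPreferred (G : Digraph V) : ℕ :=
  {S : Finset V | G.IsPreferred S}.ncard

/-- The resolution order `r(G)`: the number of vertices that belong to a 2-cycle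
(a loop is not a 2-cycle). -/
noncomputable def resolutionOrder (G : Digraph V) : ℕ :=
  {v : V | ∃ u, u ≠ v ∧ G.Adj u v ∧ G.Adj v u}.ncard

end Digraph

/-! ### Machine model: a first-order recursive language on binary trees.

Every value is a binary tree, represented in memory by a pointer to an immutable cell. Each
instruction inspects or allocates at most one cell and costs one time unit, so `t` units of time
are `O(t)` steps of a random access machine on words of `O(log t)` bits. -/

/-- Binary trees (the values of the language). -/
inductive TreeData : Type
  | nil : TreeData
  | cons : TreeData → TreeData → TreeData

namespace TreeData

/-- The first component of a pair (`nil` for `nil`). -/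
def head : TreeData → TreeData
  | nil => nil
  | cons a _ => a

/-- The second component of a pair (`nil` for `nil`). -/
def tail : TreeData → TreeData
  | nil => nil
  | cons _ b => b

/-- A list is stored as a chain of pairs that ends in `nil`. -/
def ofList : List TreeData → TreeData
  | [] => nil
  | a :: l => cons a (ofList l)

/-- A bit: `false` is `nil`, `true` is the pair of two `nil`s. -/
def ofBool : Bool → TreeData
  | false => nil
  | true => cons nil nil

open Classical in
/-- A digraph on `{0, …, n - 1}` is presented by its adjacency matrix, row by row. -/
noncomputable def ofDigraph {n : ℕ} (G : Digraph (Fin n)) : TreeData :=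
  ofList ((List.finRange n).map fun i =>
    ofList ((List.finRange n).map fun j => ofBool (decide (G.Adj i j))))

/-- A set of vertices is presented by its characteristic bit vector. -/
def ofFinset {n : ℕ} (S : Finset (Fin n)) : TreeData :=
  ofList ((List.finRange n).map fun i => ofBool (decide (i ∈ S)))

end TreeData

/-- Programs; each maps an input tree to an output tree. -/
inductive TreeProg : Type
  /-- return the input -/
  | id : TreeProg
  /-- return `nil` -/
  | nil : TreeProg
  /-- return the first component of the input -/
  | head : TreeProg
  /-- return the second component of the input -/
  | tail : TreeProg
  /-- run both programs on the input and return the pair of the results -/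
  | pair : TreeProg → TreeProg → TreeProg
  /-- run the first program on the input, then the second on its result -/
  | seq : TreeProg → TreeProg → TreeProg
  /-- run the first program on the input; continue on the same input with the second one if the
  result is a pair, with the third one if it is `nil` -/
  | branch : TreeProg → TreeProg → TreeProg → TreeProg
  /-- run the given program as a recursive procedure -/
  | procedure : TreeProg → TreeProg
  /-- call the innermost enclosing procedure on the input -/
  | call : TreeProg

namespace TreeProg

open TreeData in
/-- `Eval f p x y t`: inside the procedure with body `f`, the program `p` started on `x` halts with
result `y` after exactly `t` units of time. -/
inductive Eval : TreeProg → TreeProg → TreeData → TreeData → ℕ → Prop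
  | id (f : TreeProg) (x : TreeData) : Eval f .id x x 1
  | nil (f : TreeProg) (x : TreeData) : Eval f .nil x .nil 1
  | head (f : TreeProg) (x : TreeData) : Eval f .head x x.head 1
  | tail (f : TreeProg) (x : TreeData) : Eval f .tail x x.tail 1
  | pair {f p q : TreeProg} {x y z : TreeData} {s t : ℕ} :
      Eval f p x y s → Eval f q x z t → Eval f (.pair p q) x (.cons y z) (s + t + 1)
  | seq {f p q : TreeProg} {x y z : TreeData} {s t : ℕ} :
      Eval f p x y s → Eval f q y z t → Eval f (.seq p q) x z (s + t + 1)
  | branch_cons {f p q r : TreeProg} {x a b y : TreeData} {s t : ℕ} :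
      Eval f p x (.cons a b) s → Eval f q x y t → Eval f (.branch p q r) x y (s + t + 1)
  | branch_nil {f p q r : TreeProg} {x y : TreeData} {s t : ℕ} :
      Eval f p x .nil s → Eval f r x y t → Eval f (.branch p q r) x y (s + t + 1)
  | procedure {f p : TreeProg} {x y : TreeData} {t : ℕ} :
      Eval p p x y t → Eval f (.procedure p) x y (t + 1)
  | call {f : TreeProg} {x y : TreeData} {t : ℕ} :
      Eval f f x y t → Eval f .call x y (t + 1)

/-- The program `p` halts on `x` with result `y` after exactly `t` units of time
(at top level, `call` calls `p` itself). -/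
def Runs (p : TreeProg) (x y : TreeData) (t : ℕ) : Prop :=
  Eval p p x y t

/-- The language is deterministic: the result and the time are functions of the input. -/
theorem Eval.unique {f p : TreeProg} {x y y' : TreeData} {t t' : ℕ}
    (h : Eval f p x y t) (h' : Eval f p x y' t') : y = y' ∧ t = t' := by
  induction h generalizing y' t' with
  | id | nil | head | tail => cases h'; exact ⟨rfl, rfl⟩
  | pair _ _ ih₁ ih₂ =>
    cases h' with
    | pair h₁ h₂ =>
      obtain ⟨rfl, rfl⟩ := ih₁ h₁
      obtain ⟨rfl, rfl⟩ := ih₂ h₂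
      exact ⟨rfl, rfl⟩
  | seq _ _ ih₁ ih₂ =>
    cases h' with
    | seq h₁ h₂ =>
      obtain ⟨rfl, rfl⟩ := ih₁ h₁
      obtain ⟨rfl, rfl⟩ := ih₂ h₂
      exact ⟨rfl, rfl⟩
  | branch_cons _ _ ih₁ ih₂ =>
    cases h' with
    | branch_cons h₁ h₂ =>
      obtain ⟨-, rfl⟩ := ih₁ h₁
      obtain ⟨rfl, rfl⟩ := ih₂ h₂
      exact ⟨rfl, rfl⟩
    | branch_nil h₁ h₂ => exact absurd (ih₁ h₁).1 (by simp)
  | branch_nil _ _ ih₁ ih₂ =>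
    cases h' with
    | branch_cons h₁ h₂ => exact absurd (ih₁ h₁).1 (by simp)
    | branch_nil h₁ h₂ =>
      obtain ⟨-, rfl⟩ := ih₁ h₁
      obtain ⟨rfl, rfl⟩ := ih₂ h₂
      exact ⟨rfl, rfl⟩
  | procedure _ ih =>
    cases h' with
    | procedure h₁ =>
      obtain ⟨rfl, rfl⟩ := ih h₁
      exact ⟨rfl, rfl⟩
  | call _ ih =>
    cases h' with
    | call h₁ =>
      obtain ⟨rfl, rfl⟩ := ih h₁
      exact ⟨rfl, rfl⟩

/-- On the digraph `G`, the program `p` halts after exactly `t` units of time, and its output is a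
list that contains each preferred extension of `G` exactly once and nothing else. -/
def EnumeratesPreferredIn (p : TreeProg) {n : ℕ} (G : Digraph (Fin n)) (t : ℕ) : Prop :=
  ∃ L : List (Finset (Fin n)), L.Nodup ∧ (∀ S, S ∈ L ↔ G.IsPreferred S) ∧
    p.Runs (.ofDigraph G) (.ofList (L.map .ofFinset)) t

end TreeProg

/-! ### Reducing an active set of vertices -/

section Iterate

variable {V : Type*}

/-! The counting bounds with bases φ and √2 and the algorithm all branch on an active set `A`, the
vertices that may still enter an admissible set. If some attacker of `w` is attacked in `A` only by
vertices joined to `w`, then no admissible subset of `A` contains `w`; deleting such vertices until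
none is left gives `reduct A`. In a reduced set only directed cycles leave a choice: `attackCore`
consists of the vertices that start an infinite walk in `A`, and if it is empty then `A` is
conflict-free (`IsReduced.isConflictFree`). Such an `A` contains at most one preferred extension,
and its largest admissible subset is `defenceCore A`.

First bound. The measure `weight` counts the vertices of the attack core, and once more those in
2-cycles, so it is at most n + r. A branching either selects the first member of a set `W` or
rejects all of `W`; here `W` is a single vertex or the set of attackers of some `u`.
`IsReduced.exists_goodBranch` finds a branching whose children satisfy ∑ φ ^ weight ≤ φ ^ weight of
the parent; the extreme case, drops of 8 and 1, is the equation of φ. With a 2-cycle present this is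
direct. Without one, the core contains as many arcs into vertices as out of them, so if every easy
branching fails then each vertex has equally many attackers and targets, two or three of each, and a
local argument finishes.

Second bound. Another branching shows that the sum of 2 ^ (|S| / 2) over the preferred S ⊆ A is at
most 2 ^ (|A| / 2 + m / 4), where m counts the vertices in 2-cycles inside A
(`sum_preferredIn_pow_le`). Averaging over random supersets A of S, with every further vertex kept
with probability 1/√2, turns this into a product over vertices, and no polynomial factor appears.

Third bound. Distinct preferred extensions are joined by an arc, since otherwise their union would
be admissible. The Moon–Moser induction applies to any family of pairwise conflicting independent
sets (`PairwiseConflicting.card_le`).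

Algorithm. The tree of the first bound is evaluated bottom-up, listing the maximal admissible
subsets of the current active set. A set found after rejecting `v` fails to be maximal exactly if it
is the core of T \ {v} for some T found after selecting `v` (`isPreferredIn_iff_split`). This is a
dictionary lookup, done in a trie in O(n) steps, so merging is linear in the number of listed sets
and the total time is a polynomial times the bound on the number of leaves (`eval_solveBody`). The
`PolyTime` combinators supply the polynomial subroutines. Since the decimal constants are strictly
larger than φ² and φ, they absorb the polynomial. -/

theorem iterate_subset {f : Finset V → Finset V} (hf : ∀ A, f A ⊆ A) (k : ℕ) (A : Finset V) :
    f^[k] A ⊆ A := by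
  induction k generalizing A with
  | zero => exact subset_rfl
  | succ k ih => exact (ih (f A)).trans (hf A)

theorem subset_iterate {f : Finset V → Finset V} {Q : Finset V} (h : ∀ A, Q ⊆ A → Q ⊆ f A) (k : ℕ)
    {A : Finset V} (hA : Q ⊆ A) : Q ⊆ f^[k] A := by
  induction k generalizing A with
  | zero => exact hA
  | succ k ih => exact ih (h A hA)

/-- Each step that changes the set loses a vertex, so there are at most `Fintype.card V` such steps.
-/
theorem iterate_card_fixed [Fintype V] {f : Finset V → Finset V} (hf : ∀ A, f A ⊆ A)
    (A : Finset V) : f (f^[Fintype.card V] A) = f^[Fintype.card V] A := by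
  have key : ∀ k, f (f^[k] A) = f^[k] A ∨ (f^[k] A).card + k ≤ Fintype.card V := by
    intro k
    induction k with
    | zero => exact Or.inr (by simpa using Finset.card_le_univ A)
    | succ k ih =>
      rw [Function.iterate_succ_apply']
      by_cases h : f (f^[k] A) = f^[k] A
      · exact Or.inl (by rw [h, h])
      · have := Finset.card_lt_card ((hf (f^[k] A)).ssubset_of_ne h)
        have := ih.resolve_left h
        exact Or.inr (by omega)
  rcases key (Fintype.card V) with h | h
  · exact h
  · have h0 : f^[Fintype.card V] A = ∅ := by
      rw [← Finset.card_eq_zero]; omega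
    rw [h0]
    exact Finset.subset_empty.1 (hf ∅)

end Iterate

namespace Digraph

open scoped Classical

variable {V : Type*} (G : Digraph V)

/-- `u` and `v` are joined by an arc. -/
def Nbr (u v : V) : Prop := G.Adj u v ∨ G.Adj v u

theorem Nbr.symm {G : Digraph V} {u v : V} (h : G.Nbr u v) : G.Nbr v u := Or.symm h

/-- No vertex `w` of `A` has an attacker all of whose attackers in `A` are joined to `w`. -/
def IsReduced (A : Finset V) : Prop :=
  ∀ w ∈ A, ∀ x, G.Adj x w → ∃ y ∈ A, G.Adj y x ∧ ¬ G.Nbr y w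

/-- Delete the vertices that no admissible subset of `A` can contain for a local reason. -/
noncomputable def reduceStep (A : Finset V) : Finset V :=
  {w ∈ A | ∀ x, G.Adj x w → ∃ y ∈ A, G.Adj y x ∧ ¬ G.Nbr y w}

/-- Delete the vertices of `A` that attack no vertex of `A`. -/
noncomputable def attackStep (A : Finset V) : Finset V :=
  {v ∈ A | ∃ u ∈ A, G.Adj v u}

/-- Delete the vertices of `A` that are not acceptable with respect to `A`. -/
noncomputable def defenceStep (A : Finset V) : Finset V :=
  {v ∈ A | G.IsAcceptable A v}

/-- The vertices of `A` that belong to a 2-cycle inside `A`. -/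
noncomputable def mutualSet (A : Finset V) : Finset V :=
  {v ∈ A | ∃ u ∈ A, u ≠ v ∧ G.Adj u v ∧ G.Adj v u}

variable {G} in
theorem mem_reduceStep {A : Finset V} {w : V} : w ∈ G.reduceStep A ↔
    w ∈ A ∧ ∀ x, G.Adj x w → ∃ y ∈ A, G.Adj y x ∧ ¬ G.Nbr y w := by
  simp [reduceStep]

variable {G} in
theorem mem_mutualSet {A : Finset V} {v : V} : v ∈ G.mutualSet A ↔
    v ∈ A ∧ ∃ u ∈ A, u ≠ v ∧ G.Adj u v ∧ G.Adj v u := by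
  simp [mutualSet]

variable {G} in
theorem mem_attackStep {A : Finset V} {v : V} :
    v ∈ G.attackStep A ↔ v ∈ A ∧ ∃ u ∈ A, G.Adj v u := by
  simp [attackStep]

variable {G} in
theorem mem_defenceStep {A : Finset V} {v : V} :
    v ∈ G.defenceStep A ↔ v ∈ A ∧ G.IsAcceptable A v := by
  simp [defenceStep]

theorem reduceStep_subset (A : Finset V) : G.reduceStep A ⊆ A := Finset.filter_subset _ _
theorem attackStep_subset (A : Finset V) : G.attackStep A ⊆ A := Finset.filter_subset _ _
theorem defenceStep_subset (A : Finset V) : G.defenceStep A ⊆ A := Finset.filter_subset _ _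
theorem mutualSet_subset (A : Finset V) : G.mutualSet A ⊆ A := Finset.filter_subset _ _

variable {G}

/-- The defender that `S` supplies lies in `S`, hence in `A`, and conflict-freeness of `S` keeps it
from being joined to the vertex it defends. -/
theorem IsAdmissible.subset_reduceStep {S A : Finset V} (hS : G.IsAdmissible S) (h : S ⊆ A) :
    S ⊆ G.reduceStep A := by
  intro w hw
  refine Finset.mem_filter.2 ⟨h hw, fun x hx => ?_⟩
  obtain ⟨y, hy, hyx⟩ := hS.2 w hw x hx
  exact ⟨y, h hy, hyx, fun hn => hn.elim (hS.1 y hy w hw) (hS.1 w hw y hy)⟩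

theorem IsAdmissible.subset_defenceStep {S A : Finset V} (hS : G.IsAdmissible S) (h : S ⊆ A) :
    S ⊆ G.defenceStep A := by
  intro v hv
  refine Finset.mem_filter.2 ⟨h hv, fun u hu => ?_⟩
  obtain ⟨w, hw, hwu⟩ := hS.2 v hv u hu
  exact ⟨w, h hw, hwu⟩

theorem mutualSet_mono {A A' : Finset V} (h : A' ⊆ A) : G.mutualSet A' ⊆ G.mutualSet A := by
  intro v hv
  obtain ⟨hv, u, hu, h'⟩ := mem_mutualSet.1 hv
  exact mem_mutualSet.2 ⟨h hv, u, h hu, h'⟩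

theorem IsReduced.not_adj_self {A : Finset V} (hA : G.IsReduced A) {v : V} (hv : v ∈ A) :
    ¬ G.Adj v v := by
  intro h
  obtain ⟨y, -, hy, hn⟩ := hA v hv v h
  exact hn (Or.inl hy)

theorem IsReduced.exists_attacker {A : Finset V} (hA : G.IsReduced A) {v u : V} (hu : u ∈ A)
    (h : G.Adj v u) : ∃ y ∈ A, G.Adj y v :=
  let ⟨y, hy, hyv, _⟩ := hA u hu v h
  ⟨y, hy, hyv⟩

theorem IsConflictFree.mono {A S : Finset V} (hA : G.IsConflictFree A) (h : S ⊆ A) :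
    G.IsConflictFree S := fun u hu v hv => hA u (h hu) v (h hv)

variable [Fintype V] (G)

/-- The result of deleting repeatedly, see `Digraph.reduceStep`. -/
noncomputable def reduct (A : Finset V) : Finset V := G.reduceStep^[Fintype.card V] A

/-- The largest subset of `A` each vertex of which attacks a vertex of the subset. -/
noncomputable def attackCore (A : Finset V) : Finset V := G.attackStep^[Fintype.card V] A

/-- The largest subset of `A` whose members are acceptable with respect to it. -/
noncomputable def defenceCore (A : Finset V) : Finset V := G.defenceStep^[Fintype.card V] A

/-- The measure of an active set. -/
noncomputable def weight (A : Finset V) : ℕ := (G.attackCore A).card + (G.mutualSet A).card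

variable {G}

theorem reduct_subset (A : Finset V) : G.reduct A ⊆ A := iterate_subset G.reduceStep_subset _ A

theorem attackCore_subset (A : Finset V) : G.attackCore A ⊆ A :=
  iterate_subset G.attackStep_subset _ A

theorem defenceCore_subset (A : Finset V) : G.defenceCore A ⊆ A :=
  iterate_subset G.defenceStep_subset _ A

theorem isReduced_reduct (A : Finset V) : G.IsReduced (G.reduct A) := by
  intro w hw
  have h : G.reduceStep (G.reduct A) = G.reduct A := iterate_card_fixed G.reduceStep_subset A
  rw [← h] at hw
  exact (mem_reduceStep.1 hw).2

theorem IsAdmissible.subset_reduct {S A : Finset V} (hS : G.IsAdmissible S) (h : S ⊆ A) :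
    S ⊆ G.reduct A :=
  subset_iterate (fun _ => hS.subset_reduceStep) _ h

theorem IsAdmissible.subset_defenceCore {S A : Finset V} (hS : G.IsAdmissible S) (h : S ⊆ A) :
    S ⊆ G.defenceCore A :=
  subset_iterate (fun _ => hS.subset_defenceStep) _ h

theorem IsConflictFree.isAdmissible_defenceCore {A : Finset V} (hA : G.IsConflictFree A) :
    G.IsAdmissible (G.defenceCore A) := by
  refine ⟨hA.mono (defenceCore_subset A), fun v hv => ?_⟩
  have h : G.defenceStep (G.defenceCore A) = G.defenceCore A :=
    iterate_card_fixed G.defenceStep_subset A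
  rw [← h] at hv
  exact (Finset.mem_filter.1 hv).2

theorem exists_adj_of_mem_attackCore {A : Finset V} {v : V} (hv : v ∈ G.attackCore A) :
    ∃ u ∈ G.attackCore A, G.Adj v u := by
  have h : G.attackStep (G.attackCore A) = G.attackCore A :=
    iterate_card_fixed G.attackStep_subset A
  rw [← h] at hv
  exact (Finset.mem_filter.1 hv).2

theorem subset_attackCore {A Q : Finset V} (hQ : Q ⊆ A) (h : ∀ v ∈ Q, ∃ u ∈ Q, G.Adj v u) :
    Q ⊆ G.attackCore A := by
  refine subset_iterate (fun A' hA' v hv => ?_) _ hQ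
  obtain ⟨u, hu, hvu⟩ := h v hv
  exact Finset.mem_filter.2 ⟨hA' hv, u, hA' hu, hvu⟩

theorem mem_attackCore_of_adj {A : Finset V} {v u : V} (hv : v ∈ A) (hu : u ∈ G.attackCore A)
    (h : G.Adj v u) : v ∈ G.attackCore A := by
  refine subset_attackCore (Q := {x ∈ A | x = v ∨ x ∈ G.attackCore A}) (Finset.filter_subset _ _)
    (fun x hx => ?_) (Finset.mem_filter.2 ⟨hv, Or.inl rfl⟩)
  have hm : ∀ z ∈ G.attackCore A, z ∈ ({x ∈ A | x = v ∨ x ∈ G.attackCore A} : Finset V) :=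
    fun z hz => Finset.mem_filter.2 ⟨attackCore_subset A hz, Or.inr hz⟩
  rcases (Finset.mem_filter.1 hx).2 with rfl | hx
  · exact ⟨u, hm u hu, h⟩
  · obtain ⟨z, hz, hxz⟩ := exists_adj_of_mem_attackCore hx
    exact ⟨z, hm z hz, hxz⟩

theorem attackCore_mono {A A' : Finset V} (h : A' ⊆ A) : G.attackCore A' ⊆ G.attackCore A :=
  subset_attackCore ((attackCore_subset A').trans h) fun _ hv => exists_adj_of_mem_attackCore hv

theorem mutualSet_subset_attackCore (A : Finset V) : G.mutualSet A ⊆ G.attackCore A := by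
  refine subset_attackCore (G.mutualSet_subset A) fun v hv => ?_
  obtain ⟨hv, u, hu, huv, h1, h2⟩ := mem_mutualSet.1 hv
  exact ⟨u, mem_mutualSet.2 ⟨hu, v, hv, huv.symm, h2, h1⟩, h2⟩

theorem weight_mono {A A' : Finset V} (h : A' ⊆ A) : G.weight A' ≤ G.weight A :=
  add_le_add (Finset.card_le_card (attackCore_mono h)) (Finset.card_le_card (mutualSet_mono h))

/-- A reduced set without a directed cycle is conflict-free. -/
theorem IsReduced.isConflictFree {A : Finset V} (hA : G.IsReduced A) (h : G.attackCore A = ∅) :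
    G.IsConflictFree A := by
  intro a ha b hb hab
  -- Sets in which every vertex is attacked from inside. In a smallest one every vertex also attacks
  -- a member, since otherwise it could be erased; so that set lies in the attack core.
  let F : Finset (Finset V) := {Q : Finset V | Q ⊆ A ∧ Q.Nonempty ∧ ∀ v ∈ Q, ∃ u ∈ Q, G.Adj u v}
  have hF : F.Nonempty := by
    -- By reducedness, a vertex that attacks a member of `A` is itself attacked from `A`, and its
    -- attacker again attacks a member of `A`.
    refine ⟨{v ∈ A | ∃ u ∈ A, G.Adj v u}, Finset.mem_filter.2 ⟨Finset.mem_univ _,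
      Finset.filter_subset _ _, ⟨a, Finset.mem_filter.2 ⟨ha, b, hb, hab⟩⟩, fun v hv => ?_⟩⟩
    obtain ⟨hv, u, hu, hvu⟩ := Finset.mem_filter.1 hv
    obtain ⟨y, hy, hyv⟩ := hA.exists_attacker hu hvu
    exact ⟨y, Finset.mem_filter.2 ⟨hy, v, hv, hyv⟩, hyv⟩
  obtain ⟨Q, hQ, hmin⟩ := F.exists_min_image Finset.card hF
  obtain ⟨-, hQA, ⟨q, hq⟩, hQin⟩ := Finset.mem_filter.1 hQ
  have : Q ⊆ G.attackCore A := by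
    refine subset_attackCore hQA fun v hv => ?_
    by_contra hno
    push Not at hno
    obtain ⟨u, hu, huv⟩ := hQin v hv
    have huv' : u ≠ v := fun e => hno u hu (by rw [e] at huv ⊢; exact huv)
    have := hmin (Q.erase v) (Finset.mem_filter.2 ⟨Finset.mem_univ _,
      (Finset.erase_subset _ _).trans hQA, ⟨u, Finset.mem_erase.2 ⟨huv', hu⟩⟩, fun z hz => ?_⟩)
    · have := Finset.card_erase_lt_of_mem hv
      omega
    · obtain ⟨y, hy, hyz⟩ := hQin z (Finset.mem_of_mem_erase hz)
      exact ⟨y, Finset.mem_erase.2 ⟨fun e => hno z (Finset.mem_of_mem_erase hz) (e ▸ hyz), hy⟩, hyz⟩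
  rw [h] at this
  exact absurd (this hq) (Finset.notMem_empty q)

end Digraph

/-! ### Branching: every reduced active set with a directed cycle has a good branching -/

namespace Digraph

open scoped Classical

set_option linter.unusedSectionVars false

section Defs

variable {V : Type*} [LinearOrder V] (G : Digraph V)

/-- What is left of `A` when `w` is put into the solution and the smaller members of `W` are
rejected. -/
noncomputable def childIn (A W : Finset V) (w : V) : Finset V :=
  {i ∈ A | ¬ (i ∈ W ∧ i < w) ∧ ¬ G.Nbr i w}

/-- What is left of `A` when the members of `W` are rejected. -/
noncomputable def childOut (A W : Finset V) : Finset V := {i ∈ A | i ∉ W}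

variable {G}

theorem mem_childIn {A W : Finset V} {w i : V} :
    i ∈ G.childIn A W w ↔ i ∈ A ∧ ¬ (i ∈ W ∧ i < w) ∧ ¬ G.Nbr i w := by
  simp [childIn]

theorem mem_childOut {A W : Finset V} {i : V} : i ∈ childOut A W ↔ i ∈ A ∧ i ∉ W := by
  simp [childOut]

theorem childIn_subset (A W : Finset V) (w : V) : G.childIn A W w ⊆ A := Finset.filter_subset _ _
theorem childOut_subset (A W : Finset V) : childOut A W ⊆ A := Finset.filter_subset _ _

variable [Fintype V] (G)

/-- The measure after rejecting `W` and reducing. -/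
noncomputable def weightOut (A W : Finset V) : ℕ := G.weight (G.reduct (childOut A W))

/-- The measure after selecting `w` and reducing. -/
noncomputable def weightIn (A W : Finset V) (w : V) : ℕ := G.weight (G.reduct (G.childIn A W w))

/-- Branching on the members of `W` decreases the measure sufficiently. -/
def GoodBranch (A W : Finset V) : Prop :=
  (W.card = 1 ∧ ∀ w ∈ W,
    (G.weightIn A W w + 8 ≤ G.weight A ∧ G.weightOut A W + 1 ≤ G.weight A) ∨
    (G.weightIn A W w + 6 ≤ G.weight A ∧ G.weightOut A W + 2 ≤ G.weight A) ∨
    (G.weightIn A W w + 4 ≤ G.weight A ∧ G.weightOut A W + 3 ≤ G.weight A) ∨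
    (G.weightIn A W w + 3 ≤ G.weight A ∧ G.weightOut A W + 4 ≤ G.weight A)) ∨
  (W.card = 2 ∧ (∀ w ∈ W, G.weightIn A W w + 5 ≤ G.weight A) ∧
    G.weightOut A W + 5 ≤ G.weight A ∧
    (G.weightOut A W + 6 ≤ G.weight A ∨ ∃ w ∈ W, G.weightIn A W w + 6 ≤ G.weight A)) ∨
  (W.card = 3 ∧ (∀ w ∈ W, G.weightIn A W w + 7 ≤ G.weight A) ∧
    G.weightOut A W + 7 ≤ G.weight A)

/-- The attackers of `v` in `A`. -/
noncomputable def ins (A : Finset V) (v : V) : Finset V := {y ∈ A | G.Adj y v}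

/-- The members of the attack core of `A` that `v` attacks. -/
noncomputable def outs (A : Finset V) (v : V) : Finset V := {y ∈ G.attackCore A | G.Adj v y}

/-- `v` together with its neighbours in the attack core of `A`. -/
noncomputable def closedNbhd (A : Finset V) (v : V) : Finset V := insert v (G.ins A v ∪ G.outs A v)

variable {G}

theorem mem_ins {A : Finset V} {v y : V} : y ∈ G.ins A v ↔ y ∈ A ∧ G.Adj y v := by simp [ins]

theorem mem_outs {A : Finset V} {v y : V} : y ∈ G.outs A v ↔ y ∈ G.attackCore A ∧ G.Adj v y := by
  simp [outs]

theorem mem_closedNbhd {A : Finset V} {v y : V} :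
    y ∈ G.closedNbhd A v ↔ y = v ∨ y ∈ G.ins A v ∨ y ∈ G.outs A v := by simp [closedNbhd]

end Defs

/-! ### Vertices that leave the attack core after a branching -/

section Vanish

variable {V : Type*} [Fintype V] [LinearOrder V] {G : Digraph V}

theorem weight_add_card_le {A A' Z Y : Finset V} (h : A' ⊆ A) (hZ : Z ⊆ G.attackCore A)
    (hZ' : ∀ z ∈ Z, z ∉ G.attackCore A') (hY : Y ⊆ G.mutualSet A)
    (hY' : ∀ y ∈ Y, y ∉ G.mutualSet A') : G.weight A' + (Z.card + Y.card) ≤ G.weight A := by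
  have h1 : (G.attackCore A').card + Z.card ≤ (G.attackCore A).card := by
    rw [← Finset.card_union_of_disjoint (Finset.disjoint_right.2 hZ')]
    exact Finset.card_le_card (Finset.union_subset (attackCore_mono h) hZ)
  have h2 : (G.mutualSet A').card + Y.card ≤ (G.mutualSet A).card := by
    rw [← Finset.card_union_of_disjoint (Finset.disjoint_right.2 hY')]
    exact Finset.card_le_card (Finset.union_subset (mutualSet_mono h) hY)
  unfold weight
  omega

theorem weight_add_card_le' {A A' Z : Finset V} (h : A' ⊆ A) (hZ : Z ⊆ G.attackCore A)
    (hZ' : ∀ z ∈ Z, z ∉ G.attackCore A') : G.weight A' + Z.card ≤ G.weight A := by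
  simpa using weight_add_card_le (Y := ∅) h hZ hZ' (Finset.empty_subset _) (by simp)

theorem not_mem_attackCore {A : Finset V} {z : V} (h : z ∉ A) : z ∉ G.attackCore (G.reduct A) :=
  fun hz => h (reduct_subset A (attackCore_subset _ hz))

/-- In a reduced set whatever attacks a member is attacked from inside. So an unattacked vertex,
even if it survives, has no surviving targets. -/
theorem not_mem_attackCore_of_no_attacker {A : Finset V} {z : V} (h : ∀ y ∈ A, ¬ G.Adj y z) :
    z ∉ G.attackCore (G.reduct A) := by
  intro hz
  obtain ⟨u, hu, hzu⟩ := exists_adj_of_mem_attackCore hz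
  obtain ⟨y, hy, hyz⟩ := (isReduced_reduct A).exists_attacker (attackCore_subset _ hu) hzu
  exact h y (reduct_subset A hy) hyz

/-- Nothing in `A` can defend `z` against `x`. -/
theorem not_mem_reduct_of_attacker {A : Finset V} {z x : V} (hx : G.Adj x z)
    (h : ∀ y ∈ A, ¬ G.Adj y x) : z ∉ G.reduct A := by
  intro hz
  obtain ⟨y, hy, hyx⟩ := (isReduced_reduct A).exists_attacker hz hx
  exact h y (reduct_subset A hy) hyx

theorem not_mem_attackCore_of_attacker {A : Finset V} {z x : V} (hx : G.Adj x z)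
    (h : ∀ y ∈ A, ¬ G.Adj y x) : z ∉ G.attackCore (G.reduct A) := fun hz =>
  not_mem_reduct_of_attacker hx h (attackCore_subset _ hz)

theorem not_mem_attackCore_of_outs {A A' : Finset V} {z : V} (hA : A' ⊆ A)
    (h : ∀ y ∈ G.outs A z, y ∉ A') : z ∉ G.attackCore (G.reduct A') := by
  intro hz
  obtain ⟨u, hu, hzu⟩ := exists_adj_of_mem_attackCore hz
  have hr := reduct_subset (G := G) A'
  exact h u (mem_outs.2 ⟨attackCore_mono (hr.trans hA) hu, hzu⟩) (hr (attackCore_subset _ hu))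

/-- The neighbours of the selected `w` are deleted. Unless it has a loop, `w` stays in the active
set, but it has lost its targets. -/
theorem closedNbhd_gone_in {A W : Finset V} {w : V} :
    ∀ z ∈ G.closedNbhd A w, z ∉ G.attackCore (G.reduct (G.childIn A W w)) := by
  intro z hz
  rcases mem_closedNbhd.1 hz with rfl | hz | hz
  · exact not_mem_attackCore_of_outs (childIn_subset _ _ _) fun y hy h =>
      (mem_childIn.1 h).2.2 (Or.inr (mem_outs.1 hy).2)
  · exact not_mem_attackCore fun h => (mem_childIn.1 h).2.2 (Or.inl (mem_ins.1 hz).2)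
  · exact not_mem_attackCore fun h => (mem_childIn.1 h).2.2 (Or.inr (mem_outs.1 hz).2)

/-- Once all attackers of `u` are rejected, nothing defends against `u`: its targets are deleted,
and `u` drops out of the core for want of targets. This is the gain from branching on a full set of
attackers. -/
theorem closedNbhd_gone_out {A : Finset V} {u : V} :
    ∀ z ∈ G.closedNbhd A u, z ∉ G.attackCore (G.reduct (childOut A (G.ins A u))) := by
  have hno : ∀ y ∈ childOut A (G.ins A u), ¬ G.Adj y u := fun y hy h =>
    (mem_childOut.1 hy).2 (mem_ins.2 ⟨(mem_childOut.1 hy).1, h⟩)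
  intro z hz
  rcases mem_closedNbhd.1 hz with rfl | hz | hz
  · exact not_mem_attackCore_of_no_attacker hno
  · exact not_mem_attackCore fun h => (mem_childOut.1 h).2 hz
  · exact not_mem_attackCore_of_attacker (mem_outs.1 hz).2 hno

theorem ins_subset_attackCore {A : Finset V} {v : V} (hv : v ∈ G.attackCore A) :
    G.ins A v ⊆ G.attackCore A := fun _ hy =>
  mem_attackCore_of_adj (mem_ins.1 hy).1 hv (mem_ins.1 hy).2

theorem closedNbhd_subset {A : Finset V} {v : V} (hv : v ∈ G.attackCore A) :
    G.closedNbhd A v ⊆ G.attackCore A := by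
  intro z hz
  rcases mem_closedNbhd.1 hz with rfl | hz | hz
  · exact hv
  · exact ins_subset_attackCore hv hz
  · exact (mem_outs.1 hz).1

theorem weightIn_le_of_subset {A W Z : Finset V} {w : V} (hw : w ∈ G.attackCore A)
    (hZ : Z ⊆ G.attackCore A)
    (hZ' : ∀ z ∈ Z, z ∉ G.attackCore (G.reduct (G.childIn A W w))) :
    G.weightIn A W w + (G.closedNbhd A w ∪ Z).card ≤ G.weight A :=
  weight_add_card_le' ((reduct_subset _).trans (childIn_subset _ _ _))
    (Finset.union_subset (closedNbhd_subset hw) hZ) fun z hz =>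
      (Finset.mem_union.1 hz).elim (closedNbhd_gone_in z) (hZ' z)

theorem weightOut_le_of_gone {A W Z : Finset V} (hZ : Z ⊆ G.attackCore A)
    (hZ' : ∀ z ∈ Z, z ∉ G.attackCore (G.reduct (childOut A W))) :
    G.weightOut A W + Z.card ≤ G.weight A :=
  weight_add_card_le' ((reduct_subset _).trans (childOut_subset _ _)) hZ hZ'

end Vanish

/-! #### Vertices in 2-cycles -/

section TwoCycles

variable {V : Type*} [Fintype V] [LinearOrder V] {G : Digraph V}

/-- In a set with 2-cycles some vertex has two partners, or has a partner that has no other. -/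
theorem exists_partners {A : Finset V} (h : (G.mutualSet A).Nonempty) :
    ∃ v ∈ G.mutualSet A, ∃ P ⊆ G.mutualSet A, v ∉ P ∧ (∀ u ∈ P, G.Nbr u v) ∧
      (2 ≤ P.card ∨ P.card = 1 ∧ ∃ b ∈ G.mutualSet A, b ≠ v ∧
        ∀ A' ⊆ A, v ∉ A' → b ∉ G.mutualSet A') := by
  let P : V → Finset V := fun v => {u ∈ A | u ≠ v ∧ G.Adj u v ∧ G.Adj v u}
  have memP : ∀ {v u}, u ∈ P v ↔ u ∈ A ∧ u ≠ v ∧ G.Adj u v ∧ G.Adj v u := by simp [P]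
  -- If even the largest number of partners is one, the partner of `v` has no partner besides `v`.
  obtain ⟨v, hv, hmax⟩ := (G.mutualSet A).exists_max_image (fun v => (P v).card) h
  obtain ⟨hvA, b, hbA, hbv, hb1, hb2⟩ := mem_mutualSet.1 hv
  have hbP : b ∈ P v := memP.2 ⟨hbA, hbv, hb1, hb2⟩
  have hPm : P v ⊆ G.mutualSet A := fun u hu => by
    obtain ⟨h1, h2, h3, h4⟩ := memP.1 hu
    exact mem_mutualSet.2 ⟨h1, v, hvA, h2.symm, h4, h3⟩
  refine ⟨v, hv, P v, hPm, fun h => (memP.1 h).2.1 rfl, fun u hu => Or.inl (memP.1 hu).2.2.1, ?_⟩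
  have hpos : 0 < (P v).card := Finset.card_pos.2 ⟨b, hbP⟩
  rcases Nat.lt_or_ge 1 (P v).card with h2 | h1
  · exact Or.inl h2
  · refine Or.inr ⟨by omega, b, hPm hbP, hbv, fun A' hA' hvA' hb => ?_⟩
    have hPb : P b = {v} := by
      refine (Finset.eq_of_subset_of_card_le (Finset.singleton_subset_iff.2
        (memP.2 ⟨hvA, hbv.symm, hb2, hb1⟩)) ?_).symm
      have : (P b).card ≤ (P v).card := hmax b (hPm hbP)
      simpa using this.trans h1
    obtain ⟨-, u, hu, hub⟩ := mem_mutualSet.1 hb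
    have : u ∈ P b := memP.2 ⟨hA' hu, hub⟩
    rw [hPb, Finset.mem_singleton] at this
    exact hvA' (this ▸ hu)

/-- Vertices in 2-cycles count twice. With two partners, selecting `v` saves 2 · 3 and rejecting it
saves 2. With one partner, selecting saves 2 · 2 and rejecting saves 1 + 2, because the partner
leaves its only 2-cycle. -/
theorem exists_goodBranch_of_mutual {A : Finset V} (h : (G.mutualSet A).Nonempty) :
    ∃ v ∈ G.attackCore A, G.GoodBranch A {v} := by
  obtain ⟨v, hv, P, hP, hvP, hPv, hcard⟩ := exists_partners h
  have hvB := mutualSet_subset_attackCore A hv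
  have hZm : insert v P ⊆ G.mutualSet A := Finset.insert_subset hv hP
  have hin : G.weightIn A {v} v + ((insert v P).card + (insert v P).card) ≤ G.weight A := by
    have hgone : ∀ z ∈ insert v P, z ∉ G.attackCore (G.reduct (G.childIn A {v} v)) := by
      intro z hz
      rcases Finset.mem_insert.1 hz with rfl | hz
      · exact closedNbhd_gone_in _ (mem_closedNbhd.2 (Or.inl rfl))
      · exact not_mem_attackCore fun h => (mem_childIn.1 h).2.2 (hPv z hz)
    exact weight_add_card_le ((reduct_subset _).trans (childIn_subset _ _ _))
      (hZm.trans (mutualSet_subset_attackCore A)) hgone hZm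
      fun y hy hy' => hgone y hy (mutualSet_subset_attackCore _ hy')
  rw [Finset.card_insert_of_notMem hvP] at hin
  have hvr : v ∉ G.reduct (childOut A {v}) := fun h =>
    (mem_childOut.1 (reduct_subset _ h)).2 (by simp)
  have hsub := (reduct_subset (G := G) _).trans (childOut_subset A {v})
  refine ⟨v, hvB, Or.inl ⟨by simp, fun w hw => ?_⟩⟩
  obtain rfl := Finset.mem_singleton.1 hw
  have hout : ∀ Y ⊆ G.mutualSet A, (∀ y ∈ Y, y ∉ G.mutualSet (G.reduct (childOut A {w}))) →
      G.weightOut A {w} + (1 + Y.card) ≤ G.weight A := fun Y hY hY' =>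
    weight_add_card_le (Z := {w}) hsub (by simpa using hvB)
      (by simpa using fun h => hvr (attackCore_subset _ h)) hY hY'
  have hw0 := fun h => hvr (G.mutualSet_subset _ h)
  rcases hcard with h2 | ⟨h1, b, hb, hbw, hb'⟩
  · have := hout {w} (by simpa using hv) (by simpa using hw0)
    rw [Finset.card_singleton] at this
    exact Or.inr (Or.inl ⟨by omega, this⟩)
  · have := hout {w, b} (by simp [Finset.insert_subset_iff, hv, hb])
      (by simpa using ⟨hw0, hb' _ hsub hvr⟩)
    rw [Finset.card_pair hbw.symm] at this
    exact Or.inr (Or.inr (Or.inl ⟨by omega, this⟩))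

end TwoCycles
end Digraph

/-! #### Oriented active sets -/

namespace Digraph

open scoped Classical

set_option linter.unusedSectionVars false

variable {V : Type*} [Fintype V] [LinearOrder V] {G : Digraph V}

variable (G) in
/-- `A` is reduced and has no 2-cycle. -/
structure IsOrientedReduced (A : Finset V) : Prop where
  isReduced : G.IsReduced A
  mutual_eq : G.mutualSet A = ∅

namespace IsOrientedReduced

variable {A : Finset V} (hA : G.IsOrientedReduced A)

include hA

theorem asymm {u v : V} (hu : u ∈ A) (hv : v ∈ A) (h : G.Adj u v) : ¬ G.Adj v u := by
  intro h'
  have huv : u ≠ v := fun e => hA.isReduced.not_adj_self hu (by rw [← e] at h; exact h)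
  have : v ∈ G.mutualSet A := mem_mutualSet.2 ⟨hv, u, hu, huv, h, h'⟩
  rw [hA.mutual_eq] at this
  exact Finset.notMem_empty v this

/-- Without 2-cycles and loops, the attackers of `v`, its targets and `v` itself are disjoint. -/
theorem card_closedNbhd {v : V} (hv : v ∈ G.attackCore A) :
    (G.closedNbhd A v).card = (G.ins A v).card + (G.outs A v).card + 1 := by
  have hvA := attackCore_subset A hv
  rw [closedNbhd, Finset.card_insert_of_notMem, Finset.card_union_of_disjoint]
  · rw [Finset.disjoint_left]
    intro y hy hy'
    exact hA.asymm (mem_ins.1 hy).1 hvA (mem_ins.1 hy).2 (mem_outs.1 hy').2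
  · intro h
    rcases Finset.mem_union.1 h with h | h
    · exact hA.isReduced.not_adj_self hvA (mem_ins.1 h).2
    · exact hA.isReduced.not_adj_self hvA (mem_outs.1 h).2

theorem ins_nonempty {v : V} (hv : v ∈ G.attackCore A) : (G.ins A v).Nonempty := by
  obtain ⟨u, hu, hvu⟩ := exists_adj_of_mem_attackCore hv
  obtain ⟨y, hy, hyv⟩ := hA.isReduced.exists_attacker (attackCore_subset _ hu) hvu
  exact ⟨y, mem_ins.2 ⟨hy, hyv⟩⟩

omit hA in
theorem outs_nonempty {v : V} (hv : v ∈ G.attackCore A) : (G.outs A v).Nonempty := by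
  obtain ⟨u, hu, hvu⟩ := exists_adj_of_mem_attackCore hv
  exact ⟨u, mem_outs.2 ⟨hu, hvu⟩⟩

theorem weightIn_le {v : V} (hv : v ∈ G.attackCore A) (W : Finset V) :
    G.weightIn A W v + ((G.ins A v).card + (G.outs A v).card + 1) ≤ G.weight A := by
  have := weightIn_le_of_subset (Z := ∅) (W := W) hv (Finset.empty_subset _) (by simp)
  rwa [Finset.union_empty, hA.card_closedNbhd hv] at this

theorem weightIn_le_of_gone {v z : V} (hv : v ∈ G.attackCore A) {W : Finset V}
    (hz : z ∈ G.attackCore A) (hzv : z ∉ G.closedNbhd A v)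
    (h : z ∉ G.attackCore (G.reduct (G.childIn A W v))) :
    G.weightIn A W v + ((G.ins A v).card + (G.outs A v).card + 2) ≤ G.weight A := by
  have := weightIn_le_of_subset (Z := {z}) (W := W) hv (by simpa using hz) (by simpa using h)
  rw [Finset.card_union_of_disjoint (by simpa using hzv), Finset.card_singleton,
    hA.card_closedNbhd hv] at this
  exact this

theorem weightOut_ins_le {u : V} (hu : u ∈ G.attackCore A) :
    G.weightOut A (G.ins A u) + ((G.ins A u).card + (G.outs A u).card + 1) ≤ G.weight A := by
  rw [← hA.card_closedNbhd hu]
  exact weightOut_le_of_gone (closedNbhd_subset hu) closedNbhd_gone_out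

omit hA in
theorem weightOut_singleton_le {v : V} (hv : v ∈ G.attackCore A) :
    G.weightOut A {v} + 1 ≤ G.weight A := by
  have := weightOut_le_of_gone (A := A) (W := {v}) (Z := {v}) (by simpa using hv) (by
    intro z hz
    exact not_mem_attackCore fun h => (mem_childOut.1 h).2 hz)
  simpa using this

omit hA in
theorem goodBranch_singleton {v : V} (h :
    (G.weightIn A {v} v + 8 ≤ G.weight A ∧ G.weightOut A {v} + 1 ≤ G.weight A) ∨
    (G.weightIn A {v} v + 6 ≤ G.weight A ∧ G.weightOut A {v} + 2 ≤ G.weight A) ∨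
    (G.weightIn A {v} v + 4 ≤ G.weight A ∧ G.weightOut A {v} + 3 ≤ G.weight A) ∨
    (G.weightIn A {v} v + 3 ≤ G.weight A ∧ G.weightOut A {v} + 4 ≤ G.weight A)) :
    G.GoodBranch A {v} :=
  Or.inl ⟨by simp, fun w hw => by obtain rfl := Finset.mem_singleton.1 hw; exact h⟩

/-- Some vertex has only one attacker. -/
theorem exists_goodBranch_of_unique_attacker {u w : V} (hu : u ∈ G.attackCore A)
    (huw : G.ins A u = {w}) : ∃ v ∈ G.attackCore A, G.GoodBranch A {v} := by
  have hw' : w ∈ G.ins A u := by simp [huw]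
  have hwB := ins_subset_attackCore hu hw'
  have hwu := (mem_ins.1 hw').2
  have huA := attackCore_subset A hu
  have hwA := attackCore_subset A hwB
  -- Rejecting the sole attacker of `u` rejects all attackers of `u`.
  have out_of : ∀ {u w : V}, u ∈ G.attackCore A → G.ins A u = {w} →
      G.weightOut A {w} + (1 + (G.outs A u).card + 1) ≤ G.weight A := by
    intro u w hu huw
    have := hA.weightOut_ins_le hu
    rwa [huw, Finset.card_singleton] at this
  have hin := hA.weightIn_le hwB {w}
  have hout := out_of hu huw
  have hiw := Finset.card_pos.2 (hA.ins_nonempty hwB)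
  have how := Finset.card_pos.2 (outs_nonempty hwB)
  have hou := Finset.card_pos.2 (outs_nonempty hu)
  -- The drops are (3, 4) if `u` has two targets and (4, 3) if `w` has degree at least 3. Otherwise
  -- `w` has a unique attacker `x`, and the argument is repeated with `x`, `w` in the roles of `w`,
  -- `u`.
  by_cases h1 : 2 ≤ (G.outs A u).card
  · exact ⟨w, hwB, goodBranch_singleton (Or.inr (Or.inr (Or.inr ⟨by omega, by omega⟩)))⟩
  by_cases h2 : 3 ≤ (G.ins A w).card + (G.outs A w).card
  · exact ⟨w, hwB, goodBranch_singleton (Or.inr (Or.inr (Or.inl ⟨by omega, by omega⟩)))⟩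
  obtain ⟨x, hxw⟩ := Finset.card_eq_one.1 (show (G.ins A w).card = 1 by omega)
  have hx' : x ∈ G.ins A w := by simp [hxw]
  have hxB := ins_subset_attackCore hwB hx'
  have hxA := attackCore_subset A hxB
  have hxw' := (mem_ins.1 hx').2
  have houtx := out_of hwB hxw
  have hinx := hA.weightIn_le hxB {x}
  have hix := Finset.card_pos.2 (hA.ins_nonempty hxB)
  have hox := Finset.card_pos.2 (outs_nonempty hxB)
  by_cases h3 : 3 ≤ (G.ins A x).card + (G.outs A x).card
  · exact ⟨x, hxB, goodBranch_singleton (Or.inr (Or.inr (Or.inl ⟨by omega, by omega⟩)))⟩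
  obtain ⟨y, hyx⟩ := Finset.card_eq_one.1 (show (G.ins A x).card = 1 by omega)
  obtain ⟨z, hzx⟩ := Finset.card_eq_one.1 (show (G.outs A x).card = 1 by omega)
  have hwz : w = z := by
    have : w ∈ G.outs A x := mem_outs.2 ⟨hwB, hxw'⟩
    simpa [hzx] using this
  -- The main point is `u ≠ y`: the only vertex `y` that can defend `w` against `x` is not joined to
  -- `w`, by reducedness.
  have hux : u ∉ G.closedNbhd A x := by
    intro h
    rcases mem_closedNbhd.1 h with rfl | h | h
    · exact hA.asymm hwA huA hwu hxw'
    · obtain ⟨y', hy', hyx', hn⟩ := hA.isReduced w hwA x hxw'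
      have e1 : u = y := by simpa [hyx] using h
      have e2 : y' = y := by simpa [hyx] using (mem_ins.2 ⟨hy', hyx'⟩ : y' ∈ G.ins A x)
      exact hn (Or.inr (e2 ▸ e1 ▸ hwu))
    · have e : u = z := by simpa [hzx] using h
      rw [e, ← hwz] at hwu
      exact hA.isReduced.not_adj_self hwA hwu
  -- Selecting `x` deletes `w`, the only attacker of `u`; so `u` is a fourth vertex that leaves the
  -- core.
  have hin' := hA.weightIn_le_of_gone (W := {x}) hxB hu hux
    (not_mem_attackCore_of_no_attacker fun t ht htu => by
      obtain ⟨htA, -, htn⟩ := mem_childIn.1 ht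
      have : t = w := by simpa [huw] using (mem_ins.2 ⟨htA, htu⟩ : t ∈ G.ins A u)
      exact htn (Or.inr (this ▸ hxw')))
  exact ⟨x, hxB, goodBranch_singleton (Or.inr (Or.inr (Or.inl ⟨by omega, by omega⟩)))⟩

/-- Some vertex of large degree is the only vertex that one of its attackers attacks. -/
theorem goodBranch_of_unique_target {u w : V} (hu : u ∈ G.attackCore A) (hw : w ∈ G.ins A u)
    (hwo : (G.outs A w).card = 1) (hdeg : 5 ≤ (G.ins A u).card + (G.outs A u).card) :
    G.GoodBranch A {u} := by
  have hin := hA.weightIn_le hu {u}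
  have hwB := ins_subset_attackCore hu hw
  have hwu := (mem_ins.1 hw).2
  have huw : u ≠ w := fun e => hA.isReduced.not_adj_self (attackCore_subset A hu) (by
    rw [← e] at hwu; exact hwu)
  -- Rejecting `u` also deprives `w` of its only target.
  have hout : G.weightOut A {u} + ({u, w} : Finset V).card ≤ G.weight A := by
    refine weightOut_le_of_gone (by simp [Finset.insert_subset_iff, hu, hwB]) fun z hz => ?_
    rcases Finset.mem_insert.1 hz with rfl | hz
    · exact not_mem_attackCore fun h => (mem_childOut.1 h).2 (by simp)
    · obtain rfl := Finset.mem_singleton.1 hz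
      refine not_mem_attackCore_of_outs (childOut_subset A _) fun y hy hy' => ?_
      obtain ⟨t, ht⟩ := Finset.card_eq_one.1 hwo
      have e1 : y = t := by simpa [ht] using hy
      have e2 : u = t := by simpa [ht] using (mem_outs.2 ⟨hu, hwu⟩ : u ∈ G.outs A z)
      exact (mem_childOut.1 hy').2 (by simp [e1, e2])
  rw [Finset.card_pair huw] at hout
  exact goodBranch_singleton (Or.inr (Or.inl ⟨by omega, hout⟩))

/-- A vertex with two attackers, each of degree at least 4. -/
theorem goodBranch_ins_of_card_eq_two {u : V} (hu : u ∈ G.attackCore A)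
    (h2 : (G.ins A u).card = 2) (hout : 2 ≤ (G.outs A u).card)
    (hw : ∀ w ∈ G.ins A u, 4 ≤ (G.ins A w).card + (G.outs A w).card)
    (h : 3 ≤ (G.outs A u).card ∨ ∃ w ∈ G.ins A u, G.weightIn A (G.ins A u) w + 6 ≤ G.weight A) :
    G.GoodBranch A (G.ins A u) := by
  have ho := hA.weightOut_ins_le hu
  refine Or.inr (Or.inl ⟨h2, fun w hwu => ?_, by omega, h.imp (fun h => by omega) id⟩)
  have := hA.weightIn_le (ins_subset_attackCore hu hwu) (G.ins A u)
  have := hw w hwu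
  omega

theorem goodBranch_ins_of_card_eq_three {u : V} (hu : u ∈ G.attackCore A)
    (h3 : (G.ins A u).card = 3) (hout : 3 ≤ (G.outs A u).card)
    (hw : ∀ w ∈ G.ins A u, 6 ≤ (G.ins A w).card + (G.outs A w).card) :
    G.GoodBranch A (G.ins A u) := by
  have ho := hA.weightOut_ins_le hu
  refine Or.inr (Or.inr ⟨h3, fun w hwu => ?_, by omega⟩)
  have := hA.weightIn_le (ins_subset_attackCore hu hwu) (G.ins A u)
  have := hw w hwu
  omega

/-- Both sides count the arcs inside the attack core; an attacker of a core vertex is itself in the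
core, so `ins` misses nothing. -/
theorem sum_card_ins_eq :
    ∑ v ∈ G.attackCore A, (G.ins A v).card = ∑ v ∈ G.attackCore A, (G.outs A v).card := by
  have := Finset.sum_card_bipartiteAbove_eq_sum_card_bipartiteBelow (s := G.attackCore A)
    (t := G.attackCore A) G.Adj
  rw [eq_comm]
  convert this using 2 with v hv v hv
  · simp [outs, Finset.bipartiteAbove]
  · congr 1
    ext y
    simp only [mem_ins, Finset.mem_bipartiteBelow]
    exact ⟨fun h => ⟨mem_attackCore_of_adj h.1 hv h.2, h.2⟩,
      fun h => ⟨attackCore_subset A h.1, h.2⟩⟩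

/-- All vertices have at least two attackers, and at least as many as targets. -/
theorem exists_goodBranch_of_balanced (hne : (G.attackCore A).Nonempty)
    (h2 : ∀ v ∈ G.attackCore A, 2 ≤ (G.ins A v).card)
    (h3 : ∀ v ∈ G.attackCore A, (G.ins A v).card ≤ 3)
    (heq : ∀ v ∈ G.attackCore A, (G.outs A v).card = (G.ins A v).card) :
    ∃ u ∈ G.attackCore A, G.GoodBranch A (G.ins A u) := by
  have hdeg : ∀ v ∈ G.attackCore A, 4 ≤ (G.ins A v).card + (G.outs A v).card := fun v hv => by
    have := h2 v hv
    have := heq v hv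
    omega
  by_cases hall : ∀ v ∈ G.attackCore A, (G.ins A v).card = 3
  · obtain ⟨u, hu⟩ := hne
    refine ⟨u, hu, hA.goodBranch_ins_of_card_eq_three hu (hall u hu) ?_ fun w hw => ?_⟩
    · rw [heq u hu, hall u hu]
    · have hw := ins_subset_attackCore hu hw
      rw [heq w hw, hall w hw]
  push Not at hall
  obtain ⟨u, hu, hu3⟩ := hall
  by_contra hno
  push Not at hno
  -- The attackers of a vertex of in-degree 2 give drops (5, 5, 5). One further unit in any child
  -- would suffice, so there is none.
  have hnot : ∀ u ∈ G.attackCore A, (G.ins A u).card = 2 → ∀ w ∈ G.ins A u,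
      ¬ (G.weightIn A (G.ins A u) w + 6 ≤ G.weight A) := fun u hu hu2 w hw h =>
    hno u hu (hA.goodBranch_ins_of_card_eq_two hu hu2 (by rw [heq u hu, hu2])
      (fun w hw => hdeg w (ins_subset_attackCore hu hw)) (Or.inr ⟨w, hw, h⟩))
  -- A balanced attacker with three attackers has degree 6, and selecting it would save 7.
  have htwo : ∀ u ∈ G.attackCore A, (G.ins A u).card = 2 → ∀ w ∈ G.ins A u,
      (G.ins A w).card = 2 := fun u hu hu2 w hw => by
    have hwB := ins_subset_attackCore hu hw
    by_contra hw2
    have := h2 w hwB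
    have := heq w hwB
    have := hA.weightIn_le hwB (G.ins A u)
    exact hnot u hu hu2 w hw (by omega)
  -- Selecting the larger attacker also rejects the smaller one. If the two were not joined, this
  -- would be a sixth vertex.
  have hadj : ∀ u ∈ G.attackCore A, (G.ins A u).card = 2 → ∀ v ∈ G.ins A u, ∀ w ∈ G.ins A u,
      v < w → G.Nbr v w := fun u hu hu2 v hv w hw hvw => by
    have hwB := ins_subset_attackCore hu hw
    by_contra hn
    have hvN : v ∉ G.closedNbhd A w := by
      intro h
      rcases mem_closedNbhd.1 h with h | h | h
      · exact hvw.ne h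
      · exact hn (Or.inl (mem_ins.1 h).2)
      · exact hn (Or.inr (mem_outs.1 h).2)
    have := hA.weightIn_le_of_gone (W := G.ins A u) hwB (ins_subset_attackCore hu hv) hvN
      (not_mem_attackCore fun h => (mem_childIn.1 h).2.1 ⟨hv, hvw⟩)
    have := htwo u hu hu2 w hw
    have := heq w hwB
    exact hnot u hu hu2 w hw (by omega)
  have hadj' : ∀ u ∈ G.attackCore A, (G.ins A u).card = 2 → ∀ v ∈ G.ins A u, ∀ w ∈ G.ins A u,
      v ≠ w → G.Nbr v w := fun u hu hu2 v hv w hw hvw => by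
    rcases lt_or_gt_of_ne hvw with h | h
    · exact hadj u hu hu2 v hv w hw h
    · exact (hadj u hu hu2 w hw v hv h).symm
  have hu2 : (G.ins A u).card = 2 := by
    have := h2 u hu
    have := h3 u hu
    omega
  obtain ⟨a, b, hab, hins⟩ : ∃ a b, G.Adj a b ∧ G.ins A u = {a, b} := by
    obtain ⟨a, b, hab, h⟩ := Finset.card_eq_two.1 hu2
    rcases hadj' u hu hu2 a (by simp [h]) b (by simp [h]) hab with h' | h'
    · exact ⟨a, b, h', h⟩
    · exact ⟨b, a, h', by rw [h, Finset.pair_comm]⟩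
  have ha : a ∈ G.ins A u := by simp [hins]
  have hb : b ∈ G.ins A u := by simp [hins]
  have haB := ins_subset_attackCore hu ha
  have hbB := ins_subset_attackCore hu hb
  have haA := attackCore_subset A haB
  have hbA := attackCore_subset A hbB
  have huA := attackCore_subset A hu
  have hau := (mem_ins.1 ha).2
  have hbu := (mem_ins.1 hb).2
  have hb2 := htwo u hu hu2 b hb
  have ha2 := htwo u hu hu2 a ha
  have hab' : a ∈ G.ins A b := mem_ins.2 ⟨haA, hab⟩
  obtain ⟨c, hc, hca⟩ : ∃ c ∈ G.ins A b, c ≠ a :=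
    Finset.exists_mem_ne (by omega) a
  have hcB := ins_subset_attackCore hbB hc
  have hcA := attackCore_subset A hcB
  have hcb := (mem_ins.1 hc).2
  have hbu' : b ≠ u := fun e => hA.isReduced.not_adj_self hbA (by rw [← e] at hbu; exact hbu)
  -- The two targets of `a` are `b` and `u`, and `c` is neither; so the arc between `a` and `c` must
  -- start at `c`.
  have hca' : G.Adj c a := by
    refine (hadj' b hbB hb2 c hc a hab' hca).resolve_right fun hac => ?_
    have houts : ({b, u} : Finset V) = G.outs A a := by
      refine Finset.eq_of_subset_of_card_le ?_ ?_
      · simp [Finset.insert_subset_iff, mem_outs, hbB, hu, hab, hau]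
      · rw [heq a haB, ha2, Finset.card_pair hbu']
    have : c ∈ ({b, u} : Finset V) := houts ▸ mem_outs.2 ⟨hcB, hac⟩
    rcases Finset.mem_insert.1 this with rfl | h
    · exact hA.isReduced.not_adj_self hcA hcb
    · rw [Finset.mem_singleton.1 h] at hcb
      exact hA.asymm hbA huA hbu hcb
  -- Both attackers of `u` are joined to `c`, so by reducedness `u` cannot attack `c`.
  have hcu : u ∉ G.closedNbhd A c := by
    intro h
    rcases mem_closedNbhd.1 h with rfl | h | h
    · exact hA.asymm hbA huA hbu hcb
    · obtain ⟨y, hy, hyu, hn⟩ := hA.isReduced c hcA u (mem_ins.1 h).2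
      have : y ∈ ({a, b} : Finset V) := hins ▸ mem_ins.2 ⟨hy, hyu⟩
      rcases Finset.mem_insert.1 this with rfl | h'
      · exact hn (Or.inr hca')
      · rw [Finset.mem_singleton.1 h'] at hn
        exact hn (Or.inr hcb)
    · have : c ∈ ({a, b} : Finset V) := hins ▸ mem_ins.2 ⟨hcA, (mem_outs.1 h).2⟩
      rcases Finset.mem_insert.1 this with rfl | h'
      · exact hca rfl
      · rw [Finset.mem_singleton.1 h'] at hcb
        exact hA.isReduced.not_adj_self hbA hcb
  -- As an attacker of `b`, the vertex `c` may be selected. This deletes `a` and `b`, leaves `u`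
  -- without attackers, and so saves the sixth unit.
  have := hA.weightIn_le_of_gone (W := G.ins A b) hcB hu hcu
    (not_mem_attackCore_of_no_attacker fun t ht htu => by
      obtain ⟨htA, -, htn⟩ := mem_childIn.1 ht
      have : t ∈ ({a, b} : Finset V) := hins ▸ mem_ins.2 ⟨htA, htu⟩
      rcases Finset.mem_insert.1 this with rfl | h'
      · exact htn (Or.inr hca')
      · rw [Finset.mem_singleton.1 h'] at htn
        exact htn (Or.inr hcb))
  have := htwo b hbB hb2 c hc
  have := heq c hcB
  exact hnot b hbB hb2 c hc (by omega)

/-- Suppose there is none. Degree 7 would give (8, 1), so degrees are at most 6, and every in-degree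
is at least 2. A vertex with more targets than attackers would have two attackers and at least three
targets, and its attackers would have degree at least 4, since one with a single target allows (6,
2); this gives (5, 5, 6). So targets never outnumber attackers, and equality of the totals forces
balance everywhere. -/
theorem exists_goodBranch (hne : (G.attackCore A).Nonempty) :
    (∃ v ∈ G.attackCore A, G.GoodBranch A {v}) ∨
      ∃ u ∈ G.attackCore A, G.GoodBranch A (G.ins A u) := by
  by_contra hno
  push Not at hno
  obtain ⟨hno1, hno2⟩ := hno
  have hdeg : ∀ v ∈ G.attackCore A, (G.ins A v).card + (G.outs A v).card ≤ 6 := fun v hv => by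
    by_contra h
    have := hA.weightIn_le hv {v}
    exact hno1 v hv (goodBranch_singleton (Or.inl ⟨by omega, weightOut_singleton_le hv⟩))
  have h2 : ∀ v ∈ G.attackCore A, 2 ≤ (G.ins A v).card := fun v hv => by
    by_contra h
    have := Finset.card_pos.2 (hA.ins_nonempty hv)
    obtain ⟨w, hw⟩ := Finset.card_eq_one.1 (show (G.ins A v).card = 1 by omega)
    obtain ⟨x, hx, hgood⟩ := hA.exists_goodBranch_of_unique_attacker hv hw
    exact hno1 x hx hgood
  have hle : ∀ v ∈ G.attackCore A, (G.outs A v).card ≤ (G.ins A v).card := fun v hv => by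
    by_contra h
    have h2' := h2 v hv
    have h6 := hdeg v hv
    refine hno2 v hv (hA.goodBranch_ins_of_card_eq_two hv (by omega) (by omega) (fun w hw => ?_)
      (Or.inl (by omega)))
    have hwB := ins_subset_attackCore hv hw
    have := h2 w hwB
    have : (G.outs A w).card ≠ 1 := fun h1 =>
      hno1 v hv (hA.goodBranch_of_unique_target hv hw h1 (by omega))
    have := Finset.card_pos.2 (outs_nonempty hwB)
    omega
  have heq := (Finset.sum_eq_sum_iff_of_le hle).1 hA.sum_card_ins_eq.symm
  obtain ⟨u, hu, hgood⟩ := hA.exists_goodBranch_of_balanced hne h2 (fun v hv => by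
    have := hdeg v hv
    have := heq v hv
    omega) heq
  exact hno2 u hu hgood

end IsOrientedReduced

theorem IsReduced.exists_goodBranch {A : Finset V} (hA : G.IsReduced A)
    (hne : (G.attackCore A).Nonempty) :
    (∃ v ∈ G.attackCore A, G.GoodBranch A {v}) ∨
      ∃ u ∈ G.attackCore A, G.GoodBranch A (G.ins A u) := by
  rcases (G.mutualSet A).eq_empty_or_nonempty with h | h
  · exact IsOrientedReduced.exists_goodBranch ⟨hA, h⟩ hne
  · exact Or.inl (exists_goodBranch_of_mutual h)

end Digraph

/-! ### The branching number -/

section Root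

/-- The properties of the root of `1 - 1 / x - 1 / x ^ 8` that are used below. -/
structure IsBranchingNumber (φ : ℝ) : Prop where
  one_lt : 1 < φ
  inv_add : φ⁻¹ + φ⁻¹ ^ 8 = 1
  inv_le : φ⁻¹ ≤ 0.8118

theorem exists_isBranchingNumber : ∃ φ : ℝ,
    (∀ x : ℝ, (0 < x ∧ 1 - x⁻¹ - (x ^ 8)⁻¹ = 0) ↔ x = φ) ∧ φ < 1.2321 ∧ φ ^ 2 < 1.5180 ∧
      IsBranchingNumber φ := by
  -- The upper end is chosen finer than 1.2321 because 1.23206² < 1.5180 < 1.2321². The lower end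
  -- yields the bound 0.8118 on `φ⁻¹`.
  have hcont : ContinuousOn (fun x : ℝ => 1 - x⁻¹ - (x ^ 8)⁻¹) (Set.Icc 1.232 1.23206) := by
    have hne : ∀ x ∈ Set.Icc (1.232 : ℝ) 1.23206, x ≠ 0 := fun x hx => by
      have := hx.1
      intro h
      rw [h] at this
      norm_num at this
    exact (continuousOn_const.sub (continuousOn_id.inv₀ hne)).sub
      ((continuousOn_id.pow 8).inv₀ fun x hx => pow_ne_zero 8 (hne x hx))
  obtain ⟨φ, ⟨h1, h2⟩, h0⟩ := intermediate_value_Icc (by norm_num) hcont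
    (show (0 : ℝ) ∈ Set.Icc _ _ by constructor <;> norm_num)
  simp only at h0
  have hpos : 0 < φ := by linarith
  refine ⟨φ, fun x => ⟨fun ⟨hx, hx0⟩ => ?_, fun h => h ▸ ⟨hpos, h0⟩⟩, ?_, ?_, ?_, ?_, ?_⟩
  · rcases lt_trichotomy x φ with h | h | h
    · have := inv_strictAnti₀ hx h
      have := inv_strictAnti₀ (pow_pos hx 8) (pow_lt_pow_left₀ h hx.le (by norm_num))
      linarith
    · exact h
    · have := inv_strictAnti₀ hpos h
      have := inv_strictAnti₀ (pow_pos hpos 8) (pow_lt_pow_left₀ h hpos.le (by norm_num))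
      linarith
  · linarith
  · nlinarith
  · linarith
  · rw [inv_pow]
    linarith
  · rw [inv_le_comm₀ hpos (by norm_num)]
    refine le_trans ?_ h1
    norm_num

theorem pow_le_inv_pow_mul {y : ℝ} (hy : 1 ≤ y) {a m k : ℕ} (h : k + a ≤ m) :
    y ^ k ≤ y⁻¹ ^ a * y ^ m := by
  have hy0 : 0 < y := by linarith
  rw [inv_pow, ← div_eq_inv_mul, le_div_iff₀ (pow_pos hy0 a), ← pow_add]
  exact pow_le_pow_right₀ hy h

end Root

namespace Digraph

open scoped Classical

set_option linter.unusedSectionVars false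

section

variable {V : Type*} [Fintype V] [LinearOrder V] {G : Digraph V}

theorem IsReduced.exists_goodBranch_subset {A : Finset V} (hA : G.IsReduced A)
    (hne : (G.attackCore A).Nonempty) :
    ∃ W ⊆ G.attackCore A, W.Nonempty ∧ G.GoodBranch A W := by
  rcases hA.exists_goodBranch hne with ⟨v, hv, h⟩ | ⟨u, hu, h⟩
  · exact ⟨{v}, by simpa using hv, by simp, h⟩
  · refine ⟨G.ins A u, ins_subset_attackCore hu, Finset.card_pos.1 ?_, h⟩
    rcases h with h | h | h <;> have := h.1 <;> omega

variable (G) in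
/-- An upper bound for the number of leaves below the branching on `W`. -/
noncomputable def branchBound (φ : ℝ) (A W : Finset V) : ℝ :=
  ∑ w ∈ W, φ ^ G.weightIn A W w + φ ^ G.weightOut A W

/-- After division by `φ ^ G.weight A`, sums of powers of `x = φ⁻¹` remain. For (8, 1) the sum is x
+ x⁸ = 1, the defining equation; all other cases have slack, for which x ≤ 0.8118 is precise enough.
-/
theorem GoodBranch.branchBound_le {φ : ℝ} (hφ : IsBranchingNumber φ) {A W : Finset V}
    (h : G.GoodBranch A W) : G.branchBound φ A W ≤ φ ^ G.weight A := by
  obtain ⟨h1, hx, hx1⟩ := hφ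
  have key : ∀ {k a : ℕ}, k + a ≤ G.weight A → φ ^ k ≤ φ⁻¹ ^ a * φ ^ G.weight A := fun h =>
    pow_le_inv_pow_mul h1.le h
  set m := G.weight A
  set x := φ⁻¹
  have hx0 : 0 < x := inv_pos.2 (by linarith)
  have hm : 0 < φ ^ m := by positivity
  have hpow : ∀ a : ℕ, x ^ a ≤ 0.8118 ^ a := fun a => pow_le_pow_left₀ hx0.le hx1 a
  have fin : ∀ {c d : ℝ}, d ≤ c * φ ^ m → c ≤ 1 → d ≤ φ ^ m := fun hd hc =>
    hd.trans (mul_le_of_le_one_left hm.le hc)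
  have p2 := hpow 2
  have p3 := hpow 3
  have p4 := hpow 4
  have p5 := hpow 5
  have p6 := hpow 6
  have p7 := hpow 7
  norm_num at p2 p3 p4 p5 p6 p7
  unfold branchBound
  rcases h with ⟨hc, h⟩ | ⟨hc, hin, hout, h⟩ | ⟨hc, hin, hout⟩
  · obtain ⟨w, rfl⟩ := Finset.card_eq_one.1 hc
    rw [Finset.sum_singleton]
    rcases h w (by simp) with ⟨ha, hb⟩ | ⟨ha, hb⟩ | ⟨ha, hb⟩ | ⟨ha, hb⟩
    · exact fin ((add_le_add (key ha) (key hb)).trans_eq (by ring)) (c := x ^ 8 + x ^ 1)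
        (by linarith)
    · exact fin ((add_le_add (key ha) (key hb)).trans_eq (by ring)) (c := x ^ 6 + x ^ 2)
        (by linarith)
    · exact fin ((add_le_add (key ha) (key hb)).trans_eq (by ring)) (c := x ^ 4 + x ^ 3)
        (by linarith)
    · exact fin ((add_le_add (key ha) (key hb)).trans_eq (by ring)) (c := x ^ 3 + x ^ 4)
        (by linarith)
  · obtain ⟨a, b, hab, rfl⟩ := Finset.card_eq_two.1 hc
    have ha := key (hin a (by simp))
    have hb := key (hin b (by simp))
    have ho := key hout
    rw [Finset.sum_pair hab]
    refine fin (c := x ^ 5 + x ^ 5 + x ^ 6) ?_ (by linarith)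
    rcases h with h | ⟨w, hw, h⟩
    · linarith [key h]
    · rcases Finset.mem_insert.1 hw with rfl | hw
      · linarith [key h]
      · obtain rfl := Finset.mem_singleton.1 hw
        linarith [key h]
  · refine fin (c := 4 * x ^ 7) ?_ (by linarith)
    have := Finset.sum_le_card_nsmul W (fun w => φ ^ G.weightIn A W w) _ fun w hw =>
      key (hin w hw)
    rw [hc, nsmul_eq_mul] at this
    push_cast at this
    linarith [key hout]

end

/-! ### Counting preferred extensions by branching -/

section Count

variable {V : Type*} {G : Digraph V}

theorem IsAdmissible.union {S T : Finset V} (hS : G.IsAdmissible S) (hT : G.IsAdmissible T)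
    (h : G.IsConflictFree (S ∪ T)) : G.IsAdmissible (S ∪ T) := by
  refine ⟨h, fun v hv u hu => ?_⟩
  rcases Finset.mem_union.1 hv with hv | hv
  · obtain ⟨w, hw, hwu⟩ := hS.2 v hv u hu
    exact ⟨w, Finset.mem_union_left _ hw, hwu⟩
  · obtain ⟨w, hw, hwu⟩ := hT.2 v hv u hu
    exact ⟨w, Finset.mem_union_right _ hw, hwu⟩

/-- A conflict-free union of admissible sets is admissible, so by maximality both sets equal the
union. -/
theorem IsPreferred.eq_of_union {S T : Finset V} (hS : G.IsPreferred S) (hT : G.IsPreferred T)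
    (h : G.IsConflictFree (S ∪ T)) : S = T := by
  have hU := hS.1.union hT.1 h
  have h1 := hS.eq_of_le hU Finset.subset_union_left
  have h2 := hT.eq_of_le hU Finset.subset_union_right
  exact h1.trans h2.symm

variable [Fintype V]

variable (G) in
/-- The preferred extensions that are contained in `A`. -/
noncomputable def preferredIn (A : Finset V) : Finset (Finset V) :=
  {S : Finset V | G.IsPreferred S ∧ S ⊆ A}

theorem mem_preferredIn {A S : Finset V} : S ∈ G.preferredIn A ↔ G.IsPreferred S ∧ S ⊆ A := by
  simp [preferredIn]

theorem preferredIn_reduct (A : Finset V) : G.preferredIn (G.reduct A) = G.preferredIn A := by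
  ext S
  rw [mem_preferredIn, mem_preferredIn]
  exact ⟨fun h => ⟨h.1, h.2.trans (reduct_subset A)⟩, fun h => ⟨h.1, h.1.1.subset_reduct h.2⟩⟩

theorem numPreferred_eq : G.numPreferred = (G.preferredIn Finset.univ).card := by
  rw [numPreferred, ← Set.ncard_coe_finset]
  congr 1
  ext S
  simp [mem_preferredIn]

theorem card_mutualSet_univ : (G.mutualSet Finset.univ).card = G.resolutionOrder := by
  rw [resolutionOrder, ← Set.ncard_coe_finset]
  congr 1
  ext v
  simp [mem_mutualSet]

theorem resolutionOrder_le_card : G.resolutionOrder ≤ Fintype.card V := by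
  rw [← card_mutualSet_univ]
  exact Finset.card_le_univ _

theorem weight_le (A : Finset V) : G.weight A ≤ G.resolutionOrder + Fintype.card V := by
  have := (weight_mono (Finset.subset_univ A) : G.weight A ≤ G.weight Finset.univ)
  refine this.trans ?_
  rw [weight, card_mutualSet_univ, add_comm]
  exact Nat.add_le_add_left (Finset.card_le_univ _) _

theorem IsConflictFree.preferredIn_subsingleton {A : Finset V} (hA : G.IsConflictFree A) :
    ∀ S ∈ G.preferredIn A, ∀ T ∈ G.preferredIn A, S = T := fun _ hS _ hT =>
  (mem_preferredIn.1 hS).1.eq_of_union (mem_preferredIn.1 hT).1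
    (hA.mono (Finset.union_subset (mem_preferredIn.1 hS).2 (mem_preferredIn.1 hT).2))

variable [LinearOrder V]

/-- Split according to the least member of `W` that lies in `S`, if there is one. -/
theorem subset_childIn_or_childOut {A S : Finset V} (W : Finset V) (hS : G.IsConflictFree S)
    (h : S ⊆ A) : (∃ w ∈ W, S ⊆ G.childIn A W w) ∨ S ⊆ childOut A W := by
  by_cases hne : {w ∈ W | w ∈ S}.Nonempty
  · obtain ⟨w, hw, hmin⟩ := Finset.exists_min_image {w ∈ W | w ∈ S} id hne
    obtain ⟨hwW, hwS⟩ := Finset.mem_filter.1 hw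
    refine Or.inl ⟨w, hwW, fun i hi => mem_childIn.2 ⟨h hi, fun hiW => ?_, fun hn => ?_⟩⟩
    · exact absurd (hmin i (Finset.mem_filter.2 ⟨hiW.1, hi⟩)) (not_le.2 hiW.2)
    · exact hn.elim (hS i hi w hwS) (hS w hwS i hi)
  · refine Or.inr fun i hi => mem_childOut.2 ⟨h hi, fun hiW => hne ⟨i, ?_⟩⟩
    exact Finset.mem_filter.2 ⟨hiW, hi⟩

theorem card_childIn_lt {A W : Finset V} {w : V} (hw : w ∈ G.attackCore A) :
    (G.childIn A W w).card < A.card := by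
  obtain ⟨u, hu, hwu⟩ := exists_adj_of_mem_attackCore hw
  exact Finset.card_lt_card ((Finset.ssubset_iff_of_subset (childIn_subset _ _ _)).2
    ⟨u, attackCore_subset _ hu, fun h => (mem_childIn.1 h).2.2 (Or.inr hwu)⟩)

theorem card_preferredIn_le {φ : ℝ} (hφ : IsBranchingNumber φ) (A : Finset V) :
    ((G.preferredIn A).card : ℝ) ≤ φ ^ G.weight (G.reduct A) := by
  induction hn : A.card using Nat.strong_induction_on generalizing A with
  | _ n ih =>
  subst hn
  have h1 := hφ.one_lt
  have hcard := Finset.card_le_card (reduct_subset (G := G) A)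
  rw [← preferredIn_reduct]
  set A' := G.reduct A with hA'
  have hred : G.IsReduced A' := isReduced_reduct A
  rcases (G.attackCore A').eq_empty_or_nonempty with he | hne
  · have : (G.preferredIn A').card ≤ 1 :=
      Finset.card_le_one.2 (hred.isConflictFree he).preferredIn_subsingleton
    calc ((G.preferredIn A').card : ℝ) ≤ 1 := by exact_mod_cast this
      _ ≤ _ := one_le_pow₀ h1.le
  · obtain ⟨W, hW, ⟨w0, hw0⟩, hgood⟩ := hred.exists_goodBranch_subset hne
    -- It remains to see that every preferred extension inside the reduced set lies inside one of
    -- its children.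
    refine le_trans ?_ (hgood.branchBound_le hφ)
    have hsub : G.preferredIn A' ⊆
        (W.biUnion fun w => G.preferredIn (G.childIn A' W w)) ∪ G.preferredIn (childOut A' W) := by
      intro S hS
      obtain ⟨hS, hSA⟩ := mem_preferredIn.1 hS
      rcases subset_childIn_or_childOut W hS.1.1 hSA with ⟨w, hw, h⟩ | h
      · exact Finset.mem_union_left _ (Finset.mem_biUnion.2 ⟨w, hw, mem_preferredIn.2 ⟨hS, h⟩⟩)
      · exact Finset.mem_union_right _ (mem_preferredIn.2 ⟨hS, h⟩)
    have hle := (Finset.card_le_card hsub).trans (Finset.card_union_le _ _)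
    have hle' := hle.trans (Nat.add_le_add_right Finset.card_biUnion_le _)
    have hle'' : ((G.preferredIn A').card : ℝ) ≤
        ∑ w ∈ W, ((G.preferredIn (G.childIn A' W w)).card : ℝ) +
          ((G.preferredIn (childOut A' W)).card : ℝ) := by exact_mod_cast hle'
    refine hle''.trans (add_le_add (Finset.sum_le_sum fun w hw => ?_) ?_)
    · exact ih _ ((card_childIn_lt (hW hw)).trans_le hcard) _ rfl
    · refine ih _ (lt_of_lt_of_le ?_ hcard) _ rfl
      exact Finset.card_lt_card ((Finset.ssubset_iff_of_subset (childOut_subset _ _)).2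
        ⟨w0, attackCore_subset _ (hW hw0), fun h => (mem_childOut.1 h).2 hw0⟩)

end Count

theorem numPreferred_le_pow {φ : ℝ} (hφ : IsBranchingNumber φ) {V : Type*} [Fintype V]
    (G : Digraph V) : (G.numPreferred : ℝ) ≤
      φ ^ (2 * G.resolutionOrder) * φ ^ (Fintype.card V - G.resolutionOrder) := by
  -- Any order will do: it only singles out the first member of a branching set.
  let _ : LinearOrder V := LinearOrder.lift' (Fintype.equivFin V) (Fintype.equivFin V).injective
  rw [numPreferred_eq, ← pow_add]
  refine (card_preferredIn_le hφ _).trans (pow_le_pow_right₀ hφ.one_lt.le ?_)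
  have := weight_le (G := G) (G.reduct Finset.univ)
  have := G.resolutionOrder_le_card
  omega

end Digraph

/-! ### Counting preferred extensions by size and averaging over active sets -/

namespace Digraph

open scoped Classical

set_option linter.unusedSectionVars false

/-! ### Branching for preferred extensions weighted by size -/

section SizeBound

variable {V : Type*} [Fintype V] [LinearOrder V] {G : Digraph V}

variable (G) in
/-- Measure for counting preferred extensions by size. -/
noncomputable def sizeWeight (A : Finset V) : ℕ := 2 * A.card + (G.mutualSet A).card

theorem sizeWeight_add_le {A A' Z Y : Finset V} (h : A' ⊆ A) (hZ : Z ⊆ A)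
    (hZ' : ∀ z ∈ Z, z ∉ A') (hY : Y ⊆ G.mutualSet A) (hY' : ∀ y ∈ Y, y ∉ G.mutualSet A') :
    G.sizeWeight A' + (2 * Z.card + Y.card) ≤ G.sizeWeight A := by
  have h1 : A'.card + Z.card ≤ A.card := by
    rw [← Finset.card_union_of_disjoint (Finset.disjoint_right.2 hZ')]
    exact Finset.card_le_card (Finset.union_subset h hZ)
  have h2 : (G.mutualSet A').card + Y.card ≤ (G.mutualSet A).card := by
    rw [← Finset.card_union_of_disjoint (Finset.disjoint_right.2 hY')]
    exact Finset.card_le_card (Finset.union_subset (mutualSet_mono h) hY)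
  unfold sizeWeight
  omega

theorem sizeWeight_add_le' {A A' Z : Finset V} (h : A' ⊆ A) (hZ : Z ⊆ A)
    (hZ' : ∀ z ∈ Z, z ∉ A') : G.sizeWeight A' + 2 * Z.card ≤ G.sizeWeight A := by
  simpa using sizeWeight_add_le (Y := ∅) h hZ hZ' (Finset.empty_subset _) (by simp)

variable (G) in
/-- A binary branching for counting by size. -/
def GoodSplit (A A₁ A₂ : Finset V) : Prop :=
  A₁ ⊆ A ∧ A₂ ⊆ A ∧ (∀ S, G.IsAdmissible S → S ⊆ A → S ⊆ A₁ ∨ S ⊆ A₂) ∧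
    ((G.sizeWeight A₁ + 4 ≤ G.sizeWeight A ∧ G.sizeWeight A₂ + 4 ≤ G.sizeWeight A) ∨
      (G.sizeWeight A₁ + 8 ≤ G.sizeWeight A ∧ G.sizeWeight A₂ + 2 ≤ G.sizeWeight A) ∨
      (G.sizeWeight A₁ + 7 ≤ G.sizeWeight A ∧ G.sizeWeight A₂ + 3 ≤ G.sizeWeight A))

theorem subset_childIn_or_reduct {A S : Finset V} (w : V) (hS : G.IsAdmissible S) (h : S ⊆ A) :
    S ⊆ G.childIn A {w} w ∨ S ⊆ G.reduct (childOut A {w}) := by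
  rcases subset_childIn_or_childOut {w} hS.1 h with ⟨v, hv, h⟩ | h
  · obtain rfl := Finset.mem_singleton.1 hv
    exact Or.inl h
  · exact Or.inr (hS.subset_reduct h)

theorem reduct_childOut_subset (A W : Finset V) : G.reduct (childOut A W) ⊆ A :=
  (reduct_subset _).trans (childOut_subset _ _)

theorem notMem_reduct_childOut (A : Finset V) (w : V) : w ∉ G.reduct (childOut A {w}) := fun h =>
  (mem_childOut.1 (reduct_subset _ h)).2 (by simp)

/-- The selected vertex stays in its child, so it is not saved in the term `2 * A.card`; only its
partners are, besides the vertices that cease to be in 2-cycles. Two partners give (4 + 3, 2 + 1), a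
single one gives (2 + 2, 2 + 2). -/
theorem exists_goodSplit_of_mutual {A : Finset V} (h : (G.mutualSet A).Nonempty) :
    ∃ A₁ A₂, G.GoodSplit A A₁ A₂ := by
  obtain ⟨v, hv, P, hP, hvP, hPv, hcard⟩ := exists_partners h
  have hsub := reduct_childOut_subset (G := G) A {v}
  have hvr := notMem_reduct_childOut (G := G) A v
  have hvr' := fun h => hvr (G.mutualSet_subset _ h)
  have hvA := G.mutualSet_subset A hv
  obtain ⟨u, hu⟩ : P.Nonempty := Finset.card_pos.1 (by omega)
  have hPi : ∀ z ∈ P, z ∉ G.childIn A {v} v := fun z hz h => (mem_childIn.1 h).2.2 (hPv z hz)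
  refine ⟨G.childIn A {v} v, G.reduct (childOut A {v}), childIn_subset _ _ _, hsub,
    fun S hS hSA => subset_childIn_or_reduct v hS hSA, ?_⟩
  have hout : ∀ Y ⊆ G.mutualSet A, (∀ y ∈ Y, y ∉ G.mutualSet (G.reduct (childOut A {v}))) →
      G.sizeWeight (G.reduct (childOut A {v})) + (2 * 1 + Y.card) ≤ G.sizeWeight A :=
    fun Y hY hY' => sizeWeight_add_le (Z := {v}) hsub (by simpa using hvA) (by simpa using hvr)
      hY hY'
  rcases hcard with h2 | ⟨h1, b, hb, hbw, hb'⟩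
  · have hin : G.sizeWeight (G.childIn A {v} v) + (2 * P.card + (insert v P).card) ≤
        G.sizeWeight A := by
      refine sizeWeight_add_le (childIn_subset _ _ _) (hP.trans (G.mutualSet_subset A)) hPi
        (Finset.insert_subset hv hP) fun y hy hy' => ?_
      rcases Finset.mem_insert.1 hy with rfl | hy
      · obtain ⟨-, u, hu, -, huv, -⟩ := mem_mutualSet.1 hy'
        exact (mem_childIn.1 hu).2.2 (Or.inl huv)
      · exact hPi y hy (G.mutualSet_subset _ hy')
    rw [Finset.card_insert_of_notMem hvP] at hin
    have := hout {v} (by simpa using hv) (by simpa using hvr')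
    rw [Finset.card_singleton] at this
    exact Or.inr (Or.inr ⟨by omega, this⟩)
  · have hin : G.sizeWeight (G.childIn A {v} v) + (2 * P.card + (insert v P).card) ≤
        G.sizeWeight A := by
      refine sizeWeight_add_le (childIn_subset _ _ _) (hP.trans (G.mutualSet_subset A)) hPi
        (Finset.insert_subset hv hP) fun y hy hy' => ?_
      rcases Finset.mem_insert.1 hy with rfl | hy
      · obtain ⟨-, u, hu, -, huv, -⟩ := mem_mutualSet.1 hy'
        exact (mem_childIn.1 hu).2.2 (Or.inl huv)
      · exact hPi y hy (G.mutualSet_subset _ hy')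
    rw [Finset.card_insert_of_notMem hvP] at hin
    have := hout {v, b} (by simp [Finset.insert_subset_iff, hv, hb])
      (by simpa using ⟨hvr', hb' _ hsub hvr⟩)
    rw [Finset.card_pair hbw.symm] at this
    exact Or.inl ⟨by omega, this⟩

/-- Degree 4 gives (8, 2). If `w` is the only attacker of `u`, selecting `w` deletes two neighbours,
and rejecting it deletes `w` and the targets of the now unattacked `u`, which gives (4, 4).
Otherwise every core vertex has at least two attackers and at most one target, against the equality
of the totals. -/
theorem IsOrientedReduced.exists_goodSplit {A : Finset V} (hA : G.IsOrientedReduced A)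
    (hne : (G.attackCore A).Nonempty) : ∃ A₁ A₂, G.GoodSplit A A₁ A₂ := by
  have hin : ∀ v ∈ G.attackCore A, G.sizeWeight (G.childIn A {v} v) +
      2 * ((G.ins A v).card + (G.outs A v).card) ≤ G.sizeWeight A := by
    intro v hv
    have hc := hA.card_closedNbhd hv
    have hvN : v ∈ G.closedNbhd A v := mem_closedNbhd.2 (Or.inl rfl)
    have := sizeWeight_add_le' (G := G) (A' := G.childIn A {v} v)
      (Z := (G.closedNbhd A v).erase v) (childIn_subset _ _ _)
      ((Finset.erase_subset _ _).trans ((closedNbhd_subset hv).trans (attackCore_subset A)))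
      fun z hz hz' => by
        obtain ⟨hzv, hz⟩ := Finset.mem_erase.1 hz
        rcases mem_closedNbhd.1 hz with h | h | h
        · exact hzv h
        · exact (mem_childIn.1 hz').2.2 (Or.inl (mem_ins.1 h).2)
        · exact (mem_childIn.1 hz').2.2 (Or.inr (mem_outs.1 h).2)
    rw [Finset.card_erase_of_mem hvN, hc] at this
    simpa using this
  have split : ∀ v, ((G.sizeWeight (G.childIn A {v} v) + 4 ≤ G.sizeWeight A ∧
      G.sizeWeight (G.reduct (childOut A {v})) + 4 ≤ G.sizeWeight A) ∨
      (G.sizeWeight (G.childIn A {v} v) + 8 ≤ G.sizeWeight A ∧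
        G.sizeWeight (G.reduct (childOut A {v})) + 2 ≤ G.sizeWeight A)) →
      ∃ A₁ A₂, G.GoodSplit A A₁ A₂ := fun v h =>
    ⟨G.childIn A {v} v, G.reduct (childOut A {v}), childIn_subset _ _ _,
      reduct_childOut_subset A {v}, fun S hS hSA => subset_childIn_or_reduct v hS hSA,
      h.imp id Or.inl⟩
  by_contra hno
  have hdeg : ∀ v ∈ G.attackCore A, (G.ins A v).card + (G.outs A v).card ≤ 3 := by
    intro v hv
    by_contra h
    have h1 := hin v hv
    have h2 := sizeWeight_add_le' (G := G) (reduct_childOut_subset (G := G) A {v}) (Z := {v})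
      (by simpa using attackCore_subset A hv) (by simpa using notMem_reduct_childOut A v)
    rw [Finset.card_singleton] at h2
    exact hno (split v (Or.inr ⟨by omega, by omega⟩))
  have hins : ∀ v ∈ G.attackCore A, 2 ≤ (G.ins A v).card := by
    intro u hu
    by_contra h
    have := Finset.card_pos.2 (hA.ins_nonempty hu)
    obtain ⟨w, hw⟩ := Finset.card_eq_one.1 (show (G.ins A u).card = 1 by omega)
    have hw' : w ∈ G.ins A u := by simp [hw]
    have hwB := ins_subset_attackCore hu hw'
    have h1 := hin w hwB
    have hiw := Finset.card_pos.2 (hA.ins_nonempty hwB)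
    have how := Finset.card_pos.2 (outs_nonempty hwB)
    obtain ⟨z, hz⟩ := outs_nonempty hu
    have hwu := (mem_ins.1 hw').2
    have huz := (mem_outs.1 hz).2
    have hwz : w ≠ z := fun e => hA.asymm (attackCore_subset A hwB) (attackCore_subset A hu) hwu
      (e ▸ huz)
    have h2 := sizeWeight_add_le' (G := G) (reduct_childOut_subset (G := G) A {w}) (Z := {w, z})
      (by simp [Finset.insert_subset_iff, attackCore_subset A hwB,
        attackCore_subset A (mem_outs.1 hz).1]) (by
      intro y hy
      rcases Finset.mem_insert.1 hy with rfl | hy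
      · exact notMem_reduct_childOut A y
      · obtain rfl := Finset.mem_singleton.1 hy
        refine not_mem_reduct_of_attacker huz fun t ht htu => ?_
        have ht' := mem_childOut.1 ht
        have : t ∈ G.ins A u := mem_ins.2 ⟨ht'.1, htu⟩
        rw [hw] at this
        exact ht'.2 this)
    rw [Finset.card_pair hwz] at h2
    exact hno (split w (Or.inl ⟨by omega, by omega⟩))
  have hlt : ∑ v ∈ G.attackCore A, (G.outs A v).card < ∑ v ∈ G.attackCore A, (G.ins A v).card :=
    Finset.sum_lt_sum_of_nonempty hne fun v hv => by
      have := hdeg v hv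
      have := hins v hv
      omega
  exact hlt.ne' hA.sum_card_ins_eq

theorem IsReduced.exists_goodSplit {A : Finset V} (hA : G.IsReduced A)
    (hne : (G.attackCore A).Nonempty) : ∃ A₁ A₂, G.GoodSplit A A₁ A₂ := by
  rcases (G.mutualSet A).eq_empty_or_nonempty with h | h
  · exact IsOrientedReduced.exists_goodSplit ⟨hA, h⟩ hne
  · exact exists_goodSplit_of_mutual h

theorem GoodSplit.add_le {y : ℝ} (hy : 1 ≤ y) (hy4 : y ^ 4 = 2) {A A₁ A₂ : Finset V}
    (h : G.GoodSplit A A₁ A₂) :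
    y ^ G.sizeWeight A₁ + y ^ G.sizeWeight A₂ ≤ y ^ G.sizeWeight A := by
  have key : ∀ {k a : ℕ}, k + a ≤ G.sizeWeight A → y ^ k ≤ y⁻¹ ^ a * y ^ G.sizeWeight A :=
    fun h => pow_le_inv_pow_mul hy h
  have hx4 : y⁻¹ ^ 4 = 1 / 2 := by rw [inv_pow, hy4]; norm_num
  set m := G.sizeWeight A
  set x := y⁻¹
  have hx0 : 0 < x := inv_pos.2 (by linarith)
  have hm : 0 < y ^ m := by positivity
  have fin : ∀ {a b : ℕ} {k l : ℕ}, k + a ≤ m → l + b ≤ m → x ^ a + x ^ b ≤ 1 →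
      y ^ k + y ^ l ≤ y ^ m := fun ha hb hab => by
    have := mul_le_of_le_one_left hm.le hab
    linarith [key ha, key hb]
  -- Here x = 2 ^ (-1/4), so x² ≈ 0.707 and x³ ≈ 0.595; coarse bounds suffice except for (4, 4),
  -- where equality holds.
  have hx2 : x ^ 2 ≤ 3 / 4 := by
    by_contra hlt
    nlinarith
  have hx3 : x ^ 3 ≤ 2 / 3 := by
    by_contra hlt
    have h1 : (2 / 3 : ℝ) ^ 4 < (x ^ 3) ^ 4 :=
      pow_lt_pow_left₀ (not_le.1 hlt) (by norm_num) (by norm_num)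
    have h2 : (x ^ 3) ^ 4 = (1 / 2) ^ 3 := by rw [← hx4]; ring
    rw [h2] at h1
    norm_num at h1
  rcases h.2.2.2 with ⟨ha, hb⟩ | ⟨ha, hb⟩ | ⟨ha, hb⟩
  · exact fin ha hb (by linarith)
  · exact fin ha hb (by
      have : x ^ 8 = (x ^ 4) ^ 2 := by ring
      rw [this, hx4]
      linarith)
  · exact fin ha hb (by
      have : x ^ 7 = x ^ 3 * x ^ 4 := by ring
      rw [this, hx4]
      linarith)

/-- Large extensions are charged more, since `y ^ 2` is √2. At a leaf only one extension `S` can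
remain, and its charge is covered because `S ⊆ A`. -/
theorem sum_preferredIn_pow_le {y : ℝ} (hy : 1 ≤ y) (hy4 : y ^ 4 = 2) (A : Finset V) :
    ∑ S ∈ G.preferredIn A, y ^ (2 * S.card) ≤ y ^ G.sizeWeight A := by
  induction hn : A.card using Nat.strong_induction_on generalizing A with
  | _ n ih =>
  subst hn
  have hcard := Finset.card_le_card (reduct_subset (G := G) A)
  rw [← preferredIn_reduct]
  have hle : G.sizeWeight (G.reduct A) ≤ G.sizeWeight A := by
    simpa using sizeWeight_add_le' (G := G) (Z := ∅) (reduct_subset A) (by simp) (by simp)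
  refine le_trans ?_ (pow_le_pow_right₀ hy hle)
  set A' := G.reduct A with hA'
  have hred : G.IsReduced A' := isReduced_reduct A
  rcases (G.attackCore A').eq_empty_or_nonempty with he | hne
  · have hsub := (hred.isConflictFree he).preferredIn_subsingleton
    rcases (G.preferredIn A').eq_empty_or_nonempty with h0 | ⟨S, hS⟩
    · rw [h0, Finset.sum_empty]
      positivity
    · have : G.preferredIn A' = {S} :=
        Finset.eq_singleton_iff_unique_mem.2 ⟨hS, fun T hT => hsub T hT S hS⟩
      rw [this, Finset.sum_singleton]
      refine pow_le_pow_right₀ hy ?_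
      have := Finset.card_le_card (mem_preferredIn.1 hS).2
      unfold sizeWeight
      omega
  · obtain ⟨A₁, A₂, hsplit⟩ := hred.exists_goodSplit hne
    refine le_trans ?_ (hsplit.add_le hy hy4)
    obtain ⟨h1, h2, hcov, hw⟩ := hsplit
    have lt_of : ∀ A'' ⊆ A', G.sizeWeight A'' < G.sizeWeight A' → A''.card < A.card := by
      intro A'' hsub hlt
      refine (Finset.card_lt_card (hsub.ssubset_of_ne ?_)).trans_le hcard
      rintro rfl
      exact lt_irrefl _ hlt
    have hsub : G.preferredIn A' ⊆ G.preferredIn A₁ ∪ G.preferredIn A₂ := by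
      intro S hS
      obtain ⟨hS, hSA⟩ := mem_preferredIn.1 hS
      exact Finset.mem_union.2 ((hcov S hS.1 hSA).imp (fun h => mem_preferredIn.2 ⟨hS, h⟩)
        fun h => mem_preferredIn.2 ⟨hS, h⟩)
    have hpos : ∀ S : Finset V, 0 ≤ y ^ (2 * S.card) := fun S => by positivity
    calc ∑ S ∈ G.preferredIn A', y ^ (2 * S.card)
        ≤ ∑ S ∈ G.preferredIn A₁ ∪ G.preferredIn A₂, y ^ (2 * S.card) :=
          Finset.sum_le_sum_of_subset_of_nonneg hsub fun S _ _ => hpos S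
      _ ≤ ∑ S ∈ G.preferredIn A₁, y ^ (2 * S.card) + ∑ S ∈ G.preferredIn A₂, y ^ (2 * S.card) := by
          rw [← Finset.sum_union_inter]
          exact le_add_of_nonneg_right (Finset.sum_nonneg fun S _ => hpos S)
      _ ≤ _ := add_le_add (ih _ (lt_of A₁ h1 (by omega)) _ rfl) (ih _ (lt_of A₂ h2 (by omega)) _ rfl)

end SizeBound

/-- For fixed `S`, let `A` contain `S` and each further vertex independently with probability `(y ^
2)⁻¹`. Replacing 1 by the total probability and exchanging the sums leaves the size-weighted sum for
each `A`. Its bound cancels the factor `y ^ (2 * A.card)`, and what remains factors over the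
vertices. -/
theorem numPreferred_le_of_pow_four {y : ℝ} (hy : 1 ≤ y) (hy4 : y ^ 4 = 2) {V : Type*} [Fintype V]
    (G : Digraph V) : (G.numPreferred : ℝ) ≤
      (y + (1 - (y ^ 2)⁻¹)) ^ G.resolutionOrder *
        (1 + (1 - (y ^ 2)⁻¹)) ^ (Fintype.card V - G.resolutionOrder) := by
  let _ : LinearOrder V := LinearOrder.lift' (Fintype.equivFin V) (Fintype.equivFin V).injective
  have hy0 : 0 < y := by linarith
  set a : ℝ := 1 - (y ^ 2)⁻¹ with ha
  have ha0 : 0 ≤ a := sub_nonneg.2 (inv_le_one_of_one_le₀ (one_le_pow₀ hy))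
  set R := G.mutualSet Finset.univ
  set F := G.preferredIn Finset.univ
  -- The expansion of ∏ 1, with 1 written as 1 + 0 at members of `S` and as `(y ^ 2)⁻¹ + a`
  -- elsewhere; the sum is in fact equal to 1.
  have hone : ∀ S : Finset V, (1 : ℝ) ≤ ∑ A : Finset V,
      if S ⊆ A then (y ^ (2 * A.card))⁻¹ * y ^ (2 * S.card) * a ^ (Finset.univ \ A).card
      else 0 := by
    intro S
    have h := Finset.prod_add (fun i => if i ∈ S then 1 else (y ^ 2)⁻¹)
      (fun i => if i ∈ S then 0 else a) (Finset.univ : Finset V)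
    rw [Finset.prod_eq_one (fun i _ => by split_ifs <;> simp [ha])] at h
    rw [h, Finset.powerset_univ]
    refine Finset.sum_le_sum fun A _ => ?_
    split_ifs with hSA
    · refine le_of_eq ?_
      congr 1
      · have h1 : ∏ i ∈ A, (if i ∈ S then 1 else (y ^ 2)⁻¹) = ∏ i ∈ A \ S, (y ^ 2)⁻¹ := by
          rw [← Finset.prod_sdiff hSA, Finset.prod_congr rfl (g := fun _ => (y ^ 2)⁻¹)
            (fun i hi => if_neg (Finset.mem_sdiff.1 hi).2),
            Finset.prod_congr (s₁ := S) rfl (g := fun _ => (1 : ℝ)) (fun i hi => if_pos hi)]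
          simp
        have h2 := Finset.card_sdiff_add_card_eq_card hSA
        rw [h1, Finset.prod_const, ← h2]
        have h3 : ((y ^ 2)⁻¹) ^ (A \ S).card * (y ^ 2) ^ (A \ S).card = 1 := by
          rw [← mul_pow, inv_mul_cancel₀ (by positivity), one_pow]
        rw [eq_comm, inv_mul_eq_iff_eq_mul₀ (by positivity), mul_add, pow_add,
          pow_mul y 2 (A \ S).card]
        linear_combination (-y ^ (2 * S.card)) * h3
      · rw [Finset.prod_congr rfl (g := fun _ => a)
          (fun i hi => if_neg fun hiS => (Finset.mem_sdiff.1 hi).2 (hSA hiS)), Finset.prod_const]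
    · obtain ⟨i, hiS, hiA⟩ := Finset.not_subset.1 hSA
      have h0 : ∏ i ∈ Finset.univ \ A, (if i ∈ S then 0 else a) = 0 :=
        Finset.prod_eq_zero (i := i) (by simpa using hiA) (by rw [if_pos hiS])
      rw [h0, mul_zero]
  have hsize : ∀ A : Finset V, G.sizeWeight A ≤ 2 * A.card + (A ∩ R).card := fun A =>
    Nat.add_le_add_left (Finset.card_le_card (Finset.subset_inter (G.mutualSet_subset A)
      (mutualSet_mono (Finset.subset_univ A)))) _
  calc (G.numPreferred : ℝ) = ∑ S ∈ F, 1 := by rw [numPreferred_eq]; simp [F]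
    _ ≤ ∑ S ∈ F, ∑ A : Finset V,
        if S ⊆ A then (y ^ (2 * A.card))⁻¹ * y ^ (2 * S.card) * a ^ (Finset.univ \ A).card
        else 0 := Finset.sum_le_sum fun S _ => hone S
    _ = ∑ A : Finset V, (y ^ (2 * A.card))⁻¹ * a ^ (Finset.univ \ A).card *
        ∑ S ∈ G.preferredIn A, y ^ (2 * S.card) := by
      rw [Finset.sum_comm]
      refine Finset.sum_congr rfl fun A _ => ?_
      have : G.preferredIn A = {S ∈ F | S ⊆ A} := by
        ext S
        simp [F, mem_preferredIn]
      rw [← Finset.sum_filter, this, Finset.mul_sum]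
      exact Finset.sum_congr rfl fun S _ => by ring
    _ ≤ ∑ A : Finset V, (∏ i ∈ A, if i ∈ R then y else 1) * ∏ i ∈ Finset.univ \ A, a := by
      refine Finset.sum_le_sum fun A _ => ?_
      have h1 := (sum_preferredIn_pow_le hy hy4 A).trans (pow_le_pow_right₀ hy (hsize A))
      have h2 : ∏ i ∈ A, (if i ∈ R then y else 1) = y ^ (A ∩ R).card := by
        rw [Finset.prod_ite_mem, Finset.prod_const]
      rw [h2, Finset.prod_const]
      calc _ ≤ (y ^ (2 * A.card))⁻¹ * a ^ (Finset.univ \ A).card *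
            y ^ (2 * A.card + (A ∩ R).card) := mul_le_mul_of_nonneg_left h1 (by positivity)
        _ = _ := by
          rw [pow_add]
          field_simp
    _ = ∏ i : V, ((if i ∈ R then y else 1) + a) := by
      rw [Finset.prod_add, Finset.powerset_univ]
    _ = _ := by
      have h3 := Finset.prod_filter_mul_prod_filter_not (Finset.univ : Finset V) (· ∈ R)
        (fun i => (if i ∈ R then y else 1) + a)
      rw [← h3, Finset.prod_congr rfl (g := fun _ => y + a)
        (fun i hi => by rw [if_pos (Finset.mem_filter.1 hi).2]),
        Finset.prod_congr (s₁ := Finset.filter (· ∉ R) Finset.univ) rfl (g := fun _ => 1 + a)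
        (fun i hi => by rw [if_neg (Finset.mem_filter.1 hi).2]), Finset.prod_const,
        Finset.prod_const]
      have h4 : (Finset.filter (· ∈ R) Finset.univ).card = G.resolutionOrder := by
        rw [← card_mutualSet_univ]
        congr 1
        ext i
        simp [R]
      have h5 := Finset.card_filter_add_card_filter_not (s := (Finset.univ : Finset V)) (· ∈ R)
      rw [h4, Finset.card_univ] at h5
      rw [h4, ← h5, Nat.add_sub_cancel_left]

theorem numPreferred_le_sqrt {V : Type*} [Fintype V] (G : Digraph V) : (G.numPreferred : ℝ) ≤
    (1 + (2 : ℝ) ^ (1 / 4 : ℝ) - 1 / √2) ^ G.resolutionOrder *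
      (2 - 1 / √2) ^ (Fintype.card V - G.resolutionOrder) := by
  have h2 : ((2 : ℝ) ^ (1 / 4 : ℝ)) ^ 2 = √2 := by
    rw [Real.sqrt_eq_rpow, ← Real.rpow_natCast, ← Real.rpow_mul (by norm_num)]
    norm_num
  have h4 : ((2 : ℝ) ^ (1 / 4 : ℝ)) ^ 4 = 2 := by
    rw [← Real.rpow_natCast, ← Real.rpow_mul (by norm_num)]
    norm_num
  have h := numPreferred_le_of_pow_four (Real.one_le_rpow (by norm_num) (by norm_num)) h4 G
  rw [h2] at h
  convert h using 3 <;> ring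

end Digraph

/-! ### Families of pairwise conflicting independent sets -/

namespace Digraph

open scoped Classical

set_option linter.unusedSectionVars false

/-- Among integers, m ^ (1 / m) is largest at m = 3. -/
theorem le_pow_of_pow_three {c : ℝ} (hc : 0 ≤ c) (hc3 : c ^ 3 = 3) (m : ℕ) : (m : ℝ) ≤ c ^ m := by
  have h : ∀ m : ℕ, m ^ 3 ≤ 3 ^ m := by
    intro m
    rcases Nat.lt_or_ge m 3 with h | h
    · interval_cases m <;> norm_num
    · induction m, h using Nat.le_induction with
      | base => norm_num
      | succ k hk ih =>
        obtain ⟨j, rfl⟩ := Nat.exists_eq_add_of_le hk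
        have : (3 + j + 1) ^ 3 ≤ (3 + j) ^ 3 * 3 :=
          -- The witness is the difference 3 (3 + j)³ − (4 + j)³.
          Nat.le.intro (k := 2 * j ^ 3 + 15 * j ^ 2 + 33 * j + 17) (by ring)
        exact this.trans (Nat.mul_le_mul_right 3 ih)
  refine le_of_pow_le_pow_left₀ (n := 3) (by norm_num) (pow_nonneg hc m) ?_
  rw [← pow_mul, mul_comm m 3, pow_mul, hc3]
  exact_mod_cast h m

variable {V : Type*} {G : Digraph V}

variable (G) in
/-- Any two members of `F` are joined by an arc. -/
def PairwiseConflicting (F : Finset (Finset V)) : Prop :=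
  ∀ S ∈ F, ∀ T ∈ F, S ≠ T → ∃ s ∈ S, ∃ t ∈ T, G.Nbr s t

/-- The Moon–Moser bound. -/
theorem PairwiseConflicting.card_le {c : ℝ} (hc : 0 < c) (hc3 : c ^ 3 = 3) (A : Finset V)
    (F : Finset (Finset V)) (hF : G.PairwiseConflicting F)
    (hind : ∀ S ∈ F, G.IsConflictFree S ∧ S ⊆ A) : (F.card : ℝ) ≤ c ^ A.card := by
  induction hn : A.card using Nat.strong_induction_on generalizing A F with
  | _ n ih =>
  subst hn
  rcases A.eq_empty_or_nonempty with rfl | hA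
  · have : F.card ≤ 1 := Finset.card_le_one.2 fun S hS T hT => by
      rw [Finset.subset_empty.1 (hind S hS).2, Finset.subset_empty.1 (hind T hT).2]
    simpa using this
  let M : V → Finset V := fun v => {i ∈ A | i = v ∨ G.Nbr i v}
  have memM : ∀ {i v}, i ∈ M v ↔ i ∈ A ∧ (i = v ∨ G.Nbr i v) := by simp [M]
  obtain ⟨v, hv, hmin⟩ := A.exists_min_image (fun v => (M v).card) hA
  -- Members of `F` are filed under each vertex of `M v` that they contain. Those that miss the
  -- smallest closed neighbourhood `M v` altogether are filed under `v` as well.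
  let F' : V → Finset (Finset V) := fun u => {S ∈ F | u ∈ S ∨ u = v ∧ ∀ i ∈ S, i ∉ M v}
  have memF' : ∀ {u S}, S ∈ F' u ↔ S ∈ F ∧ (u ∈ S ∨ u = v ∧ ∀ i ∈ S, i ∉ M v) := by simp [F']
  have hfar : ∀ {u S}, S ∈ F' u → ∀ i ∈ S, i ≠ u → i ∉ M u := by
    intro u S hS i hi hiu hiM
    obtain ⟨hS, h | ⟨rfl, h⟩⟩ := memF'.1 hS
    · rcases (memM.1 hiM).2 with h' | h' | h'
      · exact hiu h'
      · exact (hind S hS).1 i hi u h h'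
      · exact (hind S hS).1 u h i hi h'
    · exact h i hi hiM
  -- Away from `u`, sets filed under `u` avoid the neighbours of `u`, so no conflict between two of
  -- them uses `u`. Hence conflicts survive the erasure of `u`, which is therefore injective.
  have hconf : ∀ u, ∀ S ∈ F' u, ∀ T ∈ F' u, S ≠ T →
      ∃ s ∈ S.erase u, ∃ t ∈ T.erase u, G.Nbr s t := by
    intro u S hS T hT hST
    obtain ⟨hS', -⟩ := memF'.1 hS
    obtain ⟨hT', -⟩ := memF'.1 hT
    obtain ⟨s, hs, t, ht, hst⟩ := hF S hS' T hT' hST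
    have hloop : ∀ x ∈ S ∪ T, ¬ G.Nbr x x := by
      intro x hx hn
      rcases Finset.mem_union.1 hx with hx | hx
      · exact (hind S hS').1 x hx x hx (hn.elim id id)
      · exact (hind T hT').1 x hx x hx (hn.elim id id)
    refine ⟨s, Finset.mem_erase.2 ⟨?_, hs⟩, t, Finset.mem_erase.2 ⟨?_, ht⟩, hst⟩
    · rintro rfl
      have hne : t ≠ s := by
        rintro rfl
        exact hloop t (Finset.mem_union_left _ hs) hst
      exact hfar hT t ht hne (memM.2 ⟨(hind T hT').2 ht, Or.inr hst.symm⟩)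
    · rintro rfl
      have hne : s ≠ t := by
        rintro rfl
        exact hloop s (Finset.mem_union_left _ hs) hst
      exact hfar hS s hs hne (memM.2 ⟨(hind S hS').2 hs, Or.inr hst⟩)
  have hcover : F ⊆ (M v).biUnion F' := by
    intro S hS
    by_cases h : ∃ i ∈ S, i ∈ M v
    · obtain ⟨i, hi, hiM⟩ := h
      exact Finset.mem_biUnion.2 ⟨i, hiM, memF'.2 ⟨hS, Or.inl hi⟩⟩
    · push Not at h
      exact Finset.mem_biUnion.2 ⟨v, memM.2 ⟨hv, Or.inl rfl⟩, memF'.2 ⟨hS, Or.inr ⟨rfl, h⟩⟩⟩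
  -- The erased sets live in `A \ M u`, where induction applies, and `M u` is at least as large as
  -- `M v`.
  have hpiece : ∀ u ∈ A, ((F' u).card : ℝ) * c ^ (M v).card ≤ c ^ A.card := by
    intro u hu
    have hinj : Set.InjOn (fun S : Finset V => S.erase u) (F' u) := by
      intro S hS T hT hST
      by_contra hne
      obtain ⟨s, hs, t, ht, hst⟩ := hconf u S hS T hT hne
      have hs' : s ∈ T.erase u := by
        rw [← show S.erase u = T.erase u from hST]
        exact hs
      have hTF := (hind T (memF'.1 hT).1).1
      exact hst.elim (hTF s (Finset.mem_of_mem_erase hs') t (Finset.mem_of_mem_erase ht))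
        (hTF t (Finset.mem_of_mem_erase ht) s (Finset.mem_of_mem_erase hs'))
    have hMu : M u ⊆ A := Finset.filter_subset _ _
    have huM : u ∈ M u := memM.2 ⟨hu, Or.inl rfl⟩
    have hcard := Finset.card_sdiff_add_card_eq_card hMu
    have hpos : 0 < (M u).card := Finset.card_pos.2 ⟨u, huM⟩
    have h := ih _ (by omega) (A \ M u) ((F' u).image fun S => S.erase u)
      (fun S hS T hT hST => by
        obtain ⟨S', hS', rfl⟩ := Finset.mem_image.1 hS
        obtain ⟨T', hT', rfl⟩ := Finset.mem_image.1 hT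
        exact hconf u S' hS' T' hT' (by rintro rfl; exact hST rfl))
      (fun S hS => by
        obtain ⟨S', hS', rfl⟩ := Finset.mem_image.1 hS
        have hS'F := hind S' (memF'.1 hS').1
        refine ⟨hS'F.1.mono (Finset.erase_subset _ _), fun i hi => ?_⟩
        obtain ⟨hiu, hi⟩ := Finset.mem_erase.1 hi
        exact Finset.mem_sdiff.2 ⟨hS'F.2 hi, hfar hS' i hi hiu⟩) rfl
    rw [Finset.card_image_of_injOn hinj] at h
    have hc1 : 1 ≤ c := by
      by_contra hlt
      have := pow_lt_one₀ hc.le (not_le.1 hlt) (by norm_num : 3 ≠ 0)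
      linarith
    have hle : c ^ (M v).card ≤ c ^ (M u).card := pow_le_pow_right₀ hc1 (hmin u hu)
    calc ((F' u).card : ℝ) * c ^ (M v).card ≤ c ^ (A \ M u).card * c ^ (M u).card := by gcongr
      _ = c ^ A.card := by rw [← pow_add, hcard]
  have hle : (F.card : ℝ) ≤ ∑ u ∈ M v, ((F' u).card : ℝ) := by
    exact_mod_cast (Finset.card_le_card hcover).trans Finset.card_biUnion_le
  have hsum : (∑ u ∈ M v, ((F' u).card : ℝ)) * c ^ (M v).card ≤ (M v).card * c ^ A.card := by
    rw [Finset.sum_mul, ← nsmul_eq_mul]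
    exact Finset.sum_le_card_nsmul _ _ _ fun u hu => hpiece u (memM.1 hu).1
  have hm := le_pow_of_pow_three hc.le hc3 (M v).card
  have hpos : 0 < c ^ (M v).card := by positivity
  have : (F.card : ℝ) * c ^ (M v).card ≤ c ^ A.card * c ^ (M v).card := by
    calc _ ≤ _ := mul_le_mul_of_nonneg_right hle hpos.le
      _ ≤ _ := hsum
      _ ≤ c ^ (M v).card * c ^ A.card := by gcongr
      _ = _ := mul_comm _ _
  exact le_of_mul_le_mul_right this hpos

theorem pairwiseConflicting_preferredIn [Fintype V] (A : Finset V) :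
    G.PairwiseConflicting (G.preferredIn A) := by
  intro S hS T hT hST
  by_contra hno
  push Not at hno
  obtain ⟨hS, -⟩ := mem_preferredIn.1 hS
  obtain ⟨hT, -⟩ := mem_preferredIn.1 hT
  refine hST (hS.eq_of_union hT fun u hu v hv huv => ?_)
  rcases Finset.mem_union.1 hu with hu | hu <;> rcases Finset.mem_union.1 hv with hv | hv
  · exact hS.1.1 u hu v hv huv
  · exact hno u hu v hv (Or.inl huv)
  · exact hno v hv u hu (Or.inr huv)
  · exact hT.1.1 u hu v hv huv

theorem numPreferred_le_three_rpow [Fintype V] (G : Digraph V) :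
    (G.numPreferred : ℝ) ≤ (3 : ℝ) ^ ((Fintype.card V : ℝ) / 3) := by
  have hc3 : ((3 : ℝ) ^ (1 / 3 : ℝ)) ^ 3 = 3 := by
    rw [← Real.rpow_natCast, ← Real.rpow_mul (by norm_num)]
    norm_num
  have h := (pairwiseConflicting_preferredIn (G := G) Finset.univ).card_le
    (by positivity) hc3 Finset.univ _ fun S hS =>
      ⟨(mem_preferredIn.1 hS).1.1.1, Finset.subset_univ S⟩
  rw [← numPreferred_eq, Finset.card_univ, ← Real.rpow_natCast, ← Real.rpow_mul (by norm_num)] at h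
  convert h using 2
  ring

end Digraph

/-! ### Polynomial-time programs -/

namespace TreeData

/-- The number of cells of a tree. -/
def size : TreeData → ℕ
  | nil => 1
  | cons a b => a.size + b.size + 1

open scoped Classical in
/-- A truth value as a tree. -/
noncomputable def bit (p : Prop) : TreeData := ofBool (decide p)

/-- A natural number in unary. -/
def num (n : ℕ) : TreeData := ofList (List.replicate n nil)

theorem size_head_le (x : TreeData) : x.head.size ≤ x.size := by
  cases x <;> simp [head, size]; omega

theorem size_tail_le (x : TreeData) : x.tail.size ≤ x.size := by
  cases x <;> simp [tail, size]; omega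

theorem bit_true {p : Prop} (h : p) : bit p = cons nil nil := by simp [bit, h, ofBool]

theorem bit_false {p : Prop} (h : ¬ p) : bit p = nil := by simp [bit, h, ofBool]

theorem ofBool_decide (p : Prop) [h : Decidable p] : ofBool (decide p) = bit p := by
  unfold bit
  congr

theorem size_bit_le (p : Prop) : (bit p).size ≤ 3 := by
  by_cases h : p
  · simp [bit_true h, size]
  · simp [bit_false h, size]

theorem num_succ (n : ℕ) : num (n + 1) = cons nil (num n) := rfl

theorem size_num (n : ℕ) : (num n).size = 2 * n + 1 := by
  induction n with
  | zero => rfl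
  | succ n ih => rw [num_succ, size, ih, size]; omega

theorem size_ofList_le {l : List TreeData} {m : ℕ} (h : ∀ a ∈ l, a.size ≤ m) :
    (ofList l).size ≤ l.length * (m + 1) + 1 := by
  induction l with
  | nil => simp [ofList, size]
  | cons a l ih =>
    have h1 := h a (by simp)
    have h2 := ih fun b hb => h b (by simp [hb])
    rw [ofList, size, List.length_cons, Nat.succ_mul]
    omega

theorem size_le_of_mem {l : List TreeData} {a : TreeData} (h : a ∈ l) :
    a.size ≤ (ofList l).size := by
  induction l with
  | nil => simp at h
  | cons b l ih =>
    rw [ofList, size]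
    rcases List.mem_cons.1 h with rfl | h
    · omega
    · have := ih h
      omega

theorem length_le_size (l : List TreeData) : l.length ≤ (ofList l).size := by
  induction l with
  | nil => simp
  | cons b l ih => rw [ofList, size, List.length_cons]; omega

theorem iterate_tail_ofList (l : List TreeData) (k : ℕ) : tail^[k] (ofList l) = ofList (l.drop k) := by
  induction k generalizing l with
  | zero => rfl
  | succ k ih =>
    rw [Function.iterate_succ_apply]
    cases l with
    | nil => simpa [ofList, tail] using ih []
    | cons a l => exact ih l

theorem iterate_tail_num (k n : ℕ) : tail^[k] (num n) = num (n - k) := by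
  rw [num, iterate_tail_ofList, List.drop_replicate]
  rfl

theorem head_iterate_tail {n : ℕ} (f : Fin n → TreeData) (j : Fin n) :
    (tail^[(j : ℕ)] (ofList ((List.finRange n).map f))).head = f j := by
  rw [iterate_tail_ofList, List.drop_eq_getElem_cons (by simp), ofList, head]
  simp

end TreeData

namespace TreeProg

open TreeData Polynomial

theorem eval_mono_nat (P : ℕ[X]) {m n : ℕ} (h : m ≤ n) : P.eval m ≤ P.eval n := by
  induction P using Polynomial.induction_on' with
  | add p q hp hq => simpa using add_le_add hp hq
  | monomial k a => simpa using Nat.mul_le_mul_left a (Nat.pow_le_pow_left h k)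

/-- From the trees `x i` one can compute the trees `y i` in polynomial time, inside any procedure. -/
def PolyTime {ι : Type} (x y : ι → TreeData) : Prop :=
  ∃ (p : TreeProg) (P : ℕ[X]), ∀ i, (y i).size ≤ P.eval (x i).size ∧
    ∀ g, ∃ t ≤ P.eval (x i).size, Eval g p (x i) (y i) t

/-- Fold a list, see `TreeProg.eval_foldr`. -/
def foldrBody (step base : TreeProg) : TreeProg :=
  .branch .tail
    (.seq (.pair (.pair .head (.seq .tail .head)) (.seq (.pair .head (.seq .tail .tail)) .call)) step)
    (.seq .head base)

/-- The subprograms must work inside every procedure, because here they run inside that of the fold.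
The step is needed only on states that suffixes of `l` produce. -/
theorem eval_foldrBody {β : Type} {e : β → TreeData} {step base : TreeProg} {env : TreeData}
    {F : List β → TreeData} {T : ℕ} {l : List β} (hbase : ∀ g, ∃ t ≤ T, Eval g base env (F []) t)
    (hstep : ∀ a l', a :: l' <:+ l → ∀ g, ∃ t ≤ T,
      Eval g step (.cons (.cons env (e a)) (F l')) (F (a :: l')) t) :
    ∃ t ≤ (l.length + 1) * (T + 16),
      Eval (foldrBody step base) (foldrBody step base) (.cons env (ofList (l.map e))) (F l) t := by
  induction l with
  | nil =>
    obtain ⟨t, ht, h⟩ := hbase (foldrBody step base)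
    exact ⟨_, by simp only [List.length_nil]; omega,
      .branch_nil (.tail _ _) (.seq (.head _ _) h)⟩
  | cons a l ih =>
    obtain ⟨t, ht, h⟩ := ih fun b l' hl => hstep b l' (hl.trans (List.suffix_cons a l))
    obtain ⟨s, hs, h'⟩ := hstep a l List.suffix_rfl (foldrBody step base)
    refine ⟨_, ?_, .branch_cons (.tail _ _) (.seq (.pair (.pair (.head _ _)
      (.seq (.tail _ _) (.head _ _))) (.seq (.pair (.head _ _) (.seq (.tail _ _) (.tail _ _)))
      (.call h))) h')⟩
    rw [List.length_cons, Nat.succ_mul]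
    omega

theorem eval_foldr {β : Type} {e : β → TreeData} {step base : TreeProg} {env : TreeData}
    {F : List β → TreeData} {T : ℕ} {l : List β} (hbase : ∀ g, ∃ t ≤ T, Eval g base env (F []) t)
    (hstep : ∀ a l', a :: l' <:+ l → ∀ g, ∃ t ≤ T,
      Eval g step (.cons (.cons env (e a)) (F l')) (F (a :: l')) t) (g : TreeProg) :
    ∃ t ≤ (l.length + 1) * (T + 16) + 1,
      Eval g (.procedure (foldrBody step base)) (.cons env (ofList (l.map e))) (F l) t :=
  let ⟨_, ht, h⟩ := eval_foldrBody hbase hstep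
  ⟨_, Nat.succ_le_succ ht, .procedure h⟩

namespace PolyTime

variable {ι κ : Type} {x y z : ι → TreeData}

theorem refl (x : ι → TreeData) : PolyTime x x :=
  ⟨.id, X + 1, fun i => ⟨by simp, fun g => ⟨1, by simp, .id _ _⟩⟩⟩

/-- The size clause of `PolyTime` is needed here: the second bound is evaluated at the size of the
intermediate result. -/
theorem trans (h : PolyTime x y) (h' : PolyTime y z) : PolyTime x z := by
  obtain ⟨p, P, hp⟩ := h
  obtain ⟨q, Q, hq⟩ := h'
  refine ⟨.seq p q, P + Q.comp P + 1, fun i => ?_⟩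
  have hm := eval_mono_nat Q (hp i).1
  simp only [eval_add, eval_comp, eval_one]
  refine ⟨by have := (hq i).1; omega, fun g => ?_⟩
  obtain ⟨t, ht, h⟩ := (hp i).2 g
  obtain ⟨s, hs, h'⟩ := (hq i).2 g
  exact ⟨_, by omega, .seq h h'⟩

theorem reindex (h : PolyTime x y) (f : κ → ι) :
    PolyTime (fun k => x (f k)) (fun k => y (f k)) := by
  obtain ⟨p, P, hp⟩ := h
  exact ⟨p, P, fun k => hp (f k)⟩

theorem congr (h : PolyTime x y) (hyz : ∀ i, y i = z i) : PolyTime x z := by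
  rwa [← show y = z from funext hyz]

theorem pair (h : PolyTime x y) (h' : PolyTime x z) :
    PolyTime x (fun i => .cons (y i) (z i)) := by
  obtain ⟨p, P, hp⟩ := h
  obtain ⟨q, Q, hq⟩ := h'
  refine ⟨.pair p q, P + Q + 1, fun i => ?_⟩
  simp only [eval_add, eval_one]
  refine ⟨by have := (hp i).1; have := (hq i).1; rw [size]; omega, fun g => ?_⟩
  obtain ⟨t, ht, h⟩ := (hp i).2 g
  obtain ⟨s, hs, h'⟩ := (hq i).2 g
  exact ⟨_, by omega, .pair h h'⟩

theorem nil (x : ι → TreeData) : PolyTime x (fun _ => .nil) :=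
  ⟨.nil, 1, fun i => ⟨by simp [size], fun g => ⟨1, by simp, .nil _ _⟩⟩⟩

theorem const (x : ι → TreeData) (c : TreeData) : PolyTime x (fun _ => c) := by
  induction c with
  | nil => exact nil x
  | cons a b ha hb => exact ha.pair hb

theorem head (h : PolyTime x y) : PolyTime x (fun i => (y i).head) :=
  h.trans ⟨.head, X + 1, fun i => ⟨by simpa using (size_head_le (y i)).trans (Nat.le_succ _),
    fun g => ⟨1, by simp, .head _ _⟩⟩⟩

theorem tail (h : PolyTime x y) : PolyTime x (fun i => (y i).tail) :=
  h.trans ⟨.tail, X + 1, fun i => ⟨by simpa using (size_tail_le (y i)).trans (Nat.le_succ _),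
    fun g => ⟨1, by simp, .tail _ _⟩⟩⟩

theorem fst (h : PolyTime x (fun i => .cons (y i) (z i))) : PolyTime x y := h.head

theorem snd (h : PolyTime x (fun i => .cons (y i) (z i))) : PolyTime x z := h.tail

/-- Add a variable to the context. -/
theorem weak {f : κ → ι} {w : κ → TreeData} (h : PolyTime x y) :
    PolyTime (fun k => .cons (x (f k)) (w k)) (fun k => y (f k)) :=
  (fst (refl _)).trans (h.reindex f)

/-- Add a variable of the same index to the context. -/
theorem skip {w : ι → TreeData} (h : PolyTime x y) :
    PolyTime (fun i => .cons (x i) (w i)) y := (fst (refl _)).trans h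

/-- The last variable of the context. -/
theorem last (x w : ι → TreeData) : PolyTime (fun i => .cons (x i) (w i)) w := snd (refl _)

open scoped Classical in
theorem ite {p : ι → Prop} (hp : PolyTime x (fun i => bit (p i))) (hy : PolyTime x y)
    (hz : PolyTime x z) : PolyTime x (fun i => if p i then y i else z i) := by
  obtain ⟨p', P, hp⟩ := hp
  obtain ⟨q, Q, hq⟩ := hy
  obtain ⟨r, R, hr⟩ := hz
  refine ⟨.branch p' q r, P + Q + R + 1, fun i => ?_⟩
  simp only [eval_add, eval_one]
  have hpi := (hp i).2
  by_cases h : p i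
  · simp only [h, if_true]
    refine ⟨by have := (hq i).1; omega, fun g => ?_⟩
    obtain ⟨t, ht, h1⟩ := hpi g
    obtain ⟨s, hs, h2⟩ := (hq i).2 g
    simp only [bit_true h] at h1
    exact ⟨_, by omega, .branch_cons h1 h2⟩
  · simp only [h, if_false]
    refine ⟨by have := (hr i).1; omega, fun g => ?_⟩
    obtain ⟨t, ht, h1⟩ := hpi g
    obtain ⟨s, hs, h2⟩ := (hr i).2 g
    simp only [bit_false h] at h1
    exact ⟨_, by omega, .branch_nil h1 h2⟩

section Logic

variable {p q : ι → Prop}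

theorem bit_congr (hp : PolyTime x (fun i => bit (p i))) (h : ∀ i, p i ↔ q i) :
    PolyTime x (fun i => bit (q i)) :=
  hp.congr fun i => by rw [propext (h i)]

theorem and (hp : PolyTime x (fun i => bit (p i))) (hq : PolyTime x (fun i => bit (q i))) :
    PolyTime x (fun i => bit (p i ∧ q i)) :=
  (hp.ite hq (nil x)).congr fun i => by
    by_cases h : p i <;> simp [h, bit_false]

theorem not (hp : PolyTime x (fun i => bit (p i))) : PolyTime x (fun i => bit (¬ p i)) :=
  (hp.ite (nil x) (const x (.cons .nil .nil))).congr fun i => by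
    by_cases h : p i <;> simp [h, bit_false, bit_true]

theorem or (hp : PolyTime x (fun i => bit (p i))) (hq : PolyTime x (fun i => bit (q i))) :
    PolyTime x (fun i => bit (p i ∨ q i)) :=
  (hp.not.and hq.not).not.bit_congr fun i => by tauto

theorem imp (hp : PolyTime x (fun i => bit (p i))) (hq : PolyTime x (fun i => bit (q i))) :
    PolyTime x (fun i => bit (p i → q i)) :=
  (hp.and hq.not).not.bit_congr fun i => by tauto

theorem ne_nil (h : PolyTime x y) : PolyTime x (fun i => bit (y i ≠ .nil)) := by
  refine h.trans ⟨.branch .id (.pair .nil .nil) .nil, 6, fun i => ?_⟩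
  have h6 : (6 : ℕ[X]).eval (y i).size = 6 := by simp
  rw [h6]
  refine ⟨(size_bit_le _).trans (by norm_num), fun g => ?_⟩
  cases hy : y i with
  | nil =>
    simp only [hy, bit_false (not_not.2 (rfl : TreeData.nil = .nil))]
    exact ⟨_, by norm_num, .branch_nil (.id _ _) (.nil _ _)⟩
  | cons a b =>
    simp only [hy, bit_true (show TreeData.cons a b ≠ .nil by simp)]
    exact ⟨_, by norm_num, .branch_cons (.id _ _) (.pair (.nil _ _) (.nil _ _))⟩

end Logic

/-- A polynomial-time step alone would let the state grow exponentially over the iterations; `hsize`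
rules this out for every suffix, that is, for every intermediate state. -/
theorem foldr {β σ : ι → Type} {l : ∀ i, List (β i)} {e : ∀ i, β i → TreeData}
    {s : ∀ i, σ i → TreeData} {init : ∀ i, σ i} {f : ∀ i, β i → σ i → σ i}
    (hl : PolyTime x (fun i => ofList ((l i).map (e i))))
    (hinit : PolyTime x (fun i => s i (init i)))
    (hstep : PolyTime (fun k : Σ i, β i × σ i => .cons (.cons (x k.1) (e k.1 k.2.1)) (s k.1 k.2.2))
      (fun k => s k.1 (f k.1 k.2.1 k.2.2)))
    (hsize : ∃ P : ℕ[X], ∀ i, ∀ l' : List (β i), l' <:+ l i →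
      (s i (l'.foldr (f i) (init i))).size ≤ P.eval (x i).size) :
    PolyTime x (fun i => s i ((l i).foldr (f i) (init i))) := by
  obtain ⟨pl, L, hl⟩ := hl
  obtain ⟨pb, B, hb⟩ := hinit
  obtain ⟨ps, S, hs⟩ := hstep
  obtain ⟨P, hP⟩ := hsize
  -- The cost of the base plus that of a step on an input whose size counts the environment, one
  -- list element and the state.
  let T : ℕ[X] := B + S.comp (X + L + 1 + P + 1)
  refine ⟨.seq (.pair .id pl) (.procedure (foldrBody ps pb)),
    P + (L + 1 + 1) + ((L + 1) * (T + 16) + 1) + 1, fun i => ?_⟩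
  have hLlen : (l i).length ≤ L.eval (x i).size := by
    have := length_le_size ((l i).map (e i))
    rw [List.length_map] at this
    exact this.trans (hl i).1
  have key := eval_foldr (e := e i) (step := ps) (base := pb) (env := x i) (l := l i)
    (F := fun l' => s i (l'.foldr (f i) (init i))) (T := T.eval (x i).size)
    (fun g => by
      obtain ⟨t, ht, h⟩ := (hb i).2 g
      exact ⟨t, ht.trans (by simp [T]), h⟩)
    (fun a l' hal g => by
      obtain ⟨t, ht, h⟩ := (hs ⟨i, a, l'.foldr (f i) (init i)⟩).2 g
      refine ⟨t, ht.trans ?_, h⟩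
      have hsz : (TreeData.cons (.cons (x i) (e i a)) (s i (l'.foldr (f i) (init i)))).size ≤
          (X + L + 1 + P + 1 : ℕ[X]).eval (x i).size := by
        have h1 := hP i l' ((List.suffix_cons a l').trans hal)
        have h2 : (e i a).size ≤ (ofList ((l i).map (e i))).size :=
          size_le_of_mem (List.mem_map_of_mem (hal.subset (by simp)))
        have h3 : (ofList ((l i).map (e i))).size ≤ L.eval (x i).size := (hl i).1
        simp only [size, eval_add, eval_one, eval_X]
        omega
      have := eval_mono_nat S hsz
      refine this.trans ?_
      simp only [T, eval_add, eval_comp]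
      exact Nat.le_add_left _ _)
  refine ⟨?_, fun g => ?_⟩
  · have := hP i (l i) List.suffix_rfl
    simp only [eval_add, eval_one]
    omega
  · obtain ⟨t, ht, h⟩ := (hl i).2 g
    obtain ⟨t', ht', h'⟩ := key g
    refine ⟨_, ?_, .seq (.pair (.id _ _) h) h'⟩
    have h1 : ((l i).length + 1) * (T.eval (x i).size + 16) ≤
        (L.eval (x i).size + 1) * (T.eval (x i).size + 16) :=
      Nat.mul_le_mul_right _ (by simpa using hLlen)
    have h16 : (16 : ℕ[X]).eval (x i).size = 16 := by simp
    simp only [eval_add, eval_one, eval_mul, h16]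
    omega

end PolyTime

end TreeProg

/-! ### First-order definable operations on vertex sets are computable in polynomial time -/

namespace TreeProg

open TreeData Polynomial

theorem ofFinset_eq {n : ℕ} (S : Finset (Fin n)) :
    ofFinset S = ofList ((List.finRange n).map fun i => bit (i ∈ S)) := by
  unfold ofFinset
  simp only [ofBool_decide]

theorem ofDigraph_eq {n : ℕ} (G : Digraph (Fin n)) :
    ofDigraph G = ofList ((List.finRange n).map fun i =>
      ofList ((List.finRange n).map fun j => bit (G.Adj i j))) := rfl

theorem size_ofFinset_le {n : ℕ} (S : Finset (Fin n)) : (ofFinset S).size ≤ 4 * n + 1 := by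
  rw [ofFinset_eq]
  refine (size_ofList_le (m := 3) fun a ha => ?_).trans (by simp; omega)
  obtain ⟨i, -, rfl⟩ := List.mem_map.1 ha
  exact size_bit_le _

namespace PolyTime

variable {ι : Type} {x y : ι → TreeData} {n : ι → ℕ}

theorem map {β : ι → Type} {l : ∀ i, List (β i)} {e h : ∀ i, β i → TreeData}
    (hl : PolyTime x (fun i => ofList ((l i).map (e i))))
    (hh : PolyTime (fun k : Σ i, β i => .cons (x k.1) (e k.1 k.2)) (fun k => h k.1 k.2)) :
    PolyTime x (fun i => ofList ((l i).map (h i))) := by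
  have hsize : ∃ P : ℕ[X], ∀ i, ∀ l' : List (β i), l' <:+ l i →
      (ofList (l'.map (h i))).size ≤ P.eval (x i).size := by
    obtain ⟨pl, L, hl⟩ := hl
    obtain ⟨ph, H, hh⟩ := hh
    refine ⟨L * (H.comp (X + L + 1) + 1) + 1, fun i l' hl' => ?_⟩
    have h1 : (ofList ((l i).map (e i))).size ≤ L.eval (x i).size := (hl i).1
    have h2 : l'.length ≤ L.eval (x i).size := by
      have := length_le_size ((l i).map (e i))
      rw [List.length_map] at this
      exact hl'.length_le.trans (this.trans h1)
    refine (size_ofList_le (m := H.eval ((X + L + 1 : ℕ[X]).eval (x i).size)) fun a ha => ?_).trans ?_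
    · obtain ⟨b, hb, rfl⟩ := List.mem_map.1 ha
      refine (hh ⟨i, b⟩).1.trans (eval_mono_nat H ?_)
      have := size_le_of_mem (List.mem_map_of_mem (f := e i) (hl'.subset hb))
      simp only [size, eval_add, eval_one, eval_X]
      omega
    · simp only [eval_add, eval_one, eval_mul, eval_comp, List.length_map]
      gcongr
  refine (foldr (σ := fun i => List (β i)) (s := fun i l' => ofList (l'.map (h i)))
    (init := fun i => []) (f := fun i b l' => b :: l') hl (nil x) ?_ ?_).congr fun i => ?_
  · exact ((hh.reindex fun k : Σ i, β i × List (β i) => ⟨k.1, k.2.1⟩).weak).pair (last _ _)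
  · simpa using hsize
  · simp

/-- A unary number is a list, so folding over it is a loop with that many rounds. -/
theorem iterate_tail {m : ι → ℕ} (hm : PolyTime x (fun i => num (m i))) (hy : PolyTime x y) :
    PolyTime x (fun i => TreeData.tail^[m i] (y i)) := by
  have fold : ∀ (m : ℕ) (y : TreeData),
      (List.replicate m ()).foldr (fun _ s => s.tail) y = TreeData.tail^[m] y := by
    intro m y
    induction m with
    | zero => rfl
    | succ m ih => rw [Function.iterate_succ_apply', ← ih]; rfl
  refine (foldr (β := fun _ => Unit) (σ := fun _ => TreeData) (s := fun _ t => t)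
    (e := fun _ _ => .nil) (l := fun i => List.replicate (m i) ()) (init := y)
    (f := fun _ _ s => s.tail) (hm.congr fun i => by simp [num]) hy (last _ _).tail ?_).congr
    fun i => fold (m i) (y i)
  obtain ⟨p, P, hp⟩ := hy
  refine ⟨P, fun i l' _ => le_trans ?_ (hp i).1⟩
  induction l' with
  | nil => exact le_rfl
  | cons a l' ih =>
    exact (size_tail_le _).trans (ih ((List.suffix_cons a l').trans (by assumption)))

theorem get {f : ∀ i, Fin (n i) → TreeData} {u : ∀ i, Fin (n i)}
    (hf : PolyTime x (fun i => ofList ((List.finRange (n i)).map (f i))))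
    (hu : PolyTime x (fun i => num (u i))) : PolyTime x (fun i => f i (u i)) :=
  (iterate_tail hu hf).head.congr fun i => head_iterate_tail (f i) (u i)

/-- Dropping `a` cells from the unary `b` leaves a nonempty list exactly if `a < b`. -/
theorem lt {a b : ι → ℕ} (ha : PolyTime x (fun i => num (a i)))
    (hb : PolyTime x (fun i => num (b i))) : PolyTime x (fun i => bit (a i < b i)) := by
  refine (iterate_tail ha hb).ne_nil.bit_congr fun i => ?_
  rw [iterate_tail_num]
  cases h : b i - a i with
  | zero => exact ⟨fun h => absurd rfl h, fun h => by omega⟩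
  | succ k => exact ⟨fun _ => by omega, fun _ => by simp [num_succ]⟩

theorem le {a b : ι → ℕ} (ha : PolyTime x (fun i => num (a i)))
    (hb : PolyTime x (fun i => num (b i))) : PolyTime x (fun i => bit (a i ≤ b i)) :=
  (lt hb ha).not.bit_congr fun _ => not_lt

theorem add_const {a : ι → ℕ} (ha : PolyTime x (fun i => num (a i))) (k : ℕ) :
    PolyTime x (fun i => num (a i + k)) := by
  induction k with
  | zero => exact ha
  | succ k ih => exact ((nil x).pair ih).congr fun i => (num_succ _).symm

theorem add {a b : ι → ℕ} (ha : PolyTime x (fun i => num (a i)))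
    (hb : PolyTime x (fun i => num (b i))) : PolyTime x (fun i => num (a i + b i)) := by
  have fold : ∀ m b : ℕ, (List.replicate m ()).foldr (fun _ s => s + 1) b = m + b := by
    intro m b
    induction m with
    | zero => simp
    | succ m ih => rw [List.replicate_succ, List.foldr_cons, ih]; omega
  refine (foldr (β := fun _ => Unit) (σ := fun _ => ℕ) (s := fun _ => num)
    (e := fun _ _ => .nil) (l := fun i => List.replicate (a i) ()) (init := b)
    (f := fun _ _ s => s + 1) (ha.congr fun i => by simp [num]) hb (add_const (last _ _) 1)
    ?_).congr fun i => by rw [fold]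
  obtain ⟨p, P, hp⟩ := ha
  obtain ⟨q, Q, hq⟩ := hb
  refine ⟨P + Q, fun i l' hl' => ?_⟩
  obtain ⟨hlen, hl'⟩ := List.suffix_replicate_iff.1 hl'
  rw [hl', fold, size_num]
  have h1 := (hp i).1
  have h2 := (hq i).1
  simp only [size_num] at h1 h2
  simp only [eval_add]
  omega

/-- Built by repeatedly incrementing all entries and prepending 0; quantifiers over vertices range
over this list. -/
theorem fins (hn : PolyTime x (fun i => num (n i))) :
    PolyTime x (fun i => ofList ((List.finRange (n i)).map fun j : Fin (n i) => num j)) := by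
  have fold : ∀ m : ℕ, (List.replicate m ()).foldr (fun _ s => 0 :: s.map (· + 1)) [] =
      (List.finRange m).map fun j : Fin m => (j : ℕ) := by
    intro m
    induction m with
    | zero => simp
    | succ m ih =>
      rw [List.replicate_succ, List.foldr_cons, ih, List.finRange_succ, List.map_cons,
        List.map_map, List.map_map]
      rfl
  have hsz : ∃ P : ℕ[X], ∀ i, ∀ l' : List Unit, l' <:+ List.replicate (n i) () →
      (ofList ((l'.foldr (fun _ s => 0 :: s.map (· + 1)) []).map num)).size ≤
        P.eval (x i).size := by
    obtain ⟨p, P, hp⟩ := hn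
    refine ⟨P * (P + 1) + 1, fun i l' hl' => ?_⟩
    obtain ⟨hlen, hl'⟩ := List.suffix_replicate_iff.1 hl'
    have h1 := (hp i).1
    simp only [size_num] at h1
    rw [hl', fold]
    refine (size_ofList_le (m := P.eval (x i).size) fun a ha => ?_).trans ?_
    · simp only [List.map_map, List.mem_map, List.mem_finRange, true_and, Function.comp] at ha
      obtain ⟨j, rfl⟩ := ha
      rw [size_num]
      omega
    · simp only [eval_add, eval_mul, eval_one, List.length_map, List.length_finRange]
      gcongr
      omega
  refine (foldr (β := fun _ => Unit) (σ := fun _ => List ℕ) (s := fun _ l => ofList (l.map num))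
    (e := fun _ _ => .nil) (l := fun i => List.replicate (n i) ()) (init := fun _ => [])
    (f := fun _ _ s => 0 :: s.map (· + 1)) (hn.congr fun i => by simp [num]) (nil x) ?_
    hsz).congr fun i => ?_
  · refine ((nil _).pair (map (β := fun _ => ℕ) (e := fun _ => num) (h := fun _ k => num (k + 1))
      (l := fun k : Σ _ : ι, Unit × List ℕ => k.2.2) (last _ _) (add_const (last _ _) 1))).congr
      fun k => ?_
    simp only [List.map_cons, List.map_map]
    rfl
  · rw [fold, List.map_map]
    rfl

section Quantifiers

variable {P : ∀ i, Fin (n i) → Prop}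

/-- A quantifier is a fold whose state is a single truth value, hence of bounded size. -/
theorem exists_fin (hn : PolyTime x (fun i => num (n i)))
    (h : PolyTime (fun k : Σ i, Fin (n i) => .cons (x k.1) (num k.2))
      (fun k => bit (P k.1 k.2))) : PolyTime x (fun i => bit (∃ j, P i j)) := by
  have fold : ∀ (i : ι) (l : List (Fin (n i))),
      l.foldr (fun j s => P i j ∨ s) False = ∃ j ∈ l, P i j := by
    intro i l
    induction l with
    | nil => simp
    | cons a l ih => rw [List.foldr_cons, ih]; simp
  refine (foldr (β := fun i => Fin (n i)) (σ := fun _ => Prop) (s := fun _ => bit)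
    (e := fun _ j => num j) (l := fun i => List.finRange (n i)) (init := fun _ => False)
    (f := fun i j s => P i j ∨ s) (fins hn) ((nil x).congr fun _ => (bit_false not_false).symm) ?_
    ⟨3, fun i l' _ => ?_⟩).congr fun i => ?_
  · exact ((h.reindex fun k : Σ i, Fin (n i) × Prop => ⟨k.1, k.2.1⟩).weak).or (last _ _)
  · exact (size_bit_le _).trans (by simp)
  · rw [fold]
    simp

theorem forall_fin (hn : PolyTime x (fun i => num (n i)))
    (h : PolyTime (fun k : Σ i, Fin (n i) => .cons (x k.1) (num k.2))
      (fun k => bit (P k.1 k.2))) : PolyTime x (fun i => bit (∀ j, P i j)) :=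
  (exists_fin hn (P := fun i j => ¬ P i j) h.not).not.bit_congr fun i => by simp

/-- Define a set by a property of its members. -/
theorem comprehension {S : ∀ i, Finset (Fin (n i))} (hS : ∀ i j, j ∈ S i ↔ P i j)
    (hn : PolyTime x (fun i => num (n i)))
    (h : PolyTime (fun k : Σ i, Fin (n i) => .cons (x k.1) (num k.2))
      (fun k => bit (P k.1 k.2))) : PolyTime x (fun i => ofFinset (S i)) :=
  (map (β := fun i => Fin (n i)) (l := fun i => List.finRange (n i)) (h := fun i j => bit (P i j))
    (fins hn) h).congr fun i => by
    rw [ofFinset_eq]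
    simp only [hS]

end Quantifiers

section Sets

variable {A B : ∀ i, Finset (Fin (n i))} {u v : ∀ i, Fin (n i)}

theorem mem (hA : PolyTime x (fun i => ofFinset (A i))) (hu : PolyTime x (fun i => num (u i))) :
    PolyTime x (fun i => bit (u i ∈ A i)) :=
  get (f := fun i j => bit (j ∈ A i)) (hA.congr fun i => ofFinset_eq (A i)) hu

theorem card (hn : PolyTime x (fun i => num (n i))) (hA : PolyTime x (fun i => ofFinset (A i))) :
    PolyTime x (fun i => num (A i).card) := by
  have fold : ∀ {n : ℕ} (A : Finset (Fin n)) (l : List (Fin n)), l.Nodup →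
      l.foldr (fun j s => if j ∈ A then s + 1 else s) 0 = {j ∈ A | j ∈ l}.card := by
    intro n A l hl
    induction l with
    | nil => simp
    | cons a l ih =>
      rw [List.nodup_cons] at hl
      rw [List.foldr_cons, ih hl.2]
      split_ifs with ha
      · rw [← Finset.card_insert_of_notMem (a := a) (by simp [hl.1])]
        congr 1
        ext j
        simp only [Finset.mem_insert, Finset.mem_filter, List.mem_cons]
        constructor
        · rintro (rfl | h)
          · exact ⟨ha, Or.inl rfl⟩
          · exact ⟨h.1, Or.inr h.2⟩
        · rintro ⟨h, rfl | h'⟩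
          · exact Or.inl rfl
          · exact Or.inr ⟨h, h'⟩
      · congr 1
        ext j
        simp only [Finset.mem_filter, List.mem_cons]
        exact ⟨fun h => ⟨h.1, Or.inr h.2⟩, fun h => ⟨h.1, h.2.resolve_left fun e => ha (e ▸ h.1)⟩⟩
  refine (foldr (β := fun i => Fin (n i)) (σ := fun _ => ℕ) (s := fun _ => num)
    (e := fun _ j => num j) (l := fun i => List.finRange (n i)) (init := fun _ => 0)
    (f := fun i j s => if j ∈ A i then s + 1 else s) (fins hn) (nil x) ?_ ?_).congr fun i => ?_
  · refine (ite (p := fun k : Σ i, Fin (n i) × ℕ => k.2.1 ∈ A k.1) ?_ (add_const (last _ _) 1)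
      (last _ _)).congr fun k => ?_
    · exact (mem (A := fun k : Σ i, Fin (n i) × ℕ => A k.1) (u := fun k => k.2.1)
        (hA.weak (f := Sigma.fst)) (last _ _)).skip
    · split_ifs <;> rfl
  · obtain ⟨p, P, hp⟩ := hn
    refine ⟨P, fun i l' hl' => ?_⟩
    rw [fold _ _ (hl'.sublist.nodup (List.nodup_finRange _)), size_num]
    have := (Finset.card_le_univ {j ∈ A i | j ∈ l'})
    rw [Fintype.card_fin] at this
    have h1 := (hp i).1
    simp only [size_num] at h1
    omega
  · rw [fold _ _ (List.nodup_finRange _)]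
    simp

/-- A vertex set always has a presentation of size linear in `n`, so repetition cannot inflate the
state. -/
theorem iterate {m : ι → ℕ} {f : ∀ i, Finset (Fin (n i)) → Finset (Fin (n i))}
    (hn : PolyTime x (fun i => num (n i))) (hm : PolyTime x (fun i => num (m i)))
    (hA : PolyTime x (fun i => ofFinset (A i)))
    (hf : PolyTime (fun k : Σ i, Finset (Fin (n i)) => .cons (x k.1) (ofFinset k.2))
      (fun k => ofFinset (f k.1 k.2))) : PolyTime x (fun i => ofFinset ((f i)^[m i] (A i))) := by
  have fold : ∀ (i : ι) (m : ℕ) (A : Finset (Fin (n i))),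
      (List.replicate m ()).foldr (fun _ s => f i s) A = (f i)^[m] A := by
    intro i m A
    induction m with
    | zero => rfl
    | succ m ih => rw [Function.iterate_succ_apply', ← ih]; rfl
  refine (foldr (β := fun _ => Unit) (σ := fun i => Finset (Fin (n i))) (s := fun _ => ofFinset)
    (e := fun _ _ => .nil) (l := fun i => List.replicate (m i) ()) (init := A)
    (f := fun i _ s => f i s) (hm.congr fun i => by simp [num]) hA ?_ ?_).congr
    fun i => by rw [fold]
  · exact trans (y := fun k : Σ i, Unit × Finset (Fin (n i)) => .cons (x k.1) (ofFinset k.2.2))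
      ((((refl x).weak (f := Sigma.fst)).skip).pair (last _ _))
      (hf.reindex fun k : Σ i, Unit × Finset (Fin (n i)) => ⟨k.1, k.2.2⟩)
  · obtain ⟨p, P, hp⟩ := hn
    refine ⟨2 * P + 1, fun i l' _ => (size_ofFinset_le _).trans ?_⟩
    have h1 := (hp i).1
    simp only [size_num] at h1
    have h2 : (2 : ℕ[X]).eval (x i).size = 2 := by simp
    simp only [eval_add, eval_mul, eval_one, h2]
    omega

end Sets

end PolyTime

end TreeProg

/-! ### The subroutines of the enumeration algorithm -/

namespace Digraph

open scoped Classical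

variable {V : Type*} [LinearOrder V] (G : Digraph V)

/-- The set that consists of the least element of `W`, if any. -/
noncomputable def firstOf (W : Finset V) : Finset V := {w ∈ W | ∀ j ∈ W, ¬ j < w}

theorem mem_firstOf {W : Finset V} {w : V} : w ∈ firstOf W ↔ w ∈ W ∧ ∀ j ∈ W, ¬ j < w := by
  simp [firstOf]

theorem exists_firstOf_eq {W : Finset V} (hW : W.Nonempty) :
    ∃ v ∈ W, (∀ w ∈ W, v ≤ w) ∧ firstOf W = {v} := by
  refine ⟨W.min' hW, W.min'_mem hW, fun w hw => W.min'_le w hw, ?_⟩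
  ext w
  rw [mem_firstOf, Finset.mem_singleton]
  constructor
  · rintro ⟨hw, h⟩
    exact le_antisymm (not_lt.1 (h _ (W.min'_mem hW))) (W.min'_le w hw)
  · rintro rfl
    exact ⟨W.min'_mem hW, fun j hj => not_lt.2 (W.min'_le j hj)⟩

/-- What is left of `A` when the first member of `W` is selected. -/
noncomputable def selectFirst (A W : Finset V) : Finset V :=
  {i ∈ A | ∀ w ∈ firstOf W, ¬ G.Nbr i w}

variable {G} in
theorem mem_selectFirst {A W : Finset V} {i : V} :
    i ∈ G.selectFirst A W ↔ i ∈ A ∧ ∀ w ∈ firstOf W, ¬ G.Nbr i w := by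
  simp [selectFirst]

variable [Fintype V]

/-- The vertices that form a good branching. -/
noncomputable def singleBranches (A : Finset V) : Finset V :=
  {k ∈ G.attackCore A | G.GoodBranch A {k}}

/-- The vertices whose attackers form a good branching. -/
noncomputable def insBranches (A : Finset V) : Finset V :=
  {u ∈ G.attackCore A | G.GoodBranch A (G.ins A u)}

/-- The branching that the algorithm chooses. -/
noncomputable def chooseBranch (A : Finset V) : Finset V :=
  {w ∈ A | w ∈ firstOf (G.singleBranches A) ∨
    (¬ ∃ k, k ∈ G.singleBranches A) ∧ ∃ u ∈ firstOf (G.insBranches A), G.Adj w u}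

variable {G}

theorem mem_singleBranches {A : Finset V} {k : V} :
    k ∈ G.singleBranches A ↔ k ∈ G.attackCore A ∧ G.GoodBranch A {k} := by
  simp [singleBranches]

theorem mem_insBranches {A : Finset V} {u : V} :
    u ∈ G.insBranches A ↔ u ∈ G.attackCore A ∧ G.GoodBranch A (G.ins A u) := by
  simp [insBranches]

theorem mem_chooseBranch {A : Finset V} {w : V} :
    w ∈ G.chooseBranch A ↔ w ∈ A ∧ (w ∈ firstOf (G.singleBranches A) ∨
      (¬ ∃ k, k ∈ G.singleBranches A) ∧ ∃ u ∈ firstOf (G.insBranches A), G.Adj w u) := by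
  simp [chooseBranch]

/-- The last clause provides a vertex that is deleted whichever member of the branching set is
selected: a target of the single vertex, or the vertex whose attackers form the set. Termination of
the recursion rests on it. -/
theorem IsReduced.chooseBranch_spec {A : Finset V} (hA : G.IsReduced A)
    (hne : (G.attackCore A).Nonempty) :
    (G.chooseBranch A).Nonempty ∧ G.chooseBranch A ⊆ G.attackCore A ∧
      G.GoodBranch A (G.chooseBranch A) ∧
      ∃ u ∈ A, u ∉ G.chooseBranch A ∧ ∀ w ∈ G.chooseBranch A, G.Nbr u w := by
  by_cases hS : ∃ k, k ∈ G.singleBranches A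
  · obtain ⟨v, hv, -, hfirst⟩ := exists_firstOf_eq (W := G.singleBranches A) hS
    obtain ⟨hvB, hgood⟩ := mem_singleBranches.1 hv
    have hvA := attackCore_subset A hvB
    have hC : G.chooseBranch A = {v} := by
      ext w
      rw [mem_chooseBranch, hfirst, Finset.mem_singleton]
      constructor
      · rintro ⟨-, h | h⟩
        · exact h
        · exact absurd hS h.1
      · rintro rfl
        exact ⟨hvA, Or.inl rfl⟩
    obtain ⟨u, hu, hvu⟩ := exists_adj_of_mem_attackCore hvB
    rw [hC]
    refine ⟨by simp, by simpa using hvB, hgood, u, attackCore_subset A hu, fun h => ?_, ?_⟩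
    · rw [Finset.mem_singleton.1 h] at hvu
      exact hA.not_adj_self hvA hvu
    · intro w hw
      rw [Finset.mem_singleton.1 hw]
      exact Or.inr hvu
  · obtain ⟨u, hu⟩ : ∃ u, u ∈ G.insBranches A := by
      rcases hA.exists_goodBranch hne with ⟨v, hv, h⟩ | ⟨u, hu, h⟩
      · exact absurd ⟨v, mem_singleBranches.2 ⟨hv, h⟩⟩ hS
      · exact ⟨u, mem_insBranches.2 ⟨hu, h⟩⟩
    obtain ⟨v, hv, -, hfirst⟩ := exists_firstOf_eq (W := G.insBranches A) ⟨u, hu⟩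
    obtain ⟨hvB, hgood⟩ := mem_insBranches.1 hv
    have hvA := attackCore_subset A hvB
    have hC : G.chooseBranch A = G.ins A v := by
      ext w
      rw [mem_chooseBranch, hfirst, mem_ins]
      refine and_congr_right fun _ => ⟨?_, fun h => Or.inr ⟨hS, v, by simp, h⟩⟩
      rintro (h | ⟨-, u, hu, hwu⟩)
      · exact absurd ⟨w, (mem_firstOf.1 h).1⟩ hS
      · rwa [Finset.mem_singleton.1 hu] at hwu
    rw [hC]
    refine ⟨Finset.card_pos.1 ?_, ins_subset_attackCore hvB, hgood, v, hvA, fun h => ?_,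
      fun w hw => Or.inr (mem_ins.1 hw).2⟩
    · rcases hgood with h | h | h <;> have := h.1 <;> omega
    · exact hA.not_adj_self hvA (mem_ins.1 h).2

end Digraph

namespace TreeProg

open TreeData Digraph

namespace PolyTime

variable {ι : Type} {x : ι → TreeData} {n : ι → ℕ} {G : ∀ i, Digraph (Fin (n i))}
  {A W : ∀ i, Finset (Fin (n i))} {u v : ∀ i, Fin (n i)}

/-- Add a vertex to the context. -/
theorem up {y : ι → TreeData} {m : ι → ℕ} (h : PolyTime x y) :
    PolyTime (fun k : Σ i, Fin (m i) => .cons (x k.1) (num k.2)) (fun k => y k.1) := h.weak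

/-- Add a vertex set to the context. -/
theorem upSet {y : ι → TreeData} {m : ι → ℕ} (h : PolyTime x y) :
    PolyTime (fun k : Σ i, Finset (Fin (m i)) => .cons (x k.1) (ofFinset k.2)) (fun k => y k.1) :=
  h.weak

/-- The number of vertices is the number of rows of the matrix. -/
theorem order (hG : PolyTime x (fun i => ofDigraph (G i))) : PolyTime x (fun i => num (n i)) :=
  (map (β := fun i => Fin (n i)) (l := fun i => List.finRange (n i)) (h := fun _ _ => .nil)
    (hG.congr fun i => ofDigraph_eq (G i)) (nil _)).congr fun i => by
      rw [List.map_const', List.length_finRange]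
      rfl

theorem adj (hG : PolyTime x (fun i => ofDigraph (G i))) (hu : PolyTime x (fun i => num (u i)))
    (hv : PolyTime x (fun i => num (v i))) : PolyTime x (fun i => bit ((G i).Adj (u i) (v i))) :=
  get (f := fun i j => bit ((G i).Adj (u i) j))
    (get (f := fun i k => ofList ((List.finRange (n i)).map fun j => bit ((G i).Adj k j)))
      (hG.congr fun i => ofDigraph_eq (G i)) hu) hv

theorem nbr (hG : PolyTime x (fun i => ofDigraph (G i))) (hu : PolyTime x (fun i => num (u i)))
    (hv : PolyTime x (fun i => num (v i))) : PolyTime x (fun i => bit ((G i).Nbr (u i) (v i))) :=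
  (adj hG hu hv).or (adj hG hv hu)

theorem reduceStep (hG : PolyTime x (fun i => ofDigraph (G i)))
    (hA : PolyTime x (fun i => ofFinset (A i))) :
    PolyTime x (fun i => ofFinset ((G i).reduceStep (A i))) :=
  comprehension (fun _ _ => mem_reduceStep) hG.order <|
    .and (mem hA.up (last _ _)) <| forall_fin hG.up.order <|
      .imp (adj hG.up.up (last _ _) (last _ _).skip) <| exists_fin hG.up.up.order <|
        .and (mem hA.up.up.up (last _ _)) <|
          .and (adj hG.up.up.up (last _ _) (last _ _).skip)
            (.not (nbr hG.up.up.up (last _ _) (last _ _).skip.skip))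

theorem attackStep (hG : PolyTime x (fun i => ofDigraph (G i)))
    (hA : PolyTime x (fun i => ofFinset (A i))) :
    PolyTime x (fun i => ofFinset ((G i).attackStep (A i))) :=
  comprehension (fun _ _ => mem_attackStep) hG.order <|
    .and (mem hA.up (last _ _)) <| exists_fin hG.up.order <|
      .and (mem hA.up.up (last _ _)) (adj hG.up.up (last _ _).skip (last _ _))

theorem acceptable (hG : PolyTime x (fun i => ofDigraph (G i)))
    (hA : PolyTime x (fun i => ofFinset (A i))) (hu : PolyTime x (fun i => num (u i))) :
    PolyTime x (fun i => bit ((G i).IsAcceptable (A i) (u i))) :=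
  forall_fin hG.order <| .imp (adj hG.up (last _ _) hu.up) <| exists_fin hG.up.order <|
    .and (mem hA.up.up (last _ _)) (adj hG.up.up (last _ _) (last _ _).skip)

theorem defenceStep (hG : PolyTime x (fun i => ofDigraph (G i)))
    (hA : PolyTime x (fun i => ofFinset (A i))) :
    PolyTime x (fun i => ofFinset ((G i).defenceStep (A i))) :=
  comprehension (fun _ _ => mem_defenceStep) hG.order <|
    .and (mem hA.up (last _ _)) <| acceptable hG.up hA.up (last _ _)

theorem mutualSet (hG : PolyTime x (fun i => ofDigraph (G i)))
    (hA : PolyTime x (fun i => ofFinset (A i))) :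
    PolyTime x (fun i => ofFinset ((G i).mutualSet (A i))) :=
  comprehension (P := fun i j => j ∈ A i ∧ ∃ u, u ∈ A i ∧ (u < j ∨ j < u) ∧
      (G i).Adj u j ∧ (G i).Adj j u)
    (fun _ _ => by simp only [mem_mutualSet, lt_or_lt_iff_ne]) hG.order <|
    .and (mem hA.up (last _ _)) <| exists_fin hG.up.order <|
      .and (mem hA.up.up (last _ _)) <|
        .and (.or (lt (last _ _) (last _ _).skip) (lt (last _ _).skip (last _ _))) <|
          .and (adj hG.up.up (last _ _) (last _ _).skip)
            (adj hG.up.up (last _ _).skip (last _ _))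

theorem reduct (hG : PolyTime x (fun i => ofDigraph (G i)))
    (hA : PolyTime x (fun i => ofFinset (A i))) :
    PolyTime x (fun i => ofFinset ((G i).reduct (A i))) :=
  (iterate (f := fun i => (G i).reduceStep) hG.order hG.order hA
    (reduceStep hG.upSet (last _ _))).congr fun i => by rw [Digraph.reduct, Fintype.card_fin]

theorem attackCore (hG : PolyTime x (fun i => ofDigraph (G i)))
    (hA : PolyTime x (fun i => ofFinset (A i))) :
    PolyTime x (fun i => ofFinset ((G i).attackCore (A i))) :=
  (iterate (f := fun i => (G i).attackStep) hG.order hG.order hA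
    (attackStep hG.upSet (last _ _))).congr fun i => by rw [Digraph.attackCore, Fintype.card_fin]

theorem defenceCore (hG : PolyTime x (fun i => ofDigraph (G i)))
    (hA : PolyTime x (fun i => ofFinset (A i))) :
    PolyTime x (fun i => ofFinset ((G i).defenceCore (A i))) :=
  (iterate (f := fun i => (G i).defenceStep) hG.order hG.order hA
    (defenceStep hG.upSet (last _ _))).congr fun i => by rw [Digraph.defenceCore, Fintype.card_fin]

theorem weight (hG : PolyTime x (fun i => ofDigraph (G i)))
    (hA : PolyTime x (fun i => ofFinset (A i))) :
    PolyTime x (fun i => num ((G i).weight (A i))) :=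
  add (card hG.order (attackCore hG hA)) (card hG.order (mutualSet hG hA))

theorem childIn (hG : PolyTime x (fun i => ofDigraph (G i)))
    (hA : PolyTime x (fun i => ofFinset (A i))) (hW : PolyTime x (fun i => ofFinset (W i)))
    (hu : PolyTime x (fun i => num (u i))) :
    PolyTime x (fun i => ofFinset ((G i).childIn (A i) (W i) (u i))) :=
  comprehension (fun _ _ => mem_childIn) hG.order <|
    .and (mem hA.up (last _ _)) <|
      .and (.not (.and (mem hW.up (last _ _)) (lt (last _ _) hu.up)))
        (.not (nbr hG.up (last _ _) hu.up))

theorem childOut (hn : PolyTime x (fun i => num (n i)))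
    (hA : PolyTime x (fun i => ofFinset (A i))) (hW : PolyTime x (fun i => ofFinset (W i))) :
    PolyTime x (fun i => ofFinset (Digraph.childOut (A i) (W i))) :=
  comprehension (fun _ _ => mem_childOut) hn <|
    .and (mem hA.up (last _ _)) (.not (mem hW.up (last _ _)))

theorem goodBranch (hG : PolyTime x (fun i => ofDigraph (G i)))
    (hA : PolyTime x (fun i => ofFinset (A i))) (hW : PolyTime x (fun i => ofFinset (W i))) :
    PolyTime x (fun i => bit ((G i).GoodBranch (A i) (W i))) := by
  have hm := weight hG hA
  have hout : PolyTime x (fun i => num ((G i).weightOut (A i) (W i))) :=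
    weight hG (reduct hG (childOut hG.order hA hW))
  have hin : PolyTime (fun k : Σ i, Fin (n i) => .cons (x k.1) (num k.2))
      (fun k => num ((G k.1).weightIn (A k.1) (W k.1) k.2)) :=
    weight hG.up (reduct hG.up (childIn hG.up hA.up hW.up (last _ _)))
  have hW' : PolyTime (fun k : Σ i, Fin (n i) => .cons (x k.1) (num k.2))
      (fun k => bit (k.2 ∈ W k.1)) := mem hW.up (last _ _)
  have ho : ∀ c, PolyTime x (fun i => bit ((G i).weightOut (A i) (W i) + c ≤ (G i).weight (A i))) :=
    fun c => le (add_const hout c) hm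
  have hi : ∀ c, PolyTime (fun k : Σ i, Fin (n i) => .cons (x k.1) (num k.2))
      (fun k => bit ((G k.1).weightIn (A k.1) (W k.1) k.2 + c ≤ (G k.1).weight (A k.1))) :=
    fun c => le (add_const hin c) hm.up
  have hcard : ∀ c, PolyTime x (fun i => bit ((W i).card = c)) := fun c =>
    ((le (card hG.order hW) (const x (num c))).and
      (le (const x (num c)) (card hG.order hW))).bit_congr fun i => le_antisymm_iff.symm
  refine ((hcard 1).and (forall_fin hG.order (hW'.imp ?_))).or
    (((hcard 2).and ((forall_fin hG.order (hW'.imp (hi 5))).and ((ho 5).and ((ho 6).or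
      (exists_fin hG.order (hW'.and (hi 6))))))).or
    ((hcard 3).and ((forall_fin hG.order (hW'.imp (hi 7))).and (ho 7))))
  exact ((hi 8).and (ho 1).up).or (((hi 6).and (ho 2).up).or
    (((hi 4).and (ho 3).up).or ((hi 3).and (ho 4).up)))

theorem firstOf (hn : PolyTime x (fun i => num (n i)))
    (hW : PolyTime x (fun i => ofFinset (W i))) :
    PolyTime x (fun i => ofFinset (Digraph.firstOf (W i))) :=
  comprehension (fun _ _ => mem_firstOf) hn <|
    .and (mem hW.up (last _ _)) <| forall_fin hn.up <|
      .imp (mem hW.up.up (last _ _)) (.not (lt (last _ _) (last _ _).skip))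

theorem selectFirst (hG : PolyTime x (fun i => ofDigraph (G i)))
    (hA : PolyTime x (fun i => ofFinset (A i))) (hW : PolyTime x (fun i => ofFinset (W i))) :
    PolyTime x (fun i => ofFinset ((G i).selectFirst (A i) (W i))) :=
  comprehension (fun _ _ => mem_selectFirst) hG.order <|
    .and (mem hA.up (last _ _)) <| forall_fin hG.up.order <|
      .imp (mem (firstOf hG.order hW).up.up (last _ _))
        (.not (nbr hG.up.up (last _ _).skip (last _ _)))

theorem ofFinset_singleton (hn : PolyTime x (fun i => num (n i)))
    (hu : PolyTime x (fun i => num (u i))) : PolyTime x (fun i => ofFinset {u i}) :=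
  comprehension (P := fun i j => ¬ j < u i ∧ ¬ u i < j) (fun _ _ => by
    rw [Finset.mem_singleton, not_lt, not_lt, le_antisymm_iff, and_comm]) hn <|
    .and (.not (lt (last _ _) hu.up)) (.not (lt hu.up (last _ _)))

theorem ofFinset_empty (hn : PolyTime x (fun i => num (n i))) :
    PolyTime x (fun i => ofFinset (∅ : Finset (Fin (n i)))) :=
  comprehension (P := fun _ _ => False) (fun _ _ => by simp) hn
    ((nil _).congr fun _ => (bit_false not_false).symm)

theorem ofFinset_univ (hn : PolyTime x (fun i => num (n i))) :
    PolyTime x (fun i => ofFinset (Finset.univ : Finset (Fin (n i)))) :=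
  comprehension (P := fun _ _ => ¬ False) (fun _ _ => by simp) hn
    ((nil _).congr fun _ => (bit_false not_false).symm).not

theorem nonempty (hn : PolyTime x (fun i => num (n i)))
    (hW : PolyTime x (fun i => ofFinset (W i))) : PolyTime x (fun i => bit (∃ k, k ∈ W i)) :=
  exists_fin hn (mem hW.up (last _ _))

theorem inter (hn : PolyTime x (fun i => num (n i))) (hA : PolyTime x (fun i => ofFinset (A i)))
    (hW : PolyTime x (fun i => ofFinset (W i))) :
    PolyTime x (fun i => bit (∃ k, k ∈ A i ∧ k ∈ W i)) :=
  exists_fin hn <| .and (mem hA.up (last _ _)) (mem hW.up (last _ _))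

theorem chooseBranch (hG : PolyTime x (fun i => ofDigraph (G i)))
    (hA : PolyTime x (fun i => ofFinset (A i))) :
    PolyTime x (fun i => ofFinset ((G i).chooseBranch (A i))) := by
  have hS : PolyTime x (fun i => ofFinset ((G i).singleBranches (A i))) :=
    comprehension (fun _ _ => mem_singleBranches) hG.order <|
      .and (mem (attackCore hG hA).up (last _ _)) <|
        goodBranch hG.up hA.up (ofFinset_singleton hG.up.order (last _ _))
  have hI : PolyTime x (fun i => ofFinset ((G i).insBranches (A i))) :=
    comprehension (fun _ _ => mem_insBranches) hG.order <|
      .and (mem (attackCore hG hA).up (last _ _)) <|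
        goodBranch hG.up hA.up <| comprehension (fun _ _ => mem_ins) hG.up.order <|
          .and (mem hA.up.up (last _ _)) (adj hG.up.up (last _ _) (last _ _).skip)
  exact comprehension (fun _ _ => mem_chooseBranch) hG.order <|
    .and (mem hA.up (last _ _)) <| .or (mem (firstOf hG.order hS).up (last _ _)) <|
      .and (nonempty hG.order hS).not.up <| exists_fin hG.up.order <|
        .and (mem (firstOf hG.order hI).up.up (last _ _))
          (adj hG.up.up (last _ _).skip (last _ _))

end PolyTime

end TreeProg

/-! ### Tries and the merging of two lists of vertex sets -/

namespace TreeData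

/-- Insert a word into a binary trie. -/
def trieInsert : List Bool → TreeData → TreeData
  | [], _ => cons nil nil
  | true :: l, t => cons t.head (trieInsert l t.tail)
  | false :: l, t => cons (trieInsert l t.head) t.tail

/-- Look up a word in a binary trie; the result is `nil` if the word is absent. -/
def trieFind : List Bool → TreeData → TreeData
  | [], t => t
  | true :: l, t => trieFind l t.tail
  | false :: l, t => trieFind l t.head

theorem trieFind_nil (l : List Bool) : trieFind l nil = nil := by
  induction l with
  | nil => rfl
  | cons b l ih => cases b <;> exact ih

/-- Words of equal length end at the same depth, so an insertion never overwrites another word's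
path. -/
theorem trieFind_trieInsert {l l' : List Bool} (h : l.length = l'.length) (t : TreeData) :
    trieFind l (trieInsert l' t) ≠ nil ↔ l' = l ∨ trieFind l t ≠ nil := by
  induction l generalizing l' t with
  | nil =>
    obtain rfl := List.length_eq_zero_iff.1 h.symm
    simp [trieFind, trieInsert]
  | cons b l ih =>
    cases l' with
    | nil => simp at h
    | cons b' l' =>
      have h' : l.length = l'.length := by simpa using h
      cases b <;> cases b'
      · simpa [trieFind, trieInsert, head] using ih h' t.head
      · simp [trieFind, trieInsert, head]
      · simp [trieFind, trieInsert, tail]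
      · simpa [trieFind, trieInsert, tail] using ih h' t.tail

/-- The characteristic word of a set. -/
def bitList {n : ℕ} (S : Finset (Fin n)) : List Bool := (List.finRange n).map fun i => decide (i ∈ S)

theorem ofFinset_eq_bitList {n : ℕ} (S : Finset (Fin n)) :
    ofFinset S = ofList ((bitList S).map ofBool) := by
  rw [bitList, List.map_map]
  rfl

theorem length_bitList {n : ℕ} (S : Finset (Fin n)) : (bitList S).length = n := by simp [bitList]

theorem bitList_injective {n : ℕ} : Function.Injective (bitList (n := n)) := by
  intro S T h
  ext i
  have := List.map_inj_left.1 h i (List.mem_finRange i)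
  simpa using this

end TreeData

namespace TreeProg

open TreeData Digraph Polynomial

/-- Insert a word into a trie. -/
def insertBody : TreeProg :=
  .branch .head
    (.branch (.seq .head .head)
      (.pair (.seq .tail .head) (.seq (.pair (.seq .head .tail) (.seq .tail .tail)) .call))
      (.pair (.seq (.pair (.seq .head .tail) (.seq .tail .head)) .call) (.seq .tail .tail)))
    (.pair .nil .nil)

/-- Look up a word in a trie. -/
def findBody : TreeProg :=
  .branch .head
    (.branch (.seq .head .head)
      (.seq (.pair (.seq .head .tail) (.seq .tail .tail)) .call)
      (.seq (.pair (.seq .head .tail) (.seq .tail .head)) .call))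
    .tail

theorem eval_insertBody (l : List Bool) (x : TreeData) :
    ∃ t ≤ 30 * (l.length + 1), Eval insertBody insertBody (.cons (ofList (l.map ofBool)) x)
      (trieInsert l x) t := by
  induction l generalizing x with
  | nil => exact ⟨_, by norm_num, .branch_nil (.head _ _) (.pair (.nil _ _) (.nil _ _))⟩
  | cons b l ih =>
    cases b with
    | true =>
      obtain ⟨t, ht, h⟩ := ih x.tail
      exact ⟨_, by rw [List.length_cons]; omega, .branch_cons (.head _ _)
        (.branch_cons (.seq (.head _ _) (.head _ _)) (.pair (.seq (.tail _ _) (.head _ _))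
          (.seq (.pair (.seq (.head _ _) (.tail _ _)) (.seq (.tail _ _) (.tail _ _))) (.call h))))⟩
    | false =>
      obtain ⟨t, ht, h⟩ := ih x.head
      exact ⟨_, by rw [List.length_cons]; omega, .branch_cons (.head _ _)
        (.branch_nil (.seq (.head _ _) (.head _ _)) (.pair
          (.seq (.pair (.seq (.head _ _) (.tail _ _)) (.seq (.tail _ _) (.head _ _))) (.call h))
          (.seq (.tail _ _) (.tail _ _))))⟩

theorem eval_findBody (l : List Bool) (x : TreeData) :
    ∃ t ≤ 30 * (l.length + 1), Eval findBody findBody (.cons (ofList (l.map ofBool)) x)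
      (trieFind l x) t := by
  induction l generalizing x with
  | nil => exact ⟨_, by norm_num, .branch_nil (.head _ _) (.tail _ _)⟩
  | cons b l ih =>
    cases b with
    | true =>
      obtain ⟨t, ht, h⟩ := ih x.tail
      exact ⟨_, by rw [List.length_cons]; omega, .branch_cons (.head _ _)
        (.branch_cons (.seq (.head _ _) (.head _ _))
          (.seq (.pair (.seq (.head _ _) (.tail _ _)) (.seq (.tail _ _) (.tail _ _))) (.call h)))⟩
    | false =>
      obtain ⟨t, ht, h⟩ := ih x.head
      exact ⟨_, by rw [List.length_cons]; omega, .branch_cons (.head _ _)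
        (.branch_nil (.seq (.head _ _) (.head _ _))
          (.seq (.pair (.seq (.head _ _) (.tail _ _)) (.seq (.tail _ _) (.head _ _))) (.call h)))⟩

theorem eval_insert {n : ℕ} (S : Finset (Fin n)) (x : TreeData) (g : TreeProg) :
    ∃ t ≤ 30 * (n + 1) + 1, Eval g (.procedure insertBody) (.cons (ofFinset S) x)
      (trieInsert (bitList S) x) t := by
  obtain ⟨t, ht, h⟩ := eval_insertBody (bitList S) x
  rw [length_bitList] at ht
  rw [ofFinset_eq_bitList]
  exact ⟨_, Nat.succ_le_succ ht, .procedure h⟩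

theorem eval_find {n : ℕ} (S : Finset (Fin n)) (x : TreeData) (g : TreeProg) :
    ∃ t ≤ 30 * (n + 1) + 1, Eval g (.procedure findBody) (.cons (ofFinset S) x)
      (trieFind (bitList S) x) t := by
  obtain ⟨t, ht, h⟩ := eval_findBody (bitList S) x
  rw [length_bitList] at ht
  rw [ofFinset_eq_bitList]
  exact ⟨_, Nat.succ_le_succ ht, .procedure h⟩

open scoped Classical

/-- The members of `L₁` with property `p`, and those members of `L₂` that are not of the form `c S`
for such a member `S`. -/
noncomputable def mergeLists {α : Type} (p : α → Prop) (c : α → α) (L₁ L₂ : List α) : List α :=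
  L₁.filter (fun S => p S) ++ L₂.filter fun T => ¬ ∃ S ∈ L₁, p S ∧ c S = T

/-- The trie of the sets `c S`, where `S` runs over the members of a list with property `p`. -/
noncomputable def trieOf {n : ℕ} (p : Finset (Fin n) → Prop) (c : Finset (Fin n) → Finset (Fin n)) :
    List (Finset (Fin n)) → TreeData
  | [] => .nil
  | S :: L => if p S then trieInsert (bitList (c S)) (trieOf p c L) else trieOf p c L

theorem trieFind_trieOf {n : ℕ} {p : Finset (Fin n) → Prop} {c : Finset (Fin n) → Finset (Fin n)}
    (L : List (Finset (Fin n))) (T : Finset (Fin n)) :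
    trieFind (bitList T) (trieOf p c L) ≠ .nil ↔ ∃ S ∈ L, p S ∧ c S = T := by
  induction L with
  | nil => simp [trieOf, trieFind_nil]
  | cons S L ih =>
    rw [trieOf]
    split_ifs with h
    · rw [trieFind_trieInsert (by rw [length_bitList, length_bitList]), ih,
        bitList_injective.eq_iff]
      simp [h]
    · rw [ih]
      simp [h]

/-- The program for `TreeProg.mergeLists`. -/
def mergeProg (test core : TreeProg) : TreeProg :=
  .seq (.pair (.pair .head
      (.seq (.pair
          (.seq (.pair .head (.seq .tail .head)) (.procedure (foldrBody
            (.branch (.seq .head test)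
              (.seq (.pair (.seq .head core) .tail) (.procedure insertBody)) .tail) .nil)))
          (.seq .tail .tail))
        (.procedure (foldrBody
          (.branch (.seq (.pair (.seq .head .tail) (.seq .head .head)) (.procedure findBody)) .tail
            (.pair (.seq .head .tail) .tail)) .nil))))
      (.seq .tail .head))
    (.procedure (foldrBody
      (.branch (.seq (.pair (.seq .head (.seq .head .head)) (.seq .head .tail)) test)
        (.pair (.seq .head .tail) .tail) .tail) .tail))

/-- Three folds: collect the sets `c S` in a trie, filter `L₂` through it, and prepend the wanted
part of `L₁`. A lookup costs O(n) whatever the number of entries, so the time is linear in the two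
lengths; comparing all pairs would square the exponential factor. -/
theorem eval_mergeProg {n : ℕ} {p : Finset (Fin n) → Prop} {c : Finset (Fin n) → Finset (Fin n)}
    {env : TreeData} {test core : TreeProg} {T : ℕ}
    (htest : ∀ S g, ∃ t ≤ T, Eval g test (.cons env (ofFinset S)) (bit (p S)) t)
    (hcore : ∀ S g, ∃ t ≤ T, Eval g core (.cons env (ofFinset S)) (ofFinset (c S)) t)
    (L₁ L₂ : List (Finset (Fin n))) (g : TreeProg) :
    ∃ t ≤ (L₁.length + L₂.length + 1) * (6 * T + 90 * n + 300),
      Eval g (mergeProg test core)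
        (.cons env (.cons (ofList (L₁.map ofFinset)) (ofList (L₂.map ofFinset))))
        (ofList ((mergeLists p c L₁ L₂).map ofFinset)) t := by
  obtain ⟨tA, htA, hA⟩ := eval_foldr (e := ofFinset) (env := env) (F := trieOf p c) (l := L₁)
    (step := .branch (.seq .head test)
      (.seq (.pair (.seq .head core) .tail) (.procedure insertBody)) .tail) (base := .nil)
    (T := 2 * T + 30 * n + 50) (fun g => ⟨1, by omega, .nil _ _⟩)
    (fun S L _ g => by
      obtain ⟨t, ht, h⟩ := htest S g
      by_cases hp : p S
      · obtain ⟨t', ht', h'⟩ := hcore S g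
        obtain ⟨t'', ht'', h''⟩ := eval_insert (c S) (trieOf p c L) g
        rw [bit_true hp] at h
        rw [trieOf, if_pos hp]
        exact ⟨_, by omega, .branch_cons (.seq (.head _ _) h)
          (.seq (.pair (.seq (.head _ _) h') (.tail _ _)) h'')⟩
      · rw [bit_false hp] at h
        rw [trieOf, if_neg hp]
        exact ⟨_, by omega, .branch_nil (.seq (.head _ _) h) (.tail _ _)⟩) g
  set trie := trieOf p c L₁ with htrie
  obtain ⟨tB, htB, hB⟩ := eval_foldr (e := ofFinset) (env := trie)
    (F := fun L => ofList ((L.filter fun T => ¬ ∃ S ∈ L₁, p S ∧ c S = T).map ofFinset)) (l := L₂)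
    (step := .branch (.seq (.pair (.seq .head .tail) (.seq .head .head)) (.procedure findBody)) .tail
      (.pair (.seq .head .tail) .tail)) (base := .nil)
    (T := 30 * n + 50) (fun g => ⟨1, by omega, .nil _ _⟩)
    (fun S L _ g => by
      obtain ⟨t, ht, h⟩ := eval_find S trie g
      have hiff := trieFind_trieOf (p := p) (c := c) L₁ S
      rw [← htrie] at hiff
      by_cases hS : ∃ S' ∈ L₁, p S' ∧ c S' = S
      · have hne := hiff.2 hS
        cases hf : trieFind (bitList S) trie with
        | nil => exact absurd hf hne
        | cons a b =>
          rw [hf] at h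
          rw [List.filter_cons_of_neg (by simpa using hS)]
          exact ⟨_, by omega, .branch_cons (.seq (.pair (.seq (.head _ _) (.tail _ _))
            (.seq (.head _ _) (.head _ _))) h) (.tail _ _)⟩
      · have hne : trieFind (bitList S) trie = .nil := by
          by_contra hne
          exact hS (hiff.1 hne)
        rw [hne] at h
        rw [List.filter_cons_of_pos (by simpa using hS)]
        exact ⟨_, by omega, .branch_nil (.seq (.pair (.seq (.head _ _) (.tail _ _))
          (.seq (.head _ _) (.head _ _))) h) (.pair (.seq (.head _ _) (.tail _ _)) (.tail _ _))⟩) g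
  set L₂' := L₂.filter fun T => ¬ ∃ S ∈ L₁, p S ∧ c S = T with hL₂'
  obtain ⟨tC, htC, hC⟩ := eval_foldr (e := ofFinset)
    (env := .cons env (ofList (L₂'.map ofFinset)))
    (F := fun L => ofList ((L.filter (fun S => p S) ++ L₂').map ofFinset)) (l := L₁)
    (step := .branch (.seq (.pair (.seq .head (.seq .head .head)) (.seq .head .tail)) test)
        (.pair (.seq .head .tail) .tail) .tail) (base := .tail)
    (T := T + 50) (fun g => ⟨1, by omega, .tail _ _⟩)
    (fun S L _ g => by
      obtain ⟨t, ht, h⟩ := htest S g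
      by_cases hp : p S
      · rw [bit_true hp] at h
        rw [List.filter_cons_of_pos (by simpa using hp)]
        exact ⟨_, by omega, .branch_cons (.seq (.pair (.seq (.head _ _) (.seq (.head _ _)
          (.head _ _))) (.seq (.head _ _) (.tail _ _))) h)
          (.pair (.seq (.head _ _) (.tail _ _)) (.tail _ _))⟩
      · rw [bit_false hp] at h
        rw [List.filter_cons_of_neg (by simpa using hp)]
        exact ⟨_, by omega, .branch_nil (.seq (.pair (.seq (.head _ _) (.seq (.head _ _)
          (.head _ _))) (.seq (.head _ _) (.tail _ _))) h) (.tail _ _)⟩) g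
  have hmerge : mergeLists p c L₁ L₂ = L₁.filter (fun S => p S) ++ L₂' := by
    rw [mergeLists, hL₂']
    congr!
  rw [hmerge]
  refine ⟨_, ?_, .seq (.pair (.pair (.head _ _) (.seq (.pair
    (.seq (.pair (.head _ _) (.seq (.tail _ _) (.head _ _))) hA)
    (.seq (.tail _ _) (.tail _ _))) hB)) (.seq (.tail _ _) (.head _ _))) hC⟩
  have h1 : (L₁.length + 1) * (2 * T + 30 * n + 50 + 16) ≤
      (L₁.length + L₂.length + 1) * (2 * T + 30 * n + 66) := Nat.mul_le_mul (by omega) (by omega)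
  have h2 : (L₂.length + 1) * (30 * n + 50 + 16) ≤
      (L₁.length + L₂.length + 1) * (30 * n + 66) := Nat.mul_le_mul (by omega) (by omega)
  have h3 : (L₁.length + 1) * (T + 50 + 16) ≤
      (L₁.length + L₂.length + 1) * (T + 66) := Nat.mul_le_mul (by omega) (by omega)
  have h4 : (L₁.length + L₂.length + 1) * (2 * T + 30 * n + 66) +
      (L₁.length + L₂.length + 1) * (30 * n + 66) + (L₁.length + L₂.length + 1) * (T + 66) +
      (L₁.length + L₂.length + 1) * 50 ≤
      (L₁.length + L₂.length + 1) * (6 * T + 90 * n + 300) := by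
    rw [← mul_add, ← mul_add, ← mul_add]
    exact Nat.mul_le_mul_left _ (by omega)
  omega

end TreeProg

/-! ### Correctness of the recursion on active sets -/

namespace Digraph

set_option linter.unusedSectionVars false

section Maximal

variable {V : Type*} [Fintype V] (G : Digraph V)

/-- `S` is a maximal admissible subset of `A`. -/
def IsPreferredIn (A S : Finset V) : Prop := Maximal (fun S => G.IsAdmissible S ∧ S ⊆ A) S

variable {G} {A S : Finset V}

theorem isPreferredIn_univ : G.IsPreferredIn Finset.univ S ↔ G.IsPreferred S := by
  simp [IsPreferredIn, IsPreferred]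

theorem isPreferredIn_reduct : G.IsPreferredIn (G.reduct A) S ↔ G.IsPreferredIn A S := by
  have : (fun S => G.IsAdmissible S ∧ S ⊆ G.reduct A) = fun S => G.IsAdmissible S ∧ S ⊆ A :=
    funext fun S => propext ⟨fun h => ⟨h.1, h.2.trans (reduct_subset A)⟩,
      fun h => ⟨h.1, h.1.subset_reduct h.2⟩⟩
  rw [IsPreferredIn, this, IsPreferredIn]

theorem IsConflictFree.isPreferredIn_iff (hA : G.IsConflictFree A) :
    G.IsPreferredIn A S ↔ S = G.defenceCore A := by
  have h : G.IsAdmissible (G.defenceCore A) ∧ G.defenceCore A ⊆ A :=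
    ⟨hA.isAdmissible_defenceCore, defenceCore_subset A⟩
  constructor
  · exact fun hS => hS.eq_of_le h (hS.prop.1.subset_defenceCore hS.prop.2)
  · rintro rfl
    exact ⟨h, fun T hT _ => hT.1.subset_defenceCore hT.2⟩

theorem IsAdmissible.exists_isPreferredIn (hS : G.IsAdmissible S) (h : S ⊆ A) :
    ∃ T, G.IsPreferredIn A T ∧ S ⊆ T := by
  obtain ⟨T, hST, hT⟩ := (Set.toFinite {S | G.IsAdmissible S ∧ S ⊆ A}).exists_le_maximal
    (show S ∈ {S | G.IsAdmissible S ∧ S ⊆ A} from ⟨hS, h⟩)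
  exact ⟨T, hT, hST⟩

end Maximal

section Split

open scoped Classical

variable {V : Type*} [Fintype V] [LinearOrder V] {G : Digraph V} {A W S : Finset V} {v : V}

theorem childOut_empty : childOut A ∅ = A := by ext; simp [mem_childOut]

theorem isPreferredIn_selectFirst (hW : firstOf W = {v}) (hv : v ∈ S) :
    G.IsPreferredIn (G.selectFirst A W) S ↔ G.IsPreferredIn A S := by
  have hsub : ∀ {T}, G.IsAdmissible T → T ⊆ A → v ∈ T → T ⊆ G.selectFirst A W := by
    intro T hT hTA hvT i hi
    refine mem_selectFirst.2 ⟨hTA hi, fun w hw hn => ?_⟩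
    rw [hW, Finset.mem_singleton] at hw
    subst hw
    exact hn.elim (hT.1 i hi w hvT) (hT.1 w hvT i hi)
  have hsel : G.selectFirst A W ⊆ A := fun i hi => (mem_selectFirst.1 hi).1
  constructor
  · exact fun h => ⟨⟨h.prop.1, h.prop.2.trans hsel⟩,
      fun T hT hST => h.2 ⟨hT.1, hsub hT.1 hT.2 (hST hv)⟩ hST⟩
  · exact fun h => ⟨⟨h.prop.1, hsub h.prop.1 h.prop.2 hv⟩,
      fun T hT hST => h.2 ⟨hT.1, hT.2.trans hsel⟩ hST⟩

/-- The maximal admissible subsets of `A` are those that contain the first member `v` of `W` and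
those maximal admissible subsets of `A \ {v}` that are not cores of such a set minus `v`. -/
theorem isPreferredIn_iff_split (hW : firstOf W = {v}) :
    G.IsPreferredIn A S ↔ (G.IsPreferredIn (G.selectFirst A W) S ∧ v ∈ S) ∨
      (G.IsPreferredIn (childOut A (firstOf W)) S ∧
        ¬ ∃ T, G.IsPreferredIn (G.selectFirst A W) T ∧ v ∈ T ∧
          G.defenceCore (childOut T (firstOf W)) = S) := by
  have hout : ∀ {T B : Finset V}, T ⊆ childOut B (firstOf W) ↔ T ⊆ B ∧ v ∉ T := by
    intro T B
    rw [hW]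
    refine ⟨fun h => ⟨h.trans (childOut_subset _ _), fun hv => ?_⟩, fun h i hi => ?_⟩
    · exact (mem_childOut.1 (h hv)).2 (by simp)
    · refine mem_childOut.2 ⟨h.1 hi, fun hiv => h.2 ?_⟩
      rwa [← Finset.mem_singleton.1 hiv]
  by_cases hv : v ∈ S
  · rw [isPreferredIn_selectFirst hW hv]
    refine ⟨fun h => Or.inl ⟨h, hv⟩, ?_⟩
    rintro (h | ⟨h, -⟩)
    · exact h.1
    · exact absurd hv (hout.1 h.prop.2).2
  · constructor
    · refine fun h => Or.inr ⟨⟨⟨h.prop.1, hout.2 ⟨h.prop.2, hv⟩⟩, fun T hT hST =>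
        h.2 ⟨hT.1, hT.2.trans (childOut_subset _ _)⟩ hST⟩, ?_⟩
      -- Such a core is contained in `T` and misses `v ∈ T`, so it is not maximal.
      rintro ⟨T, hT, hvT, rfl⟩
      rw [isPreferredIn_selectFirst hW hvT] at hT
      have hST := (defenceCore_subset (G := G) (childOut T (firstOf W))).trans (childOut_subset _ _)
      exact hv (h.2 hT.prop hST hvT)
    · rintro (h | ⟨h, hno⟩)
      · exact absurd h.2 hv
      · refine ⟨⟨h.prop.1, h.prop.2.trans (childOut_subset _ _)⟩, fun T hT hST => ?_⟩
        by_cases hvT : v ∈ T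
        · exfalso
          -- A maximal `U` above `T` contains `v`. The core of `U` without `v` is admissible and
          -- contains `S`, hence equals `S` by maximality among the sets that avoid `v`.
          obtain ⟨U, hU, hTU⟩ := hT.1.exists_isPreferredIn hT.2
          refine hno ⟨U, (isPreferredIn_selectFirst hW (hTU hvT)).2 hU, hTU hvT, ?_⟩
          refine (h.eq_of_le ⟨?_, ?_⟩ ?_).symm
          · exact (hU.prop.1.1.mono (childOut_subset _ _)).isAdmissible_defenceCore
          · exact (defenceCore_subset _).trans (hout.2
              ⟨(childOut_subset _ _).trans hU.prop.2, (hout.1 subset_rfl).2⟩)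
          · exact h.prop.1.subset_defenceCore (hout.2 ⟨hST.trans hTU, hv⟩)
        · exact h.2 ⟨hT.1, hout.2 ⟨hT.2, hvT⟩⟩ hST

theorem branchBound_empty {φ : ℝ} : G.branchBound φ A ∅ = φ ^ G.weight (G.reduct A) := by
  simp [branchBound, weightOut, childOut_empty]

theorem one_le_branchBound {φ : ℝ} (hφ : 1 ≤ φ) (A W : Finset V) : 1 ≤ G.branchBound φ A W :=
  le_add_of_nonneg_of_le (Finset.sum_nonneg fun _ _ => by positivity) (one_le_pow₀ hφ)

/-- A branching on several vertices is carried out one vertex at a time. The set is not reduced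
between successive rejections, which makes the two bounds add up exactly. -/
theorem branchBound_split {φ : ℝ} (hvW : v ∈ W) (hmin : ∀ w ∈ W, v ≤ w) (hW : firstOf W = {v}) :
    G.branchBound φ A W = G.branchBound φ (G.selectFirst A W) ∅ +
      G.branchBound φ (childOut A (firstOf W)) (childOut W (firstOf W)) := by
  have hin : G.childIn A W v = G.selectFirst A W := by
    ext i
    rw [mem_childIn, mem_selectFirst, hW]
    simp only [Finset.mem_singleton, forall_eq]
    exact and_congr_right fun _ => ⟨fun h => h.2, fun h => ⟨fun hi => (hmin i hi.1).not_gt hi.2, h⟩⟩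
  have herase : childOut W (firstOf W) = W.erase v := by
    ext i
    rw [mem_childOut, hW, Finset.mem_erase, Finset.mem_singleton, and_comm]
  have hout : childOut (childOut A (firstOf W)) (childOut W (firstOf W)) = childOut A W := by
    ext i
    simp only [mem_childOut, hW, Finset.mem_singleton]
    refine ⟨fun h => ⟨h.1.1, fun hi => h.2 ⟨hi, h.1.2⟩⟩, fun h => ⟨⟨h.1, ?_⟩, fun hi => h.2 hi.1⟩⟩
    rintro rfl
    exact h.2 hvW
  have hins : ∀ w ∈ W.erase v, G.childIn A W w =
      G.childIn (childOut A (firstOf W)) (childOut W (firstOf W)) w := by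
    intro w hw
    have hvw : v < w := lt_of_le_of_ne (hmin w (Finset.mem_of_mem_erase hw))
      (Finset.ne_of_mem_erase hw).symm
    ext i
    simp only [mem_childIn, mem_childOut, hW, Finset.mem_singleton]
    constructor
    · rintro ⟨h1, h2, h3⟩
      exact ⟨⟨h1, fun h => h2 (h ▸ ⟨hvW, hvw⟩)⟩, fun h => h2 ⟨h.1.1, h.2⟩, h3⟩
    · rintro ⟨h1, h2, h3⟩
      exact ⟨h1.1, fun h => h2 ⟨⟨h.1, h1.2⟩, h.2⟩, h3⟩
  rw [branchBound_empty, branchBound, branchBound, weightOut, weightOut, hout, herase, ← add_assoc,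
    ← Finset.add_sum_erase W _ hvW, weightIn, hin]
  congr 2
  refine Finset.sum_congr rfl fun w hw => ?_
  rw [weightIn, weightIn, hins w hw, herase]

end Split

end Digraph

/-! ### The recursive procedure -/

namespace TreeProg

open TreeData Digraph Polynomial

open scoped Classical

theorem mem_mergeLists {α : Type} {p : α → Prop} {c : α → α} {L₁ L₂ : List α} {T : α} :
    T ∈ mergeLists p c L₁ L₂ ↔ T ∈ L₁ ∧ p T ∨ T ∈ L₂ ∧ ¬ ∃ S ∈ L₁, p S ∧ c S = T := by
  simp [mergeLists]

theorem length_mergeLists_le {α : Type} (p : α → Prop) (c : α → α) (L₁ L₂ : List α) :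
    (mergeLists p c L₁ L₂).length ≤ L₁.length + L₂.length := by
  rw [mergeLists, List.length_append]
  exact add_le_add (List.length_filter_le _ _) (List.length_filter_le _ _)

theorem nodup_mergeLists {α : Type} {p : α → Prop} {c : α → α} {L₁ L₂ : List α} (h₁ : L₁.Nodup)
    (h₂ : L₂.Nodup) (h : ∀ T ∈ L₂, ¬ p T) : (mergeLists p c L₁ L₂).Nodup := by
  refine List.Nodup.append (h₁.filter _) (h₂.filter _) fun T hT hT' => ?_
  exact h T (List.mem_filter.1 hT').1 (by simpa using (List.mem_filter.1 hT).2)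

/-- The presentation of the task to list the maximal admissible subsets of `A` by first branching
on the members of `W`. -/
noncomputable def taskData {n : ℕ} (G : Digraph (Fin n)) (A W : Finset (Fin n)) : TreeData :=
  .cons (ofDigraph G) (.cons (ofFinset A) (ofFinset W))

/-- The recursive procedure, composed of its subroutines. -/
def solveBody (testW prepIn prepOut merge testB prepChoose leaf : TreeProg) : TreeProg :=
  .branch testW
    (.seq (.pair .id (.pair (.seq prepIn .call) (.seq prepOut .call))) merge)
    (.branch testB (.seq prepChoose .call) leaf)

/-- Branching can be continued on the members of `W`. -/
def IsTask {n : ℕ} (G : Digraph (Fin n)) (A W : Finset (Fin n)) : Prop :=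
  W ⊆ A ∧ (W.Nonempty → ∃ u ∈ A, u ∉ W ∧ ∀ w ∈ W, G.Nbr u w)

/-- A measure that decreases in each recursive call. -/
noncomputable def rank {n : ℕ} (A W : Finset (Fin n)) : ℕ := 2 * A.card + if W = ∅ then 1 else 0

/-- `L` lists the maximal admissible subsets of `A`. -/
def Lists {n : ℕ} (G : Digraph (Fin n)) (A : Finset (Fin n)) (L : List (Finset (Fin n))) : Prop :=
  L.Nodup ∧ ∀ S, S ∈ L ↔ G.IsPreferredIn A S

theorem Lists.merge {n : ℕ} {G : Digraph (Fin n)} {A W : Finset (Fin n)} {v : Fin n}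
    {L₁ L₂ : List (Finset (Fin n))} (hW : firstOf W = {v})
    (h₁ : Lists G (G.selectFirst A W) L₁) (h₂ : Lists G (childOut A (firstOf W)) L₂) :
    Lists G A (mergeLists (fun S => ∃ k, k ∈ S ∧ k ∈ firstOf W)
      (fun S => G.defenceCore (childOut S (firstOf W))) L₁ L₂) := by
  have hp : ∀ S : Finset (Fin n), (∃ k, k ∈ S ∧ k ∈ firstOf W) ↔ v ∈ S := by
    intro S
    rw [hW]
    simp
  refine ⟨nodup_mergeLists h₁.1 h₂.1 fun T hT hv => ?_, fun S => ?_⟩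
  · obtain ⟨k, hk, hkW⟩ := hv
    exact (mem_childOut.1 (((h₂.2 T).1 hT).prop.2 hk)).2 hkW
  · rw [mem_mergeLists, isPreferredIn_iff_split hW]
    simp only [hp, h₁.2, h₂.2]

section

variable {n T : ℕ} {G : Digraph (Fin n)}
  {testW prepIn prepOut testB prepChoose leaf test core : TreeProg} {φ : ℝ}

/-- A single call costs at most κ times its `branchBound`, apart from its subcalls. That bound is
additive under a split and does not grow when a good branching is chosen, so each level of the
recursion costs at most κ times the bound at the root, and there are at most `rank A W + 1` levels.
A leaf yields one set, so the bound also controls the lengths of the lists to be merged. -/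
theorem eval_solveBody (hφ : IsBranchingNumber φ)
    (htestW : ∀ A W g, ∃ t ≤ T, Eval g testW (taskData G A W) (bit (∃ k, k ∈ W)) t)
    (hprepIn : ∀ A W g, ∃ t ≤ T, Eval g prepIn (taskData G A W)
      (taskData G (G.selectFirst A W) ∅) t)
    (hprepOut : ∀ A W g, ∃ t ≤ T, Eval g prepOut (taskData G A W)
      (taskData G (childOut A (firstOf W)) (childOut W (firstOf W))) t)
    (htestB : ∀ A W g, ∃ t ≤ T, Eval g testB (taskData G A W)
      (bit (∃ k, k ∈ G.attackCore (G.reduct A))) t)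
    (hprepChoose : ∀ A W g, ∃ t ≤ T, Eval g prepChoose (taskData G A W)
      (taskData G (G.reduct A) (G.chooseBranch (G.reduct A))) t)
    (hleaf : ∀ A W g, ∃ t ≤ T, Eval g leaf (taskData G A W)
      (ofList [ofFinset (G.defenceCore (G.reduct A))]) t)
    (htest : ∀ A W S g, ∃ t ≤ T, Eval g test (.cons (taskData G A W) (ofFinset S))
      (bit (∃ k, k ∈ S ∧ k ∈ firstOf W)) t)
    (hcore : ∀ A W S g, ∃ t ≤ T, Eval g core (.cons (taskData G A W) (ofFinset S))
      (ofFinset (G.defenceCore (childOut S (firstOf W)))) t)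
    {f : TreeProg}
    (hf : f = solveBody testW prepIn prepOut (mergeProg test core) testB prepChoose leaf)
    (A W : Finset (Fin n)) (h : IsTask G A W) :
    ∃ (L : List (Finset (Fin n))) (t : ℕ), Lists G A L ∧ (L.length : ℝ) ≤ G.branchBound φ A W ∧
      (t : ℝ) ≤ ((15 * T + 180 * n + 630 : ℕ) : ℝ) * (rank A W + 1 : ℕ) * G.branchBound φ A W ∧
      Eval f f (taskData G A W) (ofList (L.map ofFinset)) t := by
  induction hr : rank A W using Nat.strong_induction_on generalizing A W with
  | _ r ih =>
  subst hr
  -- Merging takes at most 2 (B₁ + B₂)(6T + 90n + 300), since |L₁| + |L₂| + 1 ≤ 2 (B₁ + B₂); a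
  -- further 3T + 30 pays for the rest of the call.
  set κ := 15 * T + 180 * n + 630 with hκ
  have hφ1 := hφ.one_lt.le
  have hrun : ∀ {x y t}, Eval f (solveBody testW prepIn prepOut (mergeProg test core) testB
      prepChoose leaf) x y t → Eval f f x y t := fun h => by rwa [← hf] at h
  obtain ⟨tW, htW, hW⟩ := htestW A W f
  by_cases hne : ∃ k, k ∈ W
  · rw [bit_true hne] at hW
    obtain ⟨v, hvW, hmin, hfirst⟩ := exists_firstOf_eq hne
    obtain ⟨u, huA, huW, hu⟩ := h.2 hne
    have hrank : 2 * A.card ≤ rank A W := Nat.le_add_right _ _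
    -- Selecting `v` deletes `u`; the loss of 2 outweighs the 1 gained from the empty branching set.
    have hin : rank (G.selectFirst A W) ∅ + 1 ≤ rank A W := by
      have : (G.selectFirst A W).card < A.card := by
        refine Finset.card_lt_card ((Finset.ssubset_iff_of_subset fun i hi =>
          (mem_selectFirst.1 hi).1).2 ⟨u, huA, fun hn => ?_⟩)
        exact (mem_selectFirst.1 hn).2 v (by simp [hfirst]) (hu v hvW)
      rw [rank, if_pos rfl]
      omega
    have hout : rank (childOut A (firstOf W)) (childOut W (firstOf W)) + 1 ≤ rank A W := by
      have : (childOut A (firstOf W)).card < A.card := by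
        refine Finset.card_lt_card ((Finset.ssubset_iff_of_subset (childOut_subset _ _)).2
          ⟨v, h.1 hvW, fun hn => ?_⟩)
        exact (mem_childOut.1 hn).2 (by simp [hfirst])
      have : (if childOut W (firstOf W) = ∅ then 1 else 0) ≤ 1 := by split_ifs <;> simp
      rw [rank]
      omega
    have htask : IsTask G (childOut A (firstOf W)) (childOut W (firstOf W)) := by
      refine ⟨fun i hi => ?_, fun _ => ⟨u, mem_childOut.2 ⟨huA, fun hn => huW (mem_firstOf.1 hn).1⟩,
        fun hn => huW (childOut_subset _ _ hn), fun w hw => hu w (childOut_subset _ _ hw)⟩⟩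
      have := mem_childOut.1 hi
      exact mem_childOut.2 ⟨h.1 this.1, this.2⟩
    obtain ⟨L₁, t₁, hL₁, hlen₁, hb₁, h₁⟩ := ih _ hin (G.selectFirst A W) ∅ ⟨by simp, by simp⟩ rfl
    obtain ⟨L₂, t₂, hL₂, hlen₂, hb₂, h₂⟩ := ih _ hout _ _ htask rfl
    obtain ⟨ti, hti, hi⟩ := hprepIn A W f
    obtain ⟨tO, htO, ho⟩ := hprepOut A W f
    obtain ⟨tm, htm, hm⟩ := eval_mergeProg (htest A W) (hcore A W) L₁ L₂ f
    have hB := branchBound_split (G := G) (A := A) (φ := φ) hvW hmin hfirst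
    have hB₁ := one_le_branchBound (G := G) hφ1 (G.selectFirst A W) ∅
    have hB₂ := one_le_branchBound (G := G) hφ1 (childOut A (firstOf W)) (childOut W (firstOf W))
    set B₁ := G.branchBound φ (G.selectFirst A W) ∅
    set B₂ := G.branchBound φ (childOut A (firstOf W)) (childOut W (firstOf W))
    have he := hrun (.branch_cons hW
      (.seq (.pair (.id _ _) (.pair (.seq hi (.call h₁)) (.seq ho (.call h₂)))) hm))
    refine ⟨_, _, hL₁.merge hfirst hL₂, ?_, ?_, he⟩
    · rw [hB]
      refine le_trans ?_ (add_le_add hlen₁ hlen₂)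
      exact_mod_cast length_mergeLists_le _ _ _ _
    · have hb₁' : (t₁ : ℝ) ≤ κ * (rank A W : ℕ) * B₁ := hb₁.trans (by gcongr)
      have hb₂' : (t₂ : ℝ) ≤ κ * (rank A W : ℕ) * B₂ := hb₂.trans (by gcongr)
      have htm' : (tm : ℝ) ≤ (L₁.length + L₂.length + 1) * (6 * T + 90 * n + 300) := by
        exact_mod_cast htm
      have htm'' : (tm : ℝ) ≤ (2 * (B₁ + B₂)) * (6 * T + 90 * n + 300) := htm'.trans (by
        gcongr
        linarith)
      have hs : ((tW + (1 + (ti + (t₁ + 1) + 1 + (tO + (t₂ + 1) + 1) + 1) + 1 + tm + 1) + 1 : ℕ) : ℝ)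
          ≤ t₁ + t₂ + tm + (3 * T + 30) := by
        have : tW + (1 + (ti + (t₁ + 1) + 1 + (tO + (t₂ + 1) + 1) + 1) + 1 + tm + 1) + 1
          ≤ t₁ + t₂ + tm + (3 * T + 30) := by omega
        exact_mod_cast this
      have hc : (3 * T + 30 : ℝ) ≤ (3 * T + 30) * (B₁ + B₂) :=
        le_mul_of_one_le_right (by positivity) (by linarith)
      refine hs.trans ?_
      rw [hB, hκ]
      rw [hκ] at hb₁' hb₂'
      push_cast at hb₁' hb₂' ⊢
      linarith
  · rw [bit_false hne] at hW
    obtain rfl : W = ∅ := Finset.not_nonempty_iff_eq_empty.1 hne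
    obtain ⟨tB, htB, hB⟩ := htestB A ∅ f
    have hB1 := one_le_branchBound (G := G) hφ1 A ∅
    by_cases hcyc : ∃ k, k ∈ G.attackCore (G.reduct A)
    · rw [bit_true hcyc] at hB
      obtain ⟨hn, hsub, hgood, hu⟩ := (G.isReduced_reduct A).chooseBranch_spec hcyc
      -- The active set does not grow, and the branching set becomes nonempty.
      have hrank : rank (G.reduct A) (G.chooseBranch (G.reduct A)) + 1 ≤ rank A ∅ := by
        rw [rank, rank, if_neg hn.ne_empty, if_pos rfl]
        have := Finset.card_le_card (reduct_subset (G := G) A)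
        omega
      obtain ⟨L, t, hL, hlen, hb, ht⟩ := ih _ hrank (G.reduct A) (G.chooseBranch (G.reduct A))
        ⟨hsub.trans (attackCore_subset _), fun _ => hu⟩ rfl
      have hle := hgood.branchBound_le hφ
      rw [← branchBound_empty] at hle
      have h0 := zero_le_one.trans
        (one_le_branchBound (G := G) hφ1 (G.reduct A) (G.chooseBranch (G.reduct A)))
      obtain ⟨tc, htc, hc⟩ := hprepChoose A ∅ f
      have he := hrun (.branch_nil hW (.branch_cons hB (.seq hc (.call ht))))
      refine ⟨L, _, ⟨hL.1, fun S => (hL.2 S).trans isPreferredIn_reduct⟩, hlen.trans hle, ?_, he⟩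
      have hb' : (t : ℝ) ≤ κ * (rank A ∅ : ℕ) * G.branchBound φ A ∅ := hb.trans (by gcongr)
      have hs : ((tW + (tB + (tc + (t + 1) + 1) + 1) + 1 : ℕ) : ℝ) ≤ t + κ := by
        have : tW + (tB + (tc + (t + 1) + 1) + 1) + 1 ≤ t + κ := by omega
        exact_mod_cast this
      have hκB : (κ : ℝ) ≤ κ * G.branchBound φ A ∅ := le_mul_of_one_le_right (by positivity) hB1
      push_cast at hs ⊢
      linarith
    · rw [bit_false hcyc] at hB
      obtain ⟨tl, htl, hl⟩ := hleaf A ∅ f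
      have he := hrun (.branch_nil hW (.branch_nil hB hl))
      have hcf := (G.isReduced_reduct A).isConflictFree (Finset.not_nonempty_iff_eq_empty.1 hcyc)
      refine ⟨[G.defenceCore (G.reduct A)], _, ⟨by simp, fun S => ?_⟩, by simpa using hB1, ?_, he⟩
      · rw [← isPreferredIn_reduct, hcf.isPreferredIn_iff, List.mem_singleton]
      · have hs : ((tW + (tB + tl + 1) + 1 : ℕ) : ℝ) ≤ κ := by
          have : tW + (tB + tl + 1) + 1 ≤ κ := by omega
          exact_mod_cast this
        have h1 : (1 : ℝ) ≤ (rank A ∅ + 1 : ℕ) := by exact_mod_cast Nat.le_add_left _ _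
        refine hs.trans ?_
        rw [mul_assoc]
        exact le_mul_of_one_le_right (by positivity) (one_le_mul_of_one_le_of_one_le h1 hB1)

end

end TreeProg

/-! ### The enumeration algorithm -/

namespace TreeProg

open TreeData Digraph Polynomial

open scoped Classical

/-- A polynomial time computation on inputs of polynomial size. -/
theorem PolyTime.exists_bound {ι : Type} {x y : ι → TreeData} {n : ι → ℕ} (h : PolyTime x y)
    {R : ℕ[X]} (hR : ∀ i, (x i).size ≤ R.eval (n i)) :
    ∃ (p : TreeProg) (Q : ℕ[X]), ∀ i g, ∃ t ≤ Q.eval (n i), Eval g p (x i) (y i) t := by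
  obtain ⟨p, P, hp⟩ := h
  refine ⟨p, P.comp R, fun i g => ?_⟩
  obtain ⟨t, ht, h⟩ := (hp i).2 g
  rw [eval_comp]
  exact ⟨t, ht.trans (eval_mono_nat P (hR i)), h⟩

theorem size_ofDigraph_le {n : ℕ} (G : Digraph (Fin n)) :
    (ofDigraph G).size ≤ n * (4 * n + 2) + 1 := by
  rw [ofDigraph_eq]
  refine (size_ofList_le (m := 4 * n + 1) fun a ha => ?_).trans (by simp)
  obtain ⟨i, -, rfl⟩ := List.mem_map.1 ha
  refine (size_ofList_le (m := 3) fun b hb => ?_).trans (by simp; omega)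
  obtain ⟨j, -, rfl⟩ := List.mem_map.1 hb
  exact size_bit_le _

theorem size_taskData_le {n : ℕ} (G : Digraph (Fin n)) (A W : Finset (Fin n)) :
    (taskData G A W).size ≤ n * (4 * n + 2) + 8 * n + 5 := by
  have h1 := size_ofDigraph_le G
  have h2 := size_ofFinset_le A
  have h3 := size_ofFinset_le W
  rw [taskData, TreeData.size, TreeData.size]
  omega

/-- A digraph with two sets of vertices. -/
structure Task where
  /-- the number of vertices -/
  n : ℕ
  /-- the digraph -/
  G : Digraph (Fin n)
  /-- the active set -/
  A : Finset (Fin n)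
  /-- the branching set -/
  W : Finset (Fin n)

/-- The presentation of a task. -/
noncomputable def Task.data (k : Task) : TreeData := taskData k.G k.A k.W

/-- The presentation of a task with a further set of vertices. -/
noncomputable def Task.dataWith (k : Σ k : Task, Finset (Fin k.n)) : TreeData :=
  .cons k.1.data (ofFinset k.2)

theorem PolyTime.exists_subroutine {y : Task → TreeData} (h : PolyTime Task.data y) :
    ∃ (p : TreeProg) (Q : ℕ[X]), ∀ (n : ℕ) (G : Digraph (Fin n)) A W g, ∃ t ≤ Q.eval n,
      Eval g p (taskData G A W) (y ⟨n, G, A, W⟩) t := by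
  obtain ⟨p, Q, hp⟩ := h.exists_bound (R := 4 * X ^ 2 + 10 * X + 5) (n := fun k => k.n)
    fun k => (size_taskData_le k.G k.A k.W).trans_eq (by simp; ring)
  exact ⟨p, Q, fun n G A W => hp ⟨n, G, A, W⟩⟩

theorem PolyTime.exists_subroutine_with {y : (Σ k : Task, Finset (Fin k.n)) → TreeData}
    (h : PolyTime Task.dataWith y) :
    ∃ (p : TreeProg) (Q : ℕ[X]), ∀ (n : ℕ) (G : Digraph (Fin n)) A W S g, ∃ t ≤ Q.eval n,
      Eval g p (.cons (taskData G A W) (ofFinset S)) (y ⟨⟨n, G, A, W⟩, S⟩) t := by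
  obtain ⟨p, Q, hp⟩ := h.exists_bound (R := 4 * X ^ 2 + 14 * X + 7) (n := fun k => k.1.n) fun k => by
    have h1 := size_taskData_le k.1.G k.1.A k.1.W
    have h2 := size_ofFinset_le k.2
    rw [Task.dataWith, Task.data, TreeData.size]
    simp
    nlinarith
  exact ⟨p, Q, fun n G A W S => hp ⟨⟨n, G, A, W⟩, S⟩⟩

namespace Task

theorem polyTime_G : PolyTime data (fun k => ofDigraph k.G) := .fst (.refl _)
theorem polyTime_A : PolyTime data (fun k => ofFinset k.A) := .fst (.snd (.refl _))
theorem polyTime_W : PolyTime data (fun k => ofFinset k.W) := .snd (.snd (.refl _))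
theorem polyTime_n : PolyTime data (fun k => num k.n) := polyTime_G.order

theorem polyTime_reduct : PolyTime data (fun k => ofFinset (k.G.reduct k.A)) :=
  .reduct polyTime_G polyTime_A

theorem polyTime_firstOf : PolyTime data (fun k => ofFinset (firstOf k.W)) :=
  .firstOf polyTime_n polyTime_W

theorem polyTime_with {y : Task → TreeData} (h : PolyTime data y) :
    PolyTime dataWith (fun k => y k.1) := h.weak

theorem polyTime_set : PolyTime dataWith (fun k => ofFinset k.2) := .last _ _

theorem polyTime_core :
    PolyTime dataWith (fun k => ofFinset (k.1.G.defenceCore (childOut k.2 (firstOf k.1.W)))) :=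
  .defenceCore (polyTime_with polyTime_G) <|
    .childOut (polyTime_with polyTime_n) polyTime_set (polyTime_with polyTime_firstOf)

theorem polyTime_test :
    PolyTime dataWith (fun k => bit (∃ j, j ∈ k.2 ∧ j ∈ firstOf k.1.W)) :=
  .inter (x := dataWith) (n := fun k => k.1.n) (A := fun k => k.2) (W := fun k => firstOf k.1.W)
    (polyTime_with polyTime_n) polyTime_set (polyTime_with polyTime_firstOf)

end Task

open TreeProg.Task in
theorem exists_solveBody : ∃ (p : TreeProg) (Q : ℕ[X]), ∀ {φ : ℝ}, IsBranchingNumber φ →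
    ∀ (n : ℕ) (G : Digraph (Fin n)), ∃ (L : List (Finset (Fin n))) (t : ℕ),
      Lists G Finset.univ L ∧ (t : ℝ) ≤ (Q.eval n : ℕ) * G.branchBound φ Finset.univ ∅ ∧
      Eval p p (taskData G Finset.univ ∅) (ofList (L.map ofFinset)) t := by
  obtain ⟨testW, Q₁, h₁⟩ := (PolyTime.nonempty polyTime_n polyTime_W).exists_subroutine
  obtain ⟨prepIn, Q₂, h₂⟩ := (polyTime_G.pair ((PolyTime.selectFirst polyTime_G polyTime_A
    polyTime_W).pair (PolyTime.ofFinset_empty polyTime_n))).exists_subroutine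
  obtain ⟨prepOut, Q₃, h₃⟩ := (polyTime_G.pair ((PolyTime.childOut polyTime_n polyTime_A
    polyTime_firstOf).pair (PolyTime.childOut polyTime_n polyTime_W
      polyTime_firstOf))).exists_subroutine
  obtain ⟨testB, Q₄, h₄⟩ := (PolyTime.nonempty polyTime_n
    (PolyTime.attackCore polyTime_G polyTime_reduct)).exists_subroutine
  obtain ⟨prepChoose, Q₅, h₅⟩ := (polyTime_G.pair (polyTime_reduct.pair
    (PolyTime.chooseBranch polyTime_G polyTime_reduct))).exists_subroutine
  obtain ⟨leaf, Q₆, h₆⟩ := ((PolyTime.defenceCore polyTime_G polyTime_reduct).pair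
    (PolyTime.nil _)).exists_subroutine
  obtain ⟨test, Q₇, h₇⟩ := polyTime_test.exists_subroutine_with
  obtain ⟨core, Q₈, h₈⟩ := polyTime_core.exists_subroutine_with
  set Q := Q₁ + Q₂ + Q₃ + Q₄ + Q₅ + Q₆ + Q₇ + Q₈ with hQ
  have hle : ∀ n : ℕ, Q.eval n = Q₁.eval n + Q₂.eval n + Q₃.eval n + Q₄.eval n + Q₅.eval n +
      Q₆.eval n + Q₇.eval n + Q₈.eval n := fun n => by simp [hQ]
  refine ⟨solveBody testW prepIn prepOut (mergeProg test core) testB prepChoose leaf,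
    -- The constant κ times one more than the initial rank 2n + 1.
    (15 * Q + 180 * X + 630) * (2 * X + 2), fun {φ} hφ n G => ?_⟩
  have mono : ∀ {Q' : ℕ[X]}, Q'.eval n ≤ Q.eval n → ∀ {p : TreeProg} {x y : TreeData} {g : TreeProg},
      (∃ t ≤ Q'.eval n, Eval g p x y t) → ∃ t ≤ Q.eval n, Eval g p x y t :=
    fun h _ _ _ _ ⟨t, ht, he⟩ => ⟨t, ht.trans h, he⟩
  have hQn := hle n
  obtain ⟨L, t, hL, -, ht, he⟩ := eval_solveBody (T := Q.eval n) hφ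
    (fun A W g => mono (by omega) (h₁ n G A W g))
    (fun A W g => mono (by omega) (h₂ n G A W g))
    (fun A W g => mono (by omega) (h₃ n G A W g))
    (fun A W g => mono (by omega) (h₄ n G A W g))
    (fun A W g => mono (by omega) (h₅ n G A W g))
    (fun A W g => mono (by omega) (h₆ n G A W g))
    (fun A W S g => mono (by omega) (h₇ n G A W S g))
    (fun A W S g => mono (by omega) (h₈ n G A W S g)) rfl Finset.univ ∅ ⟨by simp, by simp⟩
  refine ⟨L, t, hL, ht.trans_eq ?_, he⟩
  rw [rank, Finset.card_univ, Fintype.card_fin, if_pos rfl]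
  simp [mul_assoc, add_assoc, one_add_one_eq_two]

theorem exists_enumeration : ∃ (p : TreeProg) (Q : ℕ[X]), ∀ {φ : ℝ}, IsBranchingNumber φ →
    ∀ (n : ℕ) (G : Digraph (Fin n)), ∃ t : ℕ, p.EnumeratesPreferredIn G t ∧
      (t : ℝ) ≤ (Q.eval n : ℕ) * (φ ^ (2 * G.resolutionOrder) * φ ^ (n - G.resolutionOrder)) := by
  obtain ⟨p, Q, hp⟩ := exists_solveBody
  have hG : PolyTime (fun k : Σ n, Digraph (Fin n) => ofDigraph k.2) (fun k => ofDigraph k.2) :=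
    .refl _
  obtain ⟨init, P, hinit⟩ := (hG.pair ((PolyTime.ofFinset_univ hG.order).pair
    (PolyTime.ofFinset_empty hG.order))).exists_bound (n := fun k => k.1)
    (R := 4 * X ^ 2 + 2 * X + 1) fun k => (size_ofDigraph_le k.2).trans_eq (by simp; ring)
  refine ⟨.seq init (.procedure p), P + Q + 2, fun {φ} hφ n G => ?_⟩
  obtain ⟨L, t, hL, ht, he⟩ := hp hφ n G
  obtain ⟨s, hs, he'⟩ := hinit ⟨n, G⟩ (.seq init (.procedure p))
  refine ⟨_, ⟨L, hL.1, fun S => (hL.2 S).trans isPreferredIn_univ, .seq he' (.procedure he)⟩, ?_⟩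
  have hr := G.resolutionOrder_le_card
  have hw := weight_le (G := G) (G.reduct Finset.univ)
  rw [Fintype.card_fin] at hr hw
  have hpow : G.branchBound φ Finset.univ ∅ ≤
      φ ^ (2 * G.resolutionOrder) * φ ^ (n - G.resolutionOrder) := by
    rw [branchBound_empty, ← pow_add]
    exact pow_le_pow_right₀ hφ.one_lt.le (by omega)
  have h1 := (one_le_branchBound (G := G) hφ.one_lt.le Finset.univ ∅).trans hpow
  set B := φ ^ (2 * G.resolutionOrder) * φ ^ (n - G.resolutionOrder)
  have ht' : (t : ℝ) ≤ (Q.eval n : ℕ) * B := ht.trans (by gcongr)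
  have hs' : (s : ℝ) ≤ (P.eval n : ℕ) := by exact_mod_cast hs
  have hs'' : ((P.eval n : ℕ) + 2 : ℝ) ≤ ((P.eval n : ℕ) + 2) * B :=
    le_mul_of_one_le_right (by positivity) h1
  have h2 : (2 : ℕ[X]).eval n = 2 := by simp
  rw [eval_add, eval_add, h2]
  push_cast
  linarith

end TreeProg

/-! ### Absorbing polynomial factors, and the final bounds -/

theorem Polynomial.exists_eval_le_mul_pow (Q : Polynomial ℕ) :
    ∃ C c : ℕ, ∀ n : ℕ, Q.eval n ≤ C * (n + 1) ^ c := by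
  induction Q using Polynomial.induction_on' with
  | add p q hp hq =>
    obtain ⟨C, c, hC⟩ := hp
    obtain ⟨D, d, hD⟩ := hq
    refine ⟨C + D, c + d, fun n => ?_⟩
    rw [Polynomial.eval_add, add_mul]
    refine add_le_add ((hC n).trans ?_) ((hD n).trans ?_)
    · exact Nat.mul_le_mul_left _ (Nat.pow_le_pow_right n.succ_pos (Nat.le_add_right _ _))
    · exact Nat.mul_le_mul_left _ (Nat.pow_le_pow_right n.succ_pos (Nat.le_add_left _ _))
  | monomial k a =>
    refine ⟨a, k, fun n => ?_⟩
    rw [Polynomial.eval_monomial]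
    exact Nat.mul_le_mul_left _ (Nat.pow_le_pow_left (Nat.le_succ n) _)

theorem exists_pow_mul_pow_le (c : ℕ) {ρ : ℝ} (h0 : 0 < ρ) (h1 : ρ < 1) :
    ∃ M : ℝ, ∀ n : ℕ, ((n : ℝ) + 1) ^ c * ρ ^ n ≤ M := by
  obtain ⟨M, hM⟩ := (tendsto_pow_const_mul_const_pow_of_abs_lt_one c
    (abs_lt.2 ⟨by linarith, h1⟩)).bddAbove_range
  refine ⟨M / ρ, fun n => (le_div_iff₀ h0).2 ?_⟩
  have := hM ⟨n + 1, rfl⟩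
  push_cast at this
  rwa [mul_assoc, ← pow_succ]

theorem mainTheorem5 :
    ∃ φ : ℝ,
      -- `φ` is the unique positive root of `1 - 1 / x - 1 / x ^ 8`
      (∀ x : ℝ, (0 < x ∧ 1 - x⁻¹ - (x ^ 8)⁻¹ = 0) ↔ x = φ) ∧
      φ < 1.2321 ∧ φ ^ 2 < 1.5180 ∧
      -- the number of preferred extensions
      (∃ C c : ℕ, ∀ (V : Type*) [Fintype V] (G : Digraph V),
        (G.numPreferred : ℝ) ≤
          min (φ ^ (2 * G.resolutionOrder) * φ ^ (Fintype.card V - G.resolutionOrder))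
            (min
              (C * ((Fintype.card V : ℝ) + 1) ^ c *
                ((1 + (2 : ℝ) ^ (1 / 4 : ℝ) - 1 / √2) ^ G.resolutionOrder *
                  (2 - 1 / √2) ^ (Fintype.card V - G.resolutionOrder)))
              ((3 : ℝ) ^ ((Fintype.card V : ℝ) / 3))) ∧
        (G.numPreferred : ℝ) ≤
          1.5180 ^ G.resolutionOrder * 1.2321 ^ (Fintype.card V - G.resolutionOrder)) ∧
      -- enumeration
      (∃ p : TreeProg, ∃ C c K : ℕ, ∀ (n : ℕ) (G : Digraph (Fin n)),
        ∃ t : ℕ, p.EnumeratesPreferredIn G t ∧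
          (t : ℝ) ≤ C * ((n : ℝ) + 1) ^ c *
            (φ ^ (2 * G.resolutionOrder) * φ ^ (n - G.resolutionOrder)) ∧
          (t : ℝ) ≤ K *
            (1.5180 ^ G.resolutionOrder * 1.2321 ^ (n - G.resolutionOrder))) := by
  obtain ⟨φ, hroot, h1, h2, hφ⟩ := exists_isBranchingNumber
  have hpos : 0 < φ := zero_lt_one.trans hφ.one_lt
  -- The averaging bound has no polynomial factor, so `C = 1` and `c = 0` will do.
  refine ⟨φ, hroot, h1, h2, ⟨1, 0, fun V _ G => ⟨le_min (Digraph.numPreferred_le_pow hφ G)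
    (le_min ?_ (Digraph.numPreferred_le_three_rpow G)), ?_⟩⟩, ?_⟩
  · simpa using Digraph.numPreferred_le_sqrt G
  · refine (Digraph.numPreferred_le_pow hφ G).trans ?_
    rw [pow_mul]
    gcongr
  · obtain ⟨p, Q, hp⟩ := TreeProg.exists_enumeration
    obtain ⟨C, c, hC⟩ := Q.exists_eval_le_mul_pow
    -- Replacing both bases by the decimal ones gains a factor `ρ` per vertex, `ρ ^ n` in all,
    -- against which the polynomial stays bounded.
    set ρ := max (φ ^ 2 / 1.5180) (φ / 1.2321) with hρ
    have hρ0 : 0 < ρ := lt_max_of_lt_left (by positivity)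
    have hρ1 : ρ < 1 := max_lt (by rw [div_lt_one (by norm_num)]; exact h2)
      (by rw [div_lt_one (by norm_num)]; exact h1)
    obtain ⟨M, hM⟩ := exists_pow_mul_pow_le c hρ0 hρ1
    have hr1 : φ ^ 2 ≤ ρ * 1.5180 := (div_le_iff₀ (by norm_num)).1 (le_max_left _ _)
    have hr2 : φ ≤ ρ * 1.2321 := (div_le_iff₀ (by norm_num)).1 (le_max_right _ _)
    refine ⟨p, C, c, ⌈C * M⌉₊, fun n G => ?_⟩
    obtain ⟨t, ht, hb⟩ := hp hφ n G
    have hb' : (t : ℝ) ≤ C * ((n : ℝ) + 1) ^ c *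
        (φ ^ (2 * G.resolutionOrder) * φ ^ (n - G.resolutionOrder)) := by
      refine hb.trans (mul_le_mul_of_nonneg_right ?_ (by positivity))
      exact_mod_cast hC n
    refine ⟨t, ht, hb', hb'.trans ?_⟩
    have hr := G.resolutionOrder_le_card
    rw [Fintype.card_fin] at hr
    have hpow : φ ^ (2 * G.resolutionOrder) * φ ^ (n - G.resolutionOrder) ≤
        ρ ^ n * (1.5180 ^ G.resolutionOrder * 1.2321 ^ (n - G.resolutionOrder)) := by
      calc φ ^ (2 * G.resolutionOrder) * φ ^ (n - G.resolutionOrder)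
          ≤ (ρ * 1.5180) ^ G.resolutionOrder * (ρ * 1.2321) ^ (n - G.resolutionOrder) := by
            rw [pow_mul]
            gcongr
        _ = ρ ^ (G.resolutionOrder + (n - G.resolutionOrder)) *
            (1.5180 ^ G.resolutionOrder * 1.2321 ^ (n - G.resolutionOrder)) := by
            rw [mul_pow, mul_pow, pow_add]
            ring
        _ = _ := by rw [Nat.add_sub_cancel' hr]
    calc C * ((n : ℝ) + 1) ^ c * (φ ^ (2 * G.resolutionOrder) * φ ^ (n - G.resolutionOrder))
        ≤ C * ((n : ℝ) + 1) ^ c *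
          (ρ ^ n * (1.5180 ^ G.resolutionOrder * 1.2321 ^ (n - G.resolutionOrder))) := by gcongr
      _ = C * (((n : ℝ) + 1) ^ c * ρ ^ n) *
          (1.5180 ^ G.resolutionOrder * 1.2321 ^ (n - G.resolutionOrder)) := by ring
      _ ≤ C * M * (1.5180 ^ G.resolutionOrder * 1.2321 ^ (n - G.resolutionOrder)) := by
        gcongr
        exact hM n
      _ ≤ _ := by
        gcongr
        exact Nat.le_ceil _
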